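/- Let $N_1,N_2,\dots$ be independent standard Gaussian variables (the coordinates of $\mathbb{R}^{\mathbb{N}}$ with the product Gaussian measure). Let $\mathcal{W}_m$ be the $m$-th Wiener chaos, i.e. the closed span in $L^2$ of the products $\prod_i H_{k_i}(N_i)$ of Hermite polynomials with $\sum_i k_i=m$, and let $\mathcal{W}_{\le m}=\bigoplus_{j\le m}\mathcal{W}_j$. For a polynomial $F$ in finitely many of the $N_i$ put $$\Gamma[F,F]=\sum_i\Big(\frac{\partial F}{\partial N_i}\Big)^2,\qquad \nabla^2F=\Big(\frac{\partial^2F}{\partial N_i\partial N_j}\Big)_{i,j},\qquad \sharp^k[F]=\sum_{i_1,\dots,i_k}\frac{\partial^kF}{\partial N_{i_1}\cdots\partial N_{i_k}}\,G_{1,i_1}\cdots G_{k,i_k},$$ where the $G_{j,i}$ are further standard Gaussian variables, independent of each other and of the $N_i$. In $\Gamma[\sharp^k[F],\sharp^k[F]]$ the derivatives are taken with respect to all the variables $N_i$ and $G_{j,i}$. By density (along polynomials of bounded degree converging in $L^2$), $\Gamma[F,F]\in L^1$ and $\sharp^k[F]\in L^2$ are defined for every $F\in\mathcal{W}_{\le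 m}$, and likewise $\Gamma$ on the finite sums of chaoses generated by all the $N_i$ and $G_{j,i}$. For a symmetric matrix $A$, finite or infinite and square summable, with eigenvalues $(\lambda_i)$ listed with multiplicity, the spectral remainders are $$\mathcal{R}_q(A)=\sum_{i_1,\dots,i_q\ \text{pairwise distinct}}\lambda_{i_1}^2\cdots\lambda_{i_q}^2 .$$ Negative powers of $0$ are $+\infty$, and $0^0=1$. Then the following hold. (1) For all $m,q\in\mathbb{N}$ there are $q'\in\mathbb{N}$ and $C>0$, depending only on $m$ and $q$, such that for every $K$ and every polynomial $F\in\mathbb{R}[N_1,\dots,N_K]$ of degree at most $m$ with $\operatorname{Var}F=1$, $$\mathbb{E}\big[\Gamma[F,F]^{-q}\big]\le C\,\mathbb{E}\big[\mathcal{R}_{q'}(\nabla^2F)^{-1/2}\big].$$ (2) For every $q\in\mathbb{N}$ there is $C>0$, depending only on $q$, such that every $F\in\mathcal{W}_2$ with $\mathbb{E}[F^2]\le 1$ can be written as $F=\sum_{i,j}a_{i,j}X_{i,j}$ in $L^2$ with a symmetric matrix $A=(a_{i,j})$, where $X_{i,j}=N_iN_j$ for $i\ne j$ and $X_{i,i}=N_i^2-1$,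 and $$\mathbb{E}\big[\Gamma[F,F]^{-q}\big]\le C\,\mathcal{R}_{2q+1}(A)^{-1/2}.$$ (3) For all $m,q,k\in\mathbb{N}$ with $k\le m$ there are $q'\in\mathbb{N}$ and $C>0$, depending only on $m,q,k$, such that for every $F\in\mathcal{W}_{\le m}$ with $\mathbb{E}[F^2]=1$, $$\mathbb{E}\big[\Gamma[F,F]^{-q}\big]\le C\,\mathbb{E}\big[\Gamma[\sharp^k[F],\sharp^k[F]]^{-q'}\big].$$ -/

import Mathlib

open MeasureTheory ProbabilityTheory Filter Topology
open scoped ENNReal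

noncomputable section

namespace GaussianChaos

/-- The law of a family of independent standard Gaussian variables indexed by `ι`.
The coordinate functions `x ↦ x i` are the variables themselves. -/
def wiener (ι : Type) : Measure (ι → ℝ) :=
  Measure.infinitePi (fun _ : ι => gaussianReal 0 1)

/-- `E[Y^{-p}]` for a nonnegative random variable `Y`, as an extended number, with `0^{-p} = ∞`
for `p > 0`. -/
def negMoment {Ω : Type} [MeasurableSpace Ω] (μ : Measure Ω) (Y : Ω → ℝ) (p : ℝ) : ℝ≥0∞ :=
  ∫⁻ x, ENNReal.ofReal (Y x) ^ (-p) ∂μ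

/-! ### Wiener chaoses -/

/-- The product `∏ i, H_{k i}(N_i)` of Hermite polynomials in the Gaussian variables. -/
def hermiteProduct {ι : Type} (k : ι →₀ ℕ) (x : ι → ℝ) : ℝ :=
  k.prod (fun i n => Polynomial.aeval (x i) (Polynomial.hermite n))

/-- The `m`-th Wiener chaos: the closed linear span in `L²` of the products
`∏ i, H_{k i}(N_i)` with `∑ i, k i = m`. -/
def chaos (ι : Type) (m : ℕ) : Submodule ℝ (Lp ℝ 2 (wiener ι)) :=
  (Submodule.span ℝ {f : Lp ℝ 2 (wiener ι) |
    ∃ k : ι →₀ ℕ, (k.sum fun _ n => n) = m ∧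
      (f : (ι → ℝ) → ℝ) =ᵐ[wiener ι] hermiteProduct k}).topologicalClosure

/-- The (finite) sum of the Wiener chaoses of order at most `m`. -/
def chaosLE (ι : Type) (m : ℕ) : Submodule ℝ (Lp ℝ 2 (wiener ι)) :=
  ⨆ k ∈ Finset.range (m + 1), chaos ι k

/-! ### The square field operator and the iterated sharp operators -/

/-- The square field operator `Γ[P,P] = ∑ i, (∂P/∂N_i)²` on polynomials. Only the finitely many
variables that occur in `P` contribute. -/
def gammaPoly {ι : Type} (P : MvPolynomial ι ℝ) : MvPolynomial ι ℝ :=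
  ∑ i ∈ P.vars, (MvPolynomial.pderiv i P) ^ 2

/-- The iterated partial derivative `∂^k P / ∂N_{i_1} ⋯ ∂N_{i_k}`. -/
def iterPderiv {ι : Type} {k : ℕ} (i : Fin k → ι) (P : MvPolynomial ι ℝ) : MvPolynomial ι ℝ :=
  (List.ofFn i).foldr (fun a Q => MvPolynomial.pderiv a Q) P

/-- The iterated sharp operator on polynomials,
`♯^k[P] = ∑ ∂^k P / ∂N_{i_1} ⋯ ∂N_{i_k} · G_{1,i_1} ⋯ G_{k,i_k}`, the sum being over
all `i_1, …, i_k`. It is a polynomial in the variables `N_i` (index `Sum.inl i`) and the new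
variables `G_{j,i}` (index `Sum.inr (j, i)`). -/
def sharpPoly {ι : Type} (k : ℕ) (P : MvPolynomial ι ℝ) :
    MvPolynomial (ι ⊕ (Fin k × ι)) ℝ :=
  ∑ i ∈ Fintype.piFinset (fun _ : Fin k => P.vars),
    MvPolynomial.rename Sum.inl (iterPderiv i P) * ∏ j, MvPolynomial.X (Sum.inr (j, i j))

/-- The polynomials `P n` have bounded degrees and, evaluated at the Gaussian variables, converge
to `F` in `L²`. A random variable is approximated in this way if and only if it belongs to some
`chaosLE ι m`. -/
def Approximates {ι : Type} (P : ℕ → MvPolynomial ι ℝ) (F : Lp ℝ 2 (wiener ι)) : Prop :=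
  (∃ m : ℕ, ∀ n, (P n).totalDegree ≤ m) ∧
    Tendsto (fun n => eLpNorm (fun x => MvPolynomial.eval x (P n) - F x) 2 (wiener ι))
      atTop (𝓝 0)

/-- `Γ[F,F]` for `F` in a finite sum of Wiener chaoses, defined by density: the limit in `L¹` of
`Γ[P n,P n]` for polynomials `P n` of bounded degrees that converge to `F` in `L²`. On polynomials
of bounded degrees `Γ` is continuous from `L²` to `L¹`, so that the limit exists
and does not depend on the approximation. -/
def gamma {ι : Type} (F : Lp ℝ 2 (wiener ι)) : Lp ℝ 1 (wiener ι) :=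
  Classical.epsilon fun Y : Lp ℝ 1 (wiener ι) =>
    ∃ P : ℕ → MvPolynomial ι ℝ, Approximates P F ∧
      Tendsto (fun n =>
        eLpNorm (fun x => MvPolynomial.eval x (gammaPoly (P n)) - Y x) 1 (wiener ι)) atTop (𝓝 0)

/-- `♯^k[F]` for `F` in a finite sum of Wiener chaoses, defined by density: the limit in `L²` of
`♯^k[P n]` for polynomials `P n` of bounded degrees that converge to `F` in `L²`. On polynomials
of bounded degrees `♯^k` is linear and continuous in `L²`, so that the limit exists
and does not depend on the approximation. -/
def sharp {ι : Type} (k : ℕ) (F : Lp ℝ 2 (wiener ι)) : Lp ℝ 2 (wiener (ι ⊕ (Fin k × ι))) :=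
  Classical.epsilon fun Y : Lp ℝ 2 (wiener (ι ⊕ (Fin k × ι))) =>
    ∃ P : ℕ → MvPolynomial ι ℝ, Approximates P F ∧
      Tendsto (fun n =>
        eLpNorm (fun x => MvPolynomial.eval x (sharpPoly k (P n)) - Y x) 2
          (wiener (ι ⊕ (Fin k × ι)))) atTop (𝓝 0)

/-! ### Spectral remainders -/

/-- For a family `lam` of eigenvalues, listed with multiplicity, the sum of
`lam_{i_1}² ⋯ lam_{i_q}²` over all `q`-tuples of pairwise distinct indices. -/
def spectralRemainder {κ : Type} (q : ℕ) (lam : κ → ℝ) : ℝ≥0∞ :=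
  ∑' i : Fin q ↪ κ, ∏ j, ENNReal.ofReal (lam (i j) ^ 2)

/-- The Hessian matrix `∇²P` at the point `x`. -/
def hessian {K : ℕ} (P : MvPolynomial (Fin K) ℝ) (x : Fin K → ℝ) : Matrix (Fin K) (Fin K) ℝ :=
  Matrix.of fun i j => MvPolynomial.eval x (MvPolynomial.pderiv i (MvPolynomial.pderiv j P))

theorem hessian_isHermitian {K : ℕ} (P : MvPolynomial (Fin K) ℝ) (x : Fin K → ℝ) :
    (hessian P x).IsHermitian := by
  have comm : ∀ i j : Fin K, MvPolynomial.pderiv i (MvPolynomial.pderiv j P)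
      = MvPolynomial.pderiv j (MvPolynomial.pderiv i P) := by
    intro i j
    have h : ⁅MvPolynomial.pderiv (R := ℝ) i, MvPolynomial.pderiv (R := ℝ) j⁆ = 0 := by
      apply MvPolynomial.derivation_ext
      intro l
      simp only [Derivation.commutator_apply, MvPolynomial.pderiv_X, Derivation.zero_apply]
      by_cases h1 : j = l <;> by_cases h2 : i = l <;> simp [h1, h2, eq_comm]
    have h' := congrArg (fun D => D P) h
    simpa [Derivation.commutator_apply, sub_eq_zero] using h'
  ext i j
  simp [hessian, Matrix.conjTranspose_apply, comm i j]

/-- `R_q(∇²P)` at the point `x`: the spectral remainder of the eigenvalues of the symmetric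
matrix `∇²P(x)`. -/
def hessianRemainder {K : ℕ} (q : ℕ) (P : MvPolynomial (Fin K) ℝ) (x : Fin K → ℝ) : ℝ≥0∞ :=
  spectralRemainder q (hessian_isHermitian P x).eigenvalues

/-- The variables `X_{i,j}`: `N_i N_j` for `i ≠ j` and `N_i² - 1` for `i = j`. -/
def quadVar (i j : ℕ) (x : ℕ → ℝ) : ℝ :=
  if i = j then x i ^ 2 - 1 else x i * x j

/-- `A` is the symmetric matrix with `F = ∑ i j, A i j X_{i,j}` in `L²`. (It is determined by `F`:
`A i j = E[F X_{i,j}] / 2`, and it is square summable.) -/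
def IsMatrixOf (A : Matrix ℕ ℕ ℝ) (F : Lp ℝ 2 (wiener ℕ)) : Prop :=
  A.IsSymm ∧
    Tendsto (fun K : ℕ => eLpNorm (fun x =>
        (∑ i ∈ Finset.range K, ∑ j ∈ Finset.range K, A i j * quadVar i j x) - F x) 2 (wiener ℕ))
      atTop (𝓝 0)

/-- The eigenspace in `ℓ²` of the infinite matrix `A` for the number `c`. -/
def eigenspace (A : Matrix ℕ ℕ ℝ) (c : ℝ) : Submodule ℝ (lp (fun _ : ℕ => ℝ) 2) where
  carrier := {v | ∀ i, HasSum (fun j => A i j * v j) (c * v i)}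
  zero_mem' := by intro i; simp
  add_mem' := by
    intro v w hv hw i
    simpa [mul_add] using (hv i).add (hw i)
  smul_mem' := by
    intro r v hv i
    simpa [mul_left_comm] using (hv i).mul_left r

/-- `R_q(A)` for a square summable symmetric infinite matrix `A`: the spectral remainder of its
nonzero eigenvalues, each repeated according to its multiplicity (which is finite). The eigenvalue
`0` contributes nothing. -/
def matrixRemainder (q : ℕ) (A : Matrix ℕ ℕ ℝ) : ℝ≥0∞ :=
  spectralRemainder q
    (fun s : (Σ c : {c : ℝ // c ≠ 0}, Fin (Module.finrank ℝ (eigenspace A c.1))) => s.1.1)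

end GaussianChaos

end

namespace GaussianChaos

/-! ### The Gaussian product measure -/

/-! The engine is the decay of E[cos(tX)] for a polynomial X in Gaussian variables. Integration by
parts along the gradient of X gains a factor 1/t and costs two negative powers of Γ[X,X] times a
polynomial weight. The weights arise from X by products, Γ and the Ornstein-Uhlenbeck operator, so
in bounded degree hypercontractivity bounds their second moments independently of the number of
variables. To avoid dividing by zero, Γ is replaced by Γ + ε, which gives |E cos(tX)| ≤ C (ε +
t^{-r}) (1 + E(Γ[X,X] + ε)^{-4r}); this is `exists_abs_integral_cos_le`.

Conditionally on the N_i and on the earlier G's, ♯^{k+1}[F] is a centred Gaussian with variance Σ_i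
(∂♯^k[F]/∂N_i)² ≤ Γ[♯^k[F],♯^k[F]]. Hence E exp(-t²Γ[♯^k F,♯^k F]/2) ≤ E cos(t ♯^{k+1}F)
(`integral_exp_gam_sharpRec_le`). So negative moments of Γ[♯^{k+1}F,♯^{k+1}F] give decay of the
Laplace transform of Γ[♯^k F,♯^k F], and that decay gives back negative moments of lower order
(`negMoment_le_of_laplace`). The estimates hold for polynomials at fixed ε, pass to chaos elements
by L¹ convergence, and then ε tends to 0 (`negMoment_le_of_regularized`). Iterating over k proves
(3).

For (1) one such step suffices, because Γ[♯F,♯F] is at least |∇²F · G|², which given N is a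
quadratic form in independent Gaussians. Its Laplace transform is ∏(1 + 2tλ_i²)^{-1/2}. Expanding
the product, its terms of degree p give a lower bound c_p t^p R_p for the product, so the transform
is at most C_p t^{-p/2} R_p^{-1/2} (`ofReal_le_spectralRemainder`).

In the second chaos Γ[F,F] is already a quadratic form, formally 4|AN|², so (2) needs no integration
by parts beyond the construction of the density extension. Finitely many orthonormal eigenvectors
and Bessel's inequality bound the truncated forms from below; completeness of the eigenvectors is
never needed.

The Laplace argument always leaves an additive 1. It is absorbed because the relevant Γ or Hessian
has bounded mean, so that its negative moments are bounded below (`one_le_mul_lintegral_rpow_neg`);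
in (2) because R_p(A) ≤ 1. -/

instance isProbabilityMeasure_wiener (ι : Type) : IsProbabilityMeasure (wiener ι) := by
  unfold wiener; infer_instance

theorem measurePreserving_comp {ι κ : Type} {f : κ → ι} (hf : Function.Injective f) :
    MeasurePreserving (fun (x : ι → ℝ) k => x (f k)) (wiener ι) (wiener κ) := by
  refine ⟨by fun_prop, ?_⟩
  have h : iIndepFun (fun (i : ι) (x : ι → ℝ) => x i) (wiener ι) :=
    iIndepFun_infinitePi (X := fun _ y => y) (fun _ => measurable_id)
  have h2 := (h.precomp hf).map_fun_eq_infinitePi_map (fun k => measurable_pi_apply _)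
  rw [h2]
  simp only [wiener, Measure.infinitePi_map_eval]

theorem measurePreserving_sumElim (κ κ' : Type) :
    MeasurePreserving (fun p : (κ → ℝ) × (κ' → ℝ) => Sum.elim p.1 p.2)
      ((wiener κ).prod (wiener κ')) (wiener (κ ⊕ κ')) := by
  have hm : Measurable (fun p : (κ → ℝ) × (κ' → ℝ) => Sum.elim p.1 p.2) := by
    refine measurable_pi_iff.2 ?_
    rintro (a | a) <;> simp only [Sum.elim_inl, Sum.elim_inr] <;> fun_prop
  refine ⟨hm, Measure.eq_infinitePi _ fun s t ht => ?_⟩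
  rw [Measure.map_apply hm (MeasurableSet.pi s.countable_toSet fun i _ => ht i)]
  have : (fun p : (κ → ℝ) × (κ' → ℝ) => (Sum.elim p.1 p.2 : κ ⊕ κ' → ℝ)) ⁻¹' Set.pi s t =
      (Set.pi (s.toLeft : Set κ) fun k => t (Sum.inl k)) ×ˢ
      (Set.pi (s.toRight : Set κ') fun k => t (Sum.inr k)) := by
    ext p
    simp [Set.mem_pi]
  rw [this, Measure.prod_prod, wiener, wiener, Measure.infinitePi_pi _ (fun i _ => ht _),
    Measure.infinitePi_pi _ (fun i _ => ht _), Finset.prod_sum_eq_prod_toLeft_mul_prod_toRight]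

theorem measurePreserving_prod {ι κ κ' : Type} {f : κ → ι} {g : κ' → ι}
    (h : Function.Injective (Sum.elim f g)) :
    MeasurePreserving (fun x : ι → ℝ => ((fun k => x (f k), fun k => x (g k)) :
      (κ → ℝ) × (κ' → ℝ))) (wiener ι) ((wiener κ).prod (wiener κ')) := by
  let e : (κ ⊕ κ' → ℝ) ≃ᵐ (κ → ℝ) × (κ' → ℝ) := MeasurableEquiv.sumPiEquivProdPi fun _ => ℝ
  have h1 : MeasurePreserving e.symm ((wiener κ).prod (wiener κ')) (wiener (κ ⊕ κ')) := by
    convert measurePreserving_sumElim κ κ' using 1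
    ext p i
    cases i <;> rfl
  exact h1.symm.comp (measurePreserving_comp h)

/-- Resampling one coordinate independently preserves the product law. This brings one-dimensional
Gaussian facts into an infinite product without splitting off a factor. -/
theorem measurePreserving_update {ι : Type} [DecidableEq ι] (i : ι) :
    MeasurePreserving (fun p : (ι → ℝ) × ℝ => Function.update p.1 i p.2)
      ((wiener ι).prod (gaussianReal 0 1)) (wiener ι) := by
  have hm : Measurable (fun p : (ι → ℝ) × ℝ => Function.update p.1 i p.2) := by
    refine measurable_pi_iff.2 fun j => ?_
    by_cases h : j = i
    · subst h; simpa using measurable_snd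
    · simp only [Function.update_of_ne h]; fun_prop
  refine ⟨hm, Measure.eq_infinitePi _ fun s t ht => ?_⟩
  rw [Measure.map_apply hm (MeasurableSet.pi s.countable_toSet fun i _ => ht i)]
  by_cases hi : i ∈ s
  · have : (fun p : (ι → ℝ) × ℝ => Function.update p.1 i p.2) ⁻¹' Set.pi s t =
        (Set.pi (s.erase i : Finset ι) t) ×ˢ t i := by
      ext p
      simp only [Set.mem_preimage, Set.mem_pi, Finset.mem_coe, Set.mem_prod, Finset.mem_erase]
      constructor
      · intro h
        exact ⟨fun j hj => by simpa [hj.1] using h j hj.2, by simpa using h i hi⟩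
      · rintro ⟨h1, h2⟩ j hj
        by_cases hji : j = i
        · subst hji; simpa using h2
        · simpa [hji] using h1 j ⟨hji, hj⟩
    rw [this, Measure.prod_prod, wiener, Measure.infinitePi_pi _ (fun i _ => ht _),
      Finset.prod_erase_mul s (fun i => gaussianReal 0 1 (t i)) hi]
  · have : (fun p : (ι → ℝ) × ℝ => Function.update p.1 i p.2) ⁻¹' Set.pi s t =
        (Set.pi s t) ×ˢ Set.univ := by
      ext p
      simp only [Set.mem_preimage, Set.mem_pi, Finset.mem_coe, Set.mem_prod, Set.mem_univ,
        and_true]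
      refine forall₂_congr fun j hj => ?_
      rw [Function.update_of_ne (by rintro rfl; exact hi hj)]
    rw [this, Measure.prod_prod, measure_univ, mul_one, wiener,
      Measure.infinitePi_pi _ (fun i _ => ht _)]

/-- Each multiplication by a variable costs a doubling of the exponent in Hölder's inequality, so
the induction runs over all finite exponents at once. -/
theorem memLp_eval {ι : Type} (P : MvPolynomial ι ℝ) {p : ℝ≥0∞} (hp : p ≠ ∞) :
    MemLp (fun x => MvPolynomial.eval x P) p (wiener ι) := by
  induction P using MvPolynomial.induction_on generalizing p with
  | C a => simpa using memLp_const a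
  | add P Q hP hQ => simp only [map_add]; exact (hP hp).add (hQ hp)
  | mul_X P i hP =>
    have h2 : (2 * p) ≠ ∞ := ENNReal.mul_ne_top (by simp) hp
    have hX : MemLp (fun x : ι → ℝ => x i) (2 * p) (wiener ι) :=
      (memLp_id_gaussianReal' (2 * p) h2).comp_measurePreserving
        (measurePreserving_eval_infinitePi (fun _ : ι => gaussianReal 0 1) i)
    have : ENNReal.HolderTriple (2 * p) (2 * p) p := ⟨by
      rw [ENNReal.mul_inv (by simp) (by simp), ← add_mul, ENNReal.inv_two_add_inv_two, one_mul]⟩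
    simpa using hX.mul' (hP h2)

theorem integrable_eval {ι : Type} (P : MvPolynomial ι ℝ) :
    Integrable (fun x => MvPolynomial.eval x P) (wiener ι) :=
  memLp_one_iff_integrable.1 (memLp_eval P (by simp))

theorem measurable_eval {ι : Type} (P : MvPolynomial ι ℝ) :
    Measurable (fun x : ι → ℝ => MvPolynomial.eval x P) := by
  induction P using MvPolynomial.induction_on with
  | C a => simp
  | add P Q hP hQ => simp only [map_add]; exact hP.add hQ
  | mul_X P i hP =>
    simp only [map_mul, MvPolynomial.eval_X]; exact hP.mul (measurable_pi_apply i)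

/-! ### Gaussian integration by parts -/

/-- The standard Gaussian density φ satisfies φ'(y) = -y φ(y), so this is integration by parts on
the line. -/
theorem integral_mul_gaussianReal {f f' : ℝ → ℝ} (hf : ∀ y, HasDerivAt f (f' y) y)
    (h0 : Integrable f (gaussianReal 0 1)) (h1 : Integrable f' (gaussianReal 0 1))
    (h2 : Integrable (fun y => y * f y) (gaussianReal 0 1)) :
    ∫ y, y * f y ∂(gaussianReal 0 1) = ∫ y, f' y ∂(gaussianReal 0 1) := by
  have key : ∀ g : ℝ → ℝ, Integrable g (gaussianReal 0 1) →
      Integrable (fun y => gaussianPDFReal 0 1 y * g y) := by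
    intro g hg
    rw [gaussianReal_of_var_ne_zero _ one_ne_zero,
      integrable_withDensity_iff_integrable_smul' (measurable_gaussianPDF _ _)
        (ae_of_all _ fun _ => gaussianPDF_lt_top)] at hg
    simpa [toReal_gaussianPDF] using hg
  rw [integral_gaussianReal_eq_integral_smul one_ne_zero,
    integral_gaussianReal_eq_integral_smul one_ne_zero]
  have hd : ∀ y : ℝ, HasDerivAt (gaussianPDFReal 0 1) (-y * gaussianPDFReal 0 1 y) y := by
    intro y
    have : HasDerivAt (fun y : ℝ => (√(2 * Real.pi * 1))⁻¹ * Real.exp (-(y - 0) ^ 2 / (2 * 1)))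
        ((√(2 * Real.pi * 1))⁻¹ * (Real.exp (-(y - 0) ^ 2 / (2 * 1)) *
          (-(2 * (y - 0) ^ (2 - 1) * 1) / (2 * 1)))) y :=
      ((((((hasDerivAt_id y).sub_const 0).pow 2).neg).div_const _).exp).const_mul _
    convert this using 1
    · simp [gaussianPDFReal_def]
    · rw [gaussianPDFReal_def]
      simp only [NNReal.coe_one]
      ring
  have := integral_mul_deriv_eq_deriv_mul_of_integrable (u := gaussianPDFReal 0 1) (v := f)
    (fun y _ => hd y) (fun y _ => hf y) (key _ h1)
    (by simpa [Pi.mul_def, mul_assoc, mul_left_comm] using (key _ h2).neg) (key _ h0)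
  simp only [smul_eq_mul]
  rw [this, ← integral_neg]
  congr 1
  ext y
  ring

theorem integral_coord_mul {ι : Type} [DecidableEq ι] (i : ι) {f f' : (ι → ℝ) → ℝ}
    (hf : ∀ (x : ι → ℝ) (y : ℝ),
      HasDerivAt (fun y => f (Function.update x i y)) (f' (Function.update x i y)) y)
    (h0 : Integrable f (wiener ι)) (h1 : Integrable f' (wiener ι))
    (h2 : Integrable (fun x => x i * f x) (wiener ι)) :
    ∫ x, x i * f x ∂(wiener ι) = ∫ x, f' x ∂(wiener ι) := by
  have mp := measurePreserving_update i
  have tr : ∀ g : (ι → ℝ) → ℝ, Integrable g (wiener ι) → ∫ x, g x ∂(wiener ι) =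
      ∫ x, ∫ y, g (Function.update x i y) ∂(gaussianReal 0 1) ∂(wiener ι) := by
    intro g hg
    have hg' := hg
    rw [← mp.map_eq] at hg'
    conv_lhs => rw [← mp.map_eq]
    rw [integral_map mp.measurable.aemeasurable hg'.1]
    exact integral_prod _ (mp.integrable_comp_of_integrable hg)
  have ti : ∀ g : (ι → ℝ) → ℝ, Integrable g (wiener ι) → ∀ᵐ x ∂(wiener ι),
      Integrable (fun y => g (Function.update x i y)) (gaussianReal 0 1) := fun g hg =>
    (mp.integrable_comp_of_integrable hg).prod_right_ae
  rw [tr _ h2, tr _ h1]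
  refine integral_congr_ae ?_
  filter_upwards [ti _ h0, ti _ h1, ti _ h2] with x a0 a1 a2
  simp only [Function.update_self] at a2 ⊢
  exact integral_mul_gaussianReal (hf x) a0 a1 a2

/-- The polynomial function is differentiable along coordinates. -/
theorem hasDerivAt_eval_update {ι : Type} [DecidableEq ι] (i : ι) (P : MvPolynomial ι ℝ)
    (x : ι → ℝ) (y : ℝ) :
    HasDerivAt (fun y => MvPolynomial.eval (Function.update x i y) P)
      (MvPolynomial.eval (Function.update x i y) (MvPolynomial.pderiv i P)) y := by
  induction P using MvPolynomial.induction_on with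
  | C a => simpa using hasDerivAt_const y a
  | add P Q hP hQ => simp only [map_add]; exact hP.add hQ
  | mul_X P j hP =>
    have hX : HasDerivAt (fun y => Function.update x i y j)
        (MvPolynomial.eval (Function.update x i y)
          (MvPolynomial.pderiv i (MvPolynomial.X j : MvPolynomial ι ℝ))) y := by
      by_cases h : j = i
      · subst h; simpa using hasDerivAt_id' y
      · simpa [MvPolynomial.pderiv_X_of_ne h, Function.update_of_ne h] using
          hasDerivAt_const y (x j)
    have := hP.mul hX
    simp only [MvPolynomial.pderiv_mul, map_add, map_mul, MvPolynomial.eval_X]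
    exact this

/-! ### Polynomials in Gaussian variables and the Ornstein-Uhlenbeck operator -/

/-- The expectation of a polynomial in the Gaussian variables. -/
noncomputable def expect {ι : Type} : MvPolynomial ι ℝ →ₗ[ℝ] ℝ where
  toFun P := ∫ x, MvPolynomial.eval x P ∂(wiener ι)
  map_add' P Q := by
    simp only [map_add]
    exact integral_add (integrable_eval P) (integrable_eval Q)
  map_smul' c P := by
    simp only [MvPolynomial.smul_eval, RingHom.id_apply, smul_eq_mul]
    exact integral_const_mul _ _

theorem expect_apply {ι : Type} (P : MvPolynomial ι ℝ) :
    expect P = ∫ x, MvPolynomial.eval x P ∂(wiener ι) := rfl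

theorem expect_C {ι : Type} (c : ℝ) : expect (MvPolynomial.C c : MvPolynomial ι ℝ) = c := by
  simp [expect_apply]

theorem expect_one {ι : Type} : expect (1 : MvPolynomial ι ℝ) = 1 := expect_C 1

theorem expect_mono {ι : Type} {P Q : MvPolynomial ι ℝ}
    (h : ∀ x, MvPolynomial.eval x P ≤ MvPolynomial.eval x Q) : expect P ≤ expect Q :=
  integral_mono (integrable_eval P) (integrable_eval Q) h

theorem expect_nonneg {ι : Type} {P : MvPolynomial ι ℝ}
    (h : ∀ x, 0 ≤ MvPolynomial.eval x P) : 0 ≤ expect P :=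
  integral_nonneg h

theorem expect_sq_nonneg {ι : Type} (P : MvPolynomial ι ℝ) : 0 ≤ expect (P ^ 2) :=
  expect_nonneg fun x => by simpa using sq_nonneg _

theorem expect_C_mul {ι : Type} (c : ℝ) (P : MvPolynomial ι ℝ) :
    expect (MvPolynomial.C c * P) = c * expect P := by
  rw [← MvPolynomial.smul_eq_C_mul, map_smul, smul_eq_mul]

/-- The algebraic form of Gaussian integration by parts, from which the exact moment identities for
polynomials follow. -/
theorem expect_X_mul {ι : Type} (i : ι) (P : MvPolynomial ι ℝ) :
    expect (MvPolynomial.X i * P) = expect (MvPolynomial.pderiv i P) := by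
  classical
  have := integral_coord_mul i (fun x y => hasDerivAt_eval_update i P x y) (integrable_eval P)
    (integrable_eval _) (by
      simp only [← MvPolynomial.eval_X (R := ℝ) i, ← map_mul]
      exact integrable_eval (MvPolynomial.X i * P))
  simpa [expect_apply] using this

/-- The carré du champ restricted to the variables in `s`. -/
noncomputable def gam {ι : Type} (s : Finset ι) (P Q : MvPolynomial ι ℝ) : MvPolynomial ι ℝ :=
  ∑ i ∈ s, MvPolynomial.pderiv i P * MvPolynomial.pderiv i Q

/-- The Ornstein-Uhlenbeck operator in the variables in `s`. -/
noncomputable def ou {ι : Type} (s : Finset ι) : MvPolynomial ι ℝ →ₗ[ℝ] MvPolynomial ι ℝ where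
  toFun P := ∑ i ∈ s, (MvPolynomial.pderiv i (MvPolynomial.pderiv i P) -
    MvPolynomial.X i * MvPolynomial.pderiv i P)
  map_add' P Q := by
    rw [← Finset.sum_add_distrib]
    refine Finset.sum_congr rfl fun i _ => ?_
    simp only [map_add]; ring
  map_smul' c P := by
    rw [RingHom.id_apply, Finset.smul_sum]
    refine Finset.sum_congr rfl fun i _ => ?_
    simp only [Derivation.map_smul, smul_sub, mul_smul_comm]

theorem ou_apply {ι : Type} (s : Finset ι) (P : MvPolynomial ι ℝ) :
    ou s P = ∑ i ∈ s, (MvPolynomial.pderiv i (MvPolynomial.pderiv i P) -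
      MvPolynomial.X i * MvPolynomial.pderiv i P) := rfl

theorem ou_C {ι : Type} (s : Finset ι) (c : ℝ) : ou s (MvPolynomial.C c) = 0 := by
  simp [ou_apply]

theorem gam_comm {ι : Type} (s : Finset ι) (P Q : MvPolynomial ι ℝ) : gam s P Q = gam s Q P := by
  simp [gam, mul_comm]

theorem eval_gam_self {ι : Type} (s : Finset ι) (P : MvPolynomial ι ℝ) (x : ι → ℝ) :
    MvPolynomial.eval x (gam s P P) =
      ∑ i ∈ s, (MvPolynomial.eval x (MvPolynomial.pderiv i P)) ^ 2 := by
  simp [gam, sq]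

theorem eval_gam_self_nonneg {ι : Type} (s : Finset ι) (P : MvPolynomial ι ℝ) (x : ι → ℝ) :
    0 ≤ MvPolynomial.eval x (gam s P P) := by
  rw [eval_gam_self]; positivity

theorem ou_mul {ι : Type} (s : Finset ι) (P Q : MvPolynomial ι ℝ) :
    ou s (P * Q) = P * ou s Q + Q * ou s P + 2 * gam s P Q := by
  simp only [ou_apply, gam, Finset.mul_sum, ← Finset.sum_add_distrib]
  refine Finset.sum_congr rfl fun i _ => ?_
  simp only [MvPolynomial.pderiv_mul, map_add]
  ring

theorem expect_mul_ou {ι : Type} (s : Finset ι) (P Q : MvPolynomial ι ℝ) :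
    expect (P * ou s Q) = - expect (gam s P Q) := by
  simp only [ou_apply, gam, Finset.mul_sum, map_sum, ← Finset.sum_neg_distrib]
  refine Finset.sum_congr rfl fun i _ => ?_
  have h := expect_X_mul i (P * MvPolynomial.pderiv i Q)
  rw [MvPolynomial.pderiv_mul, map_add] at h
  rw [mul_sub, map_sub, mul_left_comm, h]
  ring

theorem expect_ou_mul {ι : Type} (s : Finset ι) (P Q : MvPolynomial ι ℝ) :
    expect (ou s P * Q) = expect (P * ou s Q) := by
  rw [mul_comm, expect_mul_ou, expect_mul_ou, gam_comm]

/-! ### Supports and degrees under differentiation, and chaos decomposition -/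

theorem pderiv_mem_supported {ι : Type} {s : Set ι} {P : MvPolynomial ι ℝ}
    (hP : P ∈ MvPolynomial.supported ℝ s) (i : ι) :
    MvPolynomial.pderiv i P ∈ MvPolynomial.supported ℝ s := by
  classical
  induction hP using Algebra.adjoin_induction with
  | mem x hx =>
    obtain ⟨j, hj, rfl⟩ := hx
    rw [MvPolynomial.pderiv_X, Pi.single_apply]
    split_ifs
    · exact one_mem _
    · exact zero_mem _
  | algebraMap r => rw [MvPolynomial.algebraMap_eq, MvPolynomial.pderiv_C]; exact zero_mem _
  | add x y _ _ hx hy => rw [map_add]; exact add_mem hx hy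
  | mul x y hx' hy' hx hy =>
    rw [MvPolynomial.pderiv_mul]; exact add_mem (mul_mem hx hy') (mul_mem hx' hy)

theorem ou_mem_supported {ι : Type} {s : Finset ι} {P : MvPolynomial ι ℝ}
    (hP : P ∈ MvPolynomial.supported ℝ (s : Set ι)) :
    ou s P ∈ MvPolynomial.supported ℝ (s : Set ι) := by
  refine sum_mem fun i hi => sub_mem (pderiv_mem_supported (pderiv_mem_supported hP i) i)
    (mul_mem ?_ (pderiv_mem_supported hP i))
  exact MvPolynomial.X_mem_supported.2 hi

theorem totalDegree_pderiv_le {ι : Type} (i : ι) (P : MvPolynomial ι ℝ) :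
    (MvPolynomial.pderiv i P).totalDegree ≤ P.totalDegree - 1 := by
  classical
  rw [MvPolynomial.totalDegree, Finset.sup_le_iff]
  intro m hm
  rw [MvPolynomial.mem_support_iff, MvPolynomial.coeff_pderiv] at hm
  have h1 : m + Finsupp.single i 1 ∈ P.support :=
    MvPolynomial.mem_support_iff.2 (left_ne_zero_of_mul hm)
  have h2 := MvPolynomial.le_totalDegree h1
  rw [Finsupp.sum_add_index' (by simp) (by simp), Finsupp.sum_single_index rfl] at h2
  omega

theorem totalDegree_ou_le {ι : Type} {s : Finset ι} {P : MvPolynomial ι ℝ} {a : ℕ}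
    (hP : P.totalDegree ≤ a) : (ou s P).totalDegree ≤ a := by
  refine MvPolynomial.totalDegree_finsetSum_le fun i _ => ?_
  refine (MvPolynomial.totalDegree_sub _ _).trans (max_le ?_ ?_)
  · have h1 := totalDegree_pderiv_le i P
    have h2 := totalDegree_pderiv_le i (MvPolynomial.pderiv i P)
    omega
  · by_cases h0 : MvPolynomial.pderiv i P = 0
    · simp [h0]
    by_cases h00 : P.totalDegree = 0
    · rw [MvPolynomial.totalDegree_eq_zero_iff_eq_C] at h00
      rw [h00, MvPolynomial.pderiv_C] at h0
      exact absurd rfl h0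
    have h1 := totalDegree_pderiv_le i P
    have h3 := MvPolynomial.totalDegree_mul (MvPolynomial.X i) (MvPolynomial.pderiv i P)
    rw [MvPolynomial.totalDegree_X] at h3
    omega

/-- By Euler's identity a monomial of degree e is sent by the Ornstein-Uhlenbeck operator to -e
times itself plus terms of degree e - 2. Adding d + 1 thus cancels the part of degree d + 1. The
support condition makes the sum over `s` see every exponent. -/
theorem totalDegree_ou_add_smul_le {ι : Type} {s : Finset ι} {P : MvPolynomial ι ℝ} {d : ℕ}
    (hP : P ∈ MvPolynomial.supported ℝ (s : Set ι)) (hd : P.totalDegree ≤ d + 1) :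
    (ou s P + ((d + 1 : ℕ) : ℝ) • P).totalDegree ≤ d := by
  classical
  have hlin : ou s P + ((d + 1 : ℕ) : ℝ) • P =
      ∑ m ∈ P.support, (ou s (MvPolynomial.monomial m (P.coeff m)) +
        ((d + 1 : ℕ) : ℝ) • MvPolynomial.monomial m (P.coeff m)) := by
    rw [Finset.sum_add_distrib, ← Finset.smul_sum, ← map_sum, ← MvPolynomial.as_sum]
  rw [hlin]
  refine MvPolynomial.totalDegree_finsetSum_le fun m hm => ?_
  have hdeg : (m.sum fun _ e => e) ≤ d + 1 := (MvPolynomial.le_totalDegree hm).trans hd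
  have hs : m.support ⊆ s := by
    intro i hi
    rw [MvPolynomial.mem_supported] at hP
    exact_mod_cast hP (Finset.mem_coe.2 ((MvPolynomial.mem_vars_iff_mem_support i).2 ⟨m, hm, hi⟩))
  set c := P.coeff m
  have e1 : ou s (MvPolynomial.monomial m c) + ((d + 1 : ℕ) : ℝ) • MvPolynomial.monomial m c =
      ∑ i ∈ s, MvPolynomial.pderiv i (MvPolynomial.pderiv i (MvPolynomial.monomial m c)) +
      ((d + 1 : ℕ) - ((m.sum fun _ e => e : ℕ) : ℝ)) • MvPolynomial.monomial m c := by
    have : ∑ i ∈ s, MvPolynomial.X i * MvPolynomial.pderiv i (MvPolynomial.monomial m c) =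
        ((m.sum fun _ e => e : ℕ) : ℝ) • MvPolynomial.monomial m c := by
      rw [Finsupp.sum_of_support_subset m hs (fun _ e => e) (by simp), Nat.cast_sum,
        Finset.sum_smul]
      refine Finset.sum_congr rfl fun i _ => ?_
      rw [MvPolynomial.X_mul_pderiv_monomial, Nat.cast_smul_eq_nsmul]
    rw [ou_apply, Finset.sum_sub_distrib, this, sub_smul]
    abel
  rw [e1]
  have hmon : (MvPolynomial.monomial m c).totalDegree ≤ m.sum fun _ e => e :=
    MvPolynomial.totalDegree_monomial_le m c
  refine (MvPolynomial.totalDegree_add _ _).trans (max_le ?_ ?_)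
  · refine MvPolynomial.totalDegree_finsetSum_le fun i _ => ?_
    have h1 := totalDegree_pderiv_le i (MvPolynomial.monomial m c)
    have h2 := totalDegree_pderiv_le i (MvPolynomial.pderiv i (MvPolynomial.monomial m c))
    omega
  · by_cases h : (m.sum fun _ e => e) = d + 1
    · simp [h]
    · refine (MvPolynomial.totalDegree_smul_le _ _).trans ?_
      omega

/-- Decomposition of a polynomial into eigenvectors of the Ornstein-Uhlenbeck operator. -/
theorem exists_chaos_decomposition {ι : Type} {s : Finset ι} (d : ℕ) :
    ∀ P ∈ MvPolynomial.supported ℝ (s : Set ι), P.totalDegree ≤ d →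
    ∃ p : ℕ → MvPolynomial ι ℝ, P = ∑ j ∈ Finset.range (d + 1), p j ∧
      (∀ j, ou s (p j) = -((j : ℝ) • p j)) ∧ ∃ c, p 0 = MvPolynomial.C c := by
  induction d with
  | zero =>
    intro P _ hd
    have h0 := MvPolynomial.totalDegree_eq_zero_iff_eq_C.1 (Nat.le_zero.1 hd)
    refine ⟨fun j => if j = 0 then P else 0, by simp, fun j => ?_, _, by simpa using h0⟩
    by_cases hj : j = 0
    · simp only [hj, if_true]; rw [h0, ou_C]; simp
    · simp [hj]
  | succ d ih =>
    intro P hP hd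
    obtain ⟨q, hq1, hq2, c, hq3⟩ := ih (ou s P + ((d + 1 : ℕ) : ℝ) • P)
      (add_mem (ou_mem_supported hP) (Subalgebra.smul_mem _ hP _))
      (totalDegree_ou_add_smul_le hP hd)
    -- On the eigencomponent `q j` the operator ou + (d + 1) is multiplication by d + 1 - j ≠ 0, so
    -- it is inverted there. Then `R` and `P` have the same image, and `P - R` lies in the kernel:
    -- it is the component of order d + 1.
    set R : MvPolynomial ι ℝ := ∑ j ∈ Finset.range (d + 1), ((d + 1 : ℝ) - j)⁻¹ • q j with hR
    have hLR : ou s R + ((d + 1 : ℕ) : ℝ) • R = ou s P + ((d + 1 : ℕ) : ℝ) • P := by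
      rw [hq1, hR, map_sum, Finset.smul_sum, ← Finset.sum_add_distrib]
      refine Finset.sum_congr rfl fun j hj => ?_
      have hj' : (j : ℝ) < d + 1 := by exact_mod_cast Finset.mem_range.1 hj
      have hne : (d + 1 : ℝ) - j ≠ 0 := by linarith
      rw [map_smul, hq2, smul_neg, smul_smul, smul_smul, ← neg_smul, ← add_smul]
      have : -(((d + 1 : ℝ) - j)⁻¹ * j) + ((d + 1 : ℕ) : ℝ) * ((d + 1 : ℝ) - j)⁻¹ = 1 := by
        push_cast
        field_simp
        ring
      rw [this, one_smul]
    refine ⟨fun j => if j = d + 1 then P - R else ((d + 1 : ℝ) - j)⁻¹ • q j, ?_, fun j => ?_,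
      (d + 1 : ℝ)⁻¹ * c, ?_⟩
    · rw [Finset.sum_range_succ, if_pos rfl, Finset.sum_congr rfl (g := fun j : ℕ =>
        ((d + 1 : ℝ) - j)⁻¹ • q j) (fun j hj => if_neg (Finset.mem_range.1 hj).ne)]
      simp [hR]
    · by_cases hj : j = d + 1
      · simp only [hj, if_true, map_sub, smul_sub]
        linear_combination (exp := 1) - hLR
      · simp only [hj, if_false, map_smul, hq2, smul_neg]
        rw [smul_comm]
    · simp [hq3, MvPolynomial.smul_eq_C_mul]

/-! ### Orthogonality of the eigencomponents and Poincaré inequalities -/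

theorem expect_mul_eq_zero_of_ou {ι : Type} {s : Finset ι} {P Q : MvPolynomial ι ℝ} {a b : ℝ}
    (hP : ou s P = -(a • P)) (hQ : ou s Q = -(b • Q)) (hab : a ≠ b) : expect (P * Q) = 0 := by
  have h := expect_ou_mul s P Q
  rw [hP, hQ, neg_mul, mul_neg, smul_mul_assoc, mul_smul_comm, map_neg, map_neg, map_smul,
    map_smul, smul_eq_mul, smul_eq_mul] at h
  have h2 : (a - b) * expect (P * Q) = 0 := by linarith
  exact (mul_eq_zero.1 h2).resolve_left (sub_ne_zero.2 hab)

theorem expect_sum_smul_mul_sum_smul {ι : Type} {s : Finset ι} {p : ℕ → MvPolynomial ι ℝ}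
    (hp : ∀ j, ou s (p j) = -((j : ℝ) • p j)) (n : ℕ) (a b : ℕ → ℝ) :
    expect ((∑ j ∈ Finset.range n, a j • p j) * (∑ j ∈ Finset.range n, b j • p j)) =
      ∑ j ∈ Finset.range n, a j * b j * expect (p j ^ 2) := by
  rw [Finset.sum_mul_sum, map_sum]
  refine Finset.sum_congr rfl fun i hi => ?_
  rw [map_sum, Finset.sum_eq_single_of_mem i hi]
  · rw [smul_mul_smul_comm, map_smul, smul_eq_mul, sq]
  · intro j _ hj
    rw [smul_mul_smul_comm, map_smul, expect_mul_eq_zero_of_ou (hp i) (hp j)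
      (by exact_mod_cast hj.symm), smul_zero]

/-- The spectral form of the second moments of a polynomial and its gradient. -/
theorem exists_spectral_moments {ι : Type} {s : Finset ι} {d : ℕ} {P : MvPolynomial ι ℝ}
    (hP : P ∈ MvPolynomial.supported ℝ (s : Set ι)) (hd : P.totalDegree ≤ d) :
    ∃ w : ℕ → ℝ, (∀ j, 0 ≤ w j) ∧ expect (P ^ 2) = ∑ j ∈ Finset.range (d + 1), w j ∧
      expect (gam s P P) = ∑ j ∈ Finset.range (d + 1), j * w j ∧
      expect ((ou s P) ^ 2) = ∑ j ∈ Finset.range (d + 1), (j : ℝ) ^ 2 * w j ∧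
      (expect P) ^ 2 = w 0 := by
  obtain ⟨p, h1, h2, c, h3⟩ := exists_chaos_decomposition d P hP hd
  have hone : P = ∑ j ∈ Finset.range (d + 1), (1 : ℝ) • p j := by simpa using h1
  have hou : ou s P = ∑ j ∈ Finset.range (d + 1), (-(j : ℝ)) • p j := by
    rw [h1, map_sum]
    exact Finset.sum_congr rfl fun j _ => by rw [h2, neg_smul]
  refine ⟨fun j => expect (p j ^ 2), fun j => expect_sq_nonneg _, ?_, ?_, ?_, ?_⟩
  · rw [sq, hone, expect_sum_smul_mul_sum_smul h2]; simp
  · rw [← neg_neg (expect (gam s P P)), ← expect_mul_ou, hou]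
    nth_rewrite 1 [hone]
    rw [expect_sum_smul_mul_sum_smul h2, ← Finset.sum_neg_distrib]
    exact Finset.sum_congr rfl fun j _ => by ring
  · rw [sq, hou, expect_sum_smul_mul_sum_smul h2]
    exact Finset.sum_congr rfl fun j _ => by ring
  · have hz : ∀ j ∈ Finset.range d, expect (p (j + 1)) = 0 := fun j _ => by
      have := expect_mul_eq_zero_of_ou (s := s) (P := p (j + 1)) (Q := 1) (a := (j + 1 : ℕ))
        (b := 0) (h2 _) (by rw [← MvPolynomial.C_1, ou_C]; simp) (by positivity)
      simpa using this
    rw [h1, map_sum, Finset.sum_range_succ', Finset.sum_eq_zero hz, zero_add]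
    simp only [h3, ← map_pow, expect_C]

/-- The Gaussian Poincaré inequality: in spectral form it only compares j with 1 for j ≥ 1. -/
theorem expect_sq_sub_le_expect_gam {ι : Type} {s : Finset ι} {P : MvPolynomial ι ℝ}
    (hP : P ∈ MvPolynomial.supported ℝ (s : Set ι)) :
    expect (P ^ 2) - (expect P) ^ 2 ≤ expect (gam s P P) := by
  obtain ⟨w, h0, h1, h2, -, h3⟩ := exists_spectral_moments hP le_rfl
  rw [h1, h2, h3, Finset.sum_range_succ', Finset.sum_range_succ']
  simp only [CharP.cast_eq_zero, zero_mul, add_zero, add_sub_cancel_right]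
  refine Finset.sum_le_sum fun j _ => ?_
  have := h0 (j + 1)
  push_cast
  nlinarith [mul_nonneg (Nat.cast_nonneg (α := ℝ) j) this]

/-- The reverse Poincaré inequality, available because only eigenvalues j ≤ d occur in degree at
most d. -/
theorem expect_gam_le_variance {ι : Type} {s : Finset ι} {d : ℕ} {P : MvPolynomial ι ℝ}
    (hP : P ∈ MvPolynomial.supported ℝ (s : Set ι)) (hd : P.totalDegree ≤ d) :
    expect (gam s P P) ≤ d * (expect (P ^ 2) - (expect P) ^ 2) := by
  obtain ⟨w, h0, h1, h2, -, h3⟩ := exists_spectral_moments hP hd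
  rw [h1, h2, h3, Finset.sum_range_succ', Finset.sum_range_succ']
  simp only [CharP.cast_eq_zero, zero_mul, add_zero, add_sub_cancel_right, Finset.mul_sum]
  refine Finset.sum_le_sum fun j hj => ?_
  exact mul_le_mul_of_nonneg_right (by exact_mod_cast Finset.mem_range.1 hj) (h0 _)

theorem expect_gam_le {ι : Type} {s : Finset ι} {d : ℕ} {P : MvPolynomial ι ℝ}
    (hP : P ∈ MvPolynomial.supported ℝ (s : Set ι)) (hd : P.totalDegree ≤ d) :
    expect (gam s P P) ≤ d * expect (P ^ 2) :=
  (expect_gam_le_variance hP hd).trans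
    (mul_le_mul_of_nonneg_left (by linarith [sq_nonneg (expect P)]) (by positivity))

theorem expect_ou_sq_le {ι : Type} {s : Finset ι} {d : ℕ} {P : MvPolynomial ι ℝ}
    (hP : P ∈ MvPolynomial.supported ℝ (s : Set ι)) (hd : P.totalDegree ≤ d) :
    expect ((ou s P) ^ 2) ≤ (d : ℝ) ^ 2 * expect (P ^ 2) := by
  obtain ⟨w, h0, h1, -, h2, -⟩ := exists_spectral_moments hP hd
  rw [h1, h2, Finset.mul_sum]
  refine Finset.sum_le_sum fun j hj => mul_le_mul_of_nonneg_right ?_ (h0 j)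
  have : (j : ℝ) ≤ d := by exact_mod_cast Nat.lt_succ_iff.1 (Finset.mem_range.1 hj)
  gcongr

/-! ### Hypercontractivity -/

/-- Equivalence of the second and fourth moments of vector valued polynomials of bounded degree,
with a constant that does not depend on the number of variables. -/
theorem exists_fourth_moment_bound (d : ℕ) : ∃ C : ℝ, 0 ≤ C ∧
    ∀ (ι : Type) (s : Finset ι) (α : Type) (J : Finset α) (p : α → MvPolynomial ι ℝ),
      (∀ a ∈ J, p a ∈ MvPolynomial.supported ℝ (s : Set ι)) →
      (∀ a ∈ J, (p a).totalDegree ≤ d) →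
      expect ((∑ a ∈ J, p a ^ 2) ^ 2) ≤ C * (expect (∑ a ∈ J, p a ^ 2)) ^ 2 := by
  induction d with
  | zero =>
    refine ⟨1, zero_le_one, fun ι s α J p _ hd => ?_⟩
    have h : ∑ a ∈ J, p a ^ 2 = MvPolynomial.C (∑ a ∈ J, ((p a).coeff 0) ^ 2) := by
      rw [map_sum]
      refine Finset.sum_congr rfl fun a ha => ?_
      rw [map_pow, ← MvPolynomial.totalDegree_eq_zero_iff_eq_C.1 (Nat.le_zero.1 (hd a ha))]
    rw [h, ← map_pow, expect_C, expect_C, one_mul]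
  | succ d ih =>
    obtain ⟨C, hC, ih⟩ := ih
    -- With T = Σ p_a² and S = Σ |∇p_a|², Poincaré and Cauchy-Schwarz give Var T ≤ 4 E[TS] ≤ E[T²]/2
    -- + 8 E[S²]. Induction applies to the family of all first derivatives, which is why families
    -- are treated: E[S²] ≤ C E[S]², and E[S] ≤ (d + 1) E[T] by reverse Poincaré. Solving for E[T²]
    -- produces the constant.
    refine ⟨2 + 16 * (d + 1) ^ 2 * C, by positivity, fun ι s α J p hs hd => ?_⟩
    set T := ∑ a ∈ J, p a ^ 2 with hT
    set S := ∑ b ∈ J ×ˢ s, (MvPolynomial.pderiv b.2 (p b.1)) ^ 2 with hS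
    have hS2 : expect (S ^ 2) ≤ C * (expect S) ^ 2 := by
      refine ih ι s (α × ι) (J ×ˢ s) (fun b => MvPolynomial.pderiv b.2 (p b.1)) ?_ ?_
      · exact fun b hb => pderiv_mem_supported (hs _ (Finset.mem_product.1 hb).1) _
      · intro b hb
        have h1 := totalDegree_pderiv_le b.2 (p b.1)
        have h2 := hd _ (Finset.mem_product.1 hb).1
        omega
    have hS0 : 0 ≤ expect S := expect_nonneg fun x => by
      simp only [hS, map_sum, map_pow]; positivity
    have hST : expect S ≤ (d + 1) * expect T := by
      rw [hS, hT, Finset.sum_product, map_sum, map_sum, Finset.mul_sum]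
      refine Finset.sum_le_sum fun a ha => ?_
      have := expect_gam_le (hs a ha) (hd a ha)
      simpa [gam, sq] using this
    have hTs : T ∈ MvPolynomial.supported ℝ (s : Set ι) :=
      sum_mem fun a ha => pow_mem (hs a ha) 2
    have hP := expect_sq_sub_le_expect_gam hTs
    have hG : expect (gam s T T) ≤ expect (MvPolynomial.C (1 / 2) * T ^ 2 +
        MvPolynomial.C 8 * S ^ 2) := by
      refine expect_mono fun x => ?_
      have e1 : ∀ i, MvPolynomial.eval x (MvPolynomial.pderiv i T) =
          2 * ∑ a ∈ J, MvPolynomial.eval x (p a) *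
            MvPolynomial.eval x (MvPolynomial.pderiv i (p a)) := by
        intro i
        simp only [hT, map_sum, MvPolynomial.pderiv_pow, map_mul, Finset.mul_sum, map_pow]
        refine Finset.sum_congr rfl fun a _ => ?_
        simp
        ring
      have e2 : MvPolynomial.eval x (gam s T T) ≤
          4 * (MvPolynomial.eval x T * MvPolynomial.eval x S) := by
        rw [eval_gam_self]
        simp only [e1]
        simp only [hS, hT, map_sum, map_pow, Finset.sum_product_right, Finset.mul_sum]
        refine Finset.sum_le_sum fun i _ => ?_
        have := Finset.sum_mul_sq_le_sq_mul_sq J (fun a => MvPolynomial.eval x (p a))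
          (fun a => MvPolynomial.eval x (MvPolynomial.pderiv i (p a)))
        rw [← Finset.mul_sum, ← Finset.mul_sum, mul_pow, ← Finset.mul_sum]
        linarith
      simp only [map_add, map_mul, map_pow, MvPolynomial.eval_C]
      nlinarith [sq_nonneg (MvPolynomial.eval x T - 4 * MvPolynomial.eval x S)]
    rw [map_add, expect_C_mul, expect_C_mul] at hG
    have h5 : (expect S) ^ 2 ≤ ((d + 1) * expect T) ^ 2 := pow_le_pow_left₀ hS0 hST 2
    have h6 := mul_le_mul_of_nonneg_left h5 hC
    nlinarith

/-! ### Uniform second moment bounds -/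

/-- Polynomials in the variables in `s`, with bounded degree and second moment. -/
structure Bdd {ι : Type} (s : Finset ι) (d : ℕ) (B : ℝ) (P : MvPolynomial ι ℝ) : Prop where
  supp : P ∈ MvPolynomial.supported ℝ (s : Set ι)
  deg : P.totalDegree ≤ d
  norm : expect (P ^ 2) ≤ B

theorem Bdd.C_mul {ι : Type} {s : Finset ι} {d : ℕ} {B : ℝ} {P : MvPolynomial ι ℝ}
    (h : Bdd s d B P) {c b : ℝ} (hc : |c| ≤ b) : Bdd s d (b ^ 2 * B) (MvPolynomial.C c * P) where
  supp := mul_mem (Subalgebra.algebraMap_mem _ c) h.supp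
  deg := by
    rw [← MvPolynomial.smul_eq_C_mul]
    exact (MvPolynomial.totalDegree_smul_le _ _).trans h.deg
  norm := by
    rw [mul_pow, ← map_pow, expect_C_mul]
    exact mul_le_mul (sq_le_sq' (abs_le.1 hc).1 (abs_le.1 hc).2) h.norm (expect_sq_nonneg P)
      (sq_nonneg _)

theorem bdd_C {ι : Type} (s : Finset ι) {c b : ℝ} (hc : |c| ≤ b) :
    Bdd s 0 (b ^ 2) (MvPolynomial.C c) where
  supp := Subalgebra.algebraMap_mem _ c
  deg := by simp
  norm := by
    rw [← map_pow, expect_C]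
    exact sq_le_sq' (abs_le.1 hc).1 (abs_le.1 hc).2

theorem Bdd.add {ι : Type} {s : Finset ι} {d₁ d₂ : ℕ} {B₁ B₂ : ℝ} {P Q : MvPolynomial ι ℝ}
    (hP : Bdd s d₁ B₁ P) (hQ : Bdd s d₂ B₂ Q) :
    Bdd s (max d₁ d₂) (2 * B₁ + 2 * B₂) (P + Q) where
  supp := add_mem hP.supp hQ.supp
  deg := (MvPolynomial.totalDegree_add _ _).trans (max_le_max hP.deg hQ.deg)
  norm := by
    have h : expect ((P + Q) ^ 2) ≤ expect (MvPolynomial.C 2 * P ^ 2 + MvPolynomial.C 2 * Q ^ 2) :=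
      expect_mono fun x => by
        simp only [map_add, map_mul, map_pow, MvPolynomial.eval_C]
        nlinarith [sq_nonneg (MvPolynomial.eval x P - MvPolynomial.eval x Q)]
    rw [map_add, expect_C_mul, expect_C_mul] at h
    linarith [hP.norm, hQ.norm]

theorem Bdd.ou {ι : Type} {s : Finset ι} {d : ℕ} {B : ℝ} {P : MvPolynomial ι ℝ}
    (hP : Bdd s d B P) : Bdd s d ((d : ℝ) ^ 2 * B) (ou s P) where
  supp := ou_mem_supported hP.supp
  deg := totalDegree_ou_le hP.deg
  norm := (expect_ou_sq_le hP.supp hP.deg).trans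
    (mul_le_mul_of_nonneg_left hP.norm (sq_nonneg _))

/-- From P²Q² ≤ (P⁴ + Q⁴)/2 and the equivalence of second and fourth moments. The constants are
chosen before the variables and the polynomials, which is the uniformity needed later. -/
theorem exists_bdd_mul (d₁ d₂ : ℕ) (B₁ B₂ : ℝ) : ∃ (d : ℕ) (B : ℝ), ∀ (ι : Type) (s : Finset ι)
    (P Q : MvPolynomial ι ℝ), Bdd s d₁ B₁ P → Bdd s d₂ B₂ Q → Bdd s d B (P * Q) := by
  obtain ⟨C₁, hC₁, h₁⟩ := exists_fourth_moment_bound d₁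
  obtain ⟨C₂, hC₂, h₂⟩ := exists_fourth_moment_bound d₂
  refine ⟨d₁ + d₂, 1 / 2 * (C₁ * B₁ ^ 2) + 1 / 2 * (C₂ * B₂ ^ 2), fun ι s P Q hP hQ =>
    ⟨mul_mem hP.supp hQ.supp, (MvPolynomial.totalDegree_mul _ _).trans
      (add_le_add hP.deg hQ.deg), ?_⟩⟩
  have e1 := h₁ ι s Unit {()} (fun _ => P) (fun _ _ => hP.supp) (fun _ _ => hP.deg)
  have e2 := h₂ ι s Unit {()} (fun _ => Q) (fun _ _ => hQ.supp) (fun _ _ => hQ.deg)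
  simp only [Finset.sum_singleton] at e1 e2
  have h : expect ((P * Q) ^ 2) ≤ expect (MvPolynomial.C (1 / 2) * (P ^ 2) ^ 2 +
      MvPolynomial.C (1 / 2) * (Q ^ 2) ^ 2) :=
    expect_mono fun x => by
      simp only [map_add, map_mul, map_pow, MvPolynomial.eval_C]
      nlinarith [sq_nonneg ((MvPolynomial.eval x P) ^ 2 - (MvPolynomial.eval x Q) ^ 2)]
  rw [map_add, expect_C_mul, expect_C_mul] at h
  have f1 := mul_le_mul_of_nonneg_left (pow_le_pow_left₀ (expect_sq_nonneg P) hP.norm 2) hC₁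
  have f2 := mul_le_mul_of_nonneg_left (pow_le_pow_left₀ (expect_sq_nonneg Q) hQ.norm 2) hC₂
  linarith

/-- Polarization: 2Γ(P,Q) = L(PQ) - P LQ - Q LP with L the Ornstein-Uhlenbeck operator, which is
bounded in bounded degree. No estimate coordinate by coordinate is needed, so the number of
variables does not enter. -/
theorem exists_bdd_gam (d₁ d₂ : ℕ) (B₁ B₂ : ℝ) : ∃ (d : ℕ) (B : ℝ), ∀ (ι : Type) (s : Finset ι)
    (P Q : MvPolynomial ι ℝ), Bdd s d₁ B₁ P → Bdd s d₂ B₂ Q → Bdd s d B (gam s P Q) := by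
  obtain ⟨a₁, b₁, h₁⟩ := exists_bdd_mul d₁ d₂ B₁ B₂
  obtain ⟨a₂, b₂, h₂⟩ := exists_bdd_mul d₁ d₂ B₁ ((d₂ : ℝ) ^ 2 * B₂)
  obtain ⟨a₃, b₃, h₃⟩ := exists_bdd_mul d₂ d₁ B₂ ((d₁ : ℝ) ^ 2 * B₁)
  refine ⟨max a₁ (max a₂ a₃), 2 * ((1 / 2) ^ 2 * ((a₁ : ℝ) ^ 2 * b₁)) +
    2 * (2 * ((1 / 2) ^ 2 * b₂) + 2 * ((1 / 2) ^ 2 * b₃)), fun ι s P Q hP hQ => ?_⟩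
  have e : gam s P Q = MvPolynomial.C (1 / 2) * (ou s (P * Q)) +
      (MvPolynomial.C (-(1 / 2)) * (P * ou s Q) + MvPolynomial.C (-(1 / 2)) * (Q * ou s P)) := by
    have h2 : (MvPolynomial.C (1 / 2) : MvPolynomial ι ℝ) * 2 = 1 := by
      rw [← map_ofNat (MvPolynomial.C : ℝ →+* MvPolynomial ι ℝ) 2, ← map_mul]; norm_num
    rw [ou_mul, map_neg]
    linear_combination (-gam s P Q) * h2
  rw [e]
  exact ((h₁ ι s P Q hP hQ).ou.C_mul (b := 1 / 2) (by norm_num [abs_of_pos])).add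
    (((h₂ ι s P _ hP hQ.ou).C_mul (b := 1 / 2) (by norm_num [abs_of_pos])).add
      ((h₃ ι s Q _ hQ hP.ou).C_mul (b := 1 / 2) (by norm_num [abs_of_pos])))

/-! ### Oscillatory integrals of polynomials -/

theorem integrable_bdd_mul_eval {ι : Type} {φ : (ι → ℝ) → ℝ} (hφ : Measurable φ) {c : ℝ}
    (hc : ∀ x, |φ x| ≤ c) (P : MvPolynomial ι ℝ) :
    Integrable (fun x => φ x * MvPolynomial.eval x P) (wiener ι) :=
  (integrable_eval P).bdd_mul hφ.aestronglyMeasurable (ae_of_all _ hc)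

/-- The regularized inverse `1 / (Γ[X,X] + ε)`. -/
noncomputable def regInv {ι : Type} (s : Finset ι) (X : MvPolynomial ι ℝ) (ε : ℝ) (x : ι → ℝ) : ℝ :=
  (MvPolynomial.eval x (gam s X X) + ε)⁻¹

section regInv

variable {ι : Type} (s : Finset ι) (X : MvPolynomial ι ℝ) {ε : ℝ}

theorem regInv_pos (hε : 0 < ε) (x : ι → ℝ) : 0 < regInv s X ε x :=
  inv_pos.2 (by linarith [eval_gam_self_nonneg s X x])

theorem regInv_le (hε : 0 < ε) (x : ι → ℝ) : regInv s X ε x ≤ ε⁻¹ :=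
  inv_anti₀ hε (by linarith [eval_gam_self_nonneg s X x])

theorem regInv_mul (hε : 0 < ε) (x : ι → ℝ) :
    regInv s X ε x * (MvPolynomial.eval x (gam s X X) + ε) = 1 :=
  inv_mul_cancel₀ (by linarith [eval_gam_self_nonneg s X x])

theorem measurable_regInv : Measurable (regInv s X ε) :=
  ((measurable_eval _).add_const _).inv

theorem abs_mul_regInv_pow_le (hε : 0 < ε) {a : ℝ} (ha : |a| ≤ 1) (b : ℕ) (x : ι → ℝ) :
    |a * regInv s X ε x ^ b| ≤ (ε⁻¹) ^ b := by
  rw [abs_mul, abs_of_nonneg (pow_nonneg (regInv_pos s X hε x).le b)]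
  calc |a| * regInv s X ε x ^ b ≤ 1 * regInv s X ε x ^ b :=
        mul_le_mul_of_nonneg_right ha (pow_nonneg (regInv_pos s X hε x).le b)
    _ ≤ _ := by
        rw [one_mul]
        exact pow_le_pow_left₀ (regInv_pos s X hε x).le (regInv_le s X hε x) b

theorem integrable_cos_mul (hε : 0 < ε) (t θ : ℝ) (b : ℕ) (Q : MvPolynomial ι ℝ) :
    Integrable (fun x => Real.cos (t * MvPolynomial.eval x X + θ) * regInv s X ε x ^ b *
      MvPolynomial.eval x Q) (wiener ι) :=
  integrable_bdd_mul_eval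
    ((Real.measurable_cos.comp (((measurable_eval X).const_mul t).add_const θ)).mul
      ((measurable_regInv s X).pow_const b))
    (fun x => abs_mul_regInv_pow_le s X hε (Real.abs_cos_le_one _) b x) Q

theorem integrable_sin_mul (hε : 0 < ε) (t θ : ℝ) (b : ℕ) (Q : MvPolynomial ι ℝ) :
    Integrable (fun x => Real.sin (t * MvPolynomial.eval x X + θ) * regInv s X ε x ^ b *
      MvPolynomial.eval x Q) (wiener ι) :=
  integrable_bdd_mul_eval
    ((Real.measurable_sin.comp (((measurable_eval X).const_mul t).add_const θ)).mul
      ((measurable_regInv s X).pow_const b))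
    (fun x => abs_mul_regInv_pow_le s X hε (Real.abs_sin_le_one _) b x) Q

/-- The polynomial weight produced by one integration by parts. -/
noncomputable def weight (ε : ℝ) (b : ℕ) (Q : MvPolynomial ι ℝ) : MvPolynomial ι ℝ :=
  MvPolynomial.C (-1) * ((gam s X X + MvPolynomial.C ε) * (Q * ou s X + gam s Q X)) +
    MvPolynomial.C (b + 1 : ℝ) * (Q * gam s (gam s X X) X)

/-- The integral of (∂_i - x_i)(sin(tX + θ) u^{b+1} Q ∂_iX) vanishes; sum over i. Differentiating
the sine gives t cos · Γ[X,X]; differentiating u^{b+1} gives -(b+1) u^{b+2} Γ(Γ[X,X],X); the rest is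
Q LX + Γ(Q,X), brought to the power u^{b+2} with 1 = u(Γ[X,X] + ε). -/
theorem integral_cos_mul_gam (hε : 0 < ε) (t θ : ℝ) (b : ℕ) (Q : MvPolynomial ι ℝ) :
    t * ∫ x, Real.cos (t * MvPolynomial.eval x X + θ) * regInv s X ε x ^ (b + 1) *
      MvPolynomial.eval x (Q * gam s X X) ∂(wiener ι) =
    ∫ x, Real.sin (t * MvPolynomial.eval x X + θ) * regInv s X ε x ^ (b + 2) *
      MvPolynomial.eval x (weight s X ε b Q) ∂(wiener ι) := by
  classical
  set u := regInv s X ε with hu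
  set G := gam s X X with hG
  have hstep : ∀ i, ∫ x, ((Real.sin (t * MvPolynomial.eval x X + θ) * u x ^ (b + 1) *
      MvPolynomial.eval x (MvPolynomial.pderiv i (Q * MvPolynomial.pderiv i X) -
        MvPolynomial.X i * (Q * MvPolynomial.pderiv i X))) +
      t * (Real.cos (t * MvPolynomial.eval x X + θ) * u x ^ (b + 1) *
        MvPolynomial.eval x (MvPolynomial.pderiv i X * (Q * MvPolynomial.pderiv i X))) +
      (-(b + 1 : ℝ)) * (Real.sin (t * MvPolynomial.eval x X + θ) * u x ^ (b + 2) *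
        MvPolynomial.eval x (MvPolynomial.pderiv i G * (Q * MvPolynomial.pderiv i X))))
        ∂(wiener ι) = 0 := by
    intro i
    set R := Q * MvPolynomial.pderiv i X
    have i1 := integrable_sin_mul s X hε t θ (b + 1) (MvPolynomial.pderiv i R)
    have i2 := (integrable_cos_mul s X hε t θ (b + 1) (MvPolynomial.pderiv i X * R)).const_mul t
    have i3 := (integrable_sin_mul s X hε t θ (b + 2)
      (MvPolynomial.pderiv i G * R)).const_mul (-(b + 1 : ℝ))
    have i4 := integrable_sin_mul s X hε t θ (b + 1) (MvPolynomial.X i * R)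
    have key := integral_coord_mul i
      (f := fun x => Real.sin (t * MvPolynomial.eval x X + θ) * u x ^ (b + 1) *
        MvPolynomial.eval x R)
      (f' := fun x => (Real.sin (t * MvPolynomial.eval x X + θ) * u x ^ (b + 1) *
        MvPolynomial.eval x (MvPolynomial.pderiv i R) +
        t * (Real.cos (t * MvPolynomial.eval x X + θ) * u x ^ (b + 1) *
          MvPolynomial.eval x (MvPolynomial.pderiv i X * R))) +
        (-(b + 1 : ℝ)) * (Real.sin (t * MvPolynomial.eval x X + θ) * u x ^ (b + 2) *
          MvPolynomial.eval x (MvPolynomial.pderiv i G * R))) ?_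
      (integrable_sin_mul s X hε t θ (b + 1) R) ((i1.add i2).add i3) ?_
    · have e : ∀ x : ι → ℝ, (Real.sin (t * MvPolynomial.eval x X + θ) * u x ^ (b + 1) *
          MvPolynomial.eval x (MvPolynomial.pderiv i R - MvPolynomial.X i * R) +
          t * (Real.cos (t * MvPolynomial.eval x X + θ) * u x ^ (b + 1) *
            MvPolynomial.eval x (MvPolynomial.pderiv i X * R)) +
          (-(b + 1 : ℝ)) * (Real.sin (t * MvPolynomial.eval x X + θ) * u x ^ (b + 2) *
            MvPolynomial.eval x (MvPolynomial.pderiv i G * R))) =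
          ((Real.sin (t * MvPolynomial.eval x X + θ) * u x ^ (b + 1) *
            MvPolynomial.eval x (MvPolynomial.pderiv i R) +
          t * (Real.cos (t * MvPolynomial.eval x X + θ) * u x ^ (b + 1) *
            MvPolynomial.eval x (MvPolynomial.pderiv i X * R))) +
          (-(b + 1 : ℝ)) * (Real.sin (t * MvPolynomial.eval x X + θ) * u x ^ (b + 2) *
            MvPolynomial.eval x (MvPolynomial.pderiv i G * R))) -
          Real.sin (t * MvPolynomial.eval x X + θ) * u x ^ (b + 1) *
            MvPolynomial.eval x (MvPolynomial.X i * R) := by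
        intro x
        rw [map_sub]; ring
      simp_rw [e]
      refine (integral_sub ((i1.add i2).add i3) i4).trans (sub_eq_zero.2 (key.symm.trans ?_))
      refine integral_congr_ae (ae_of_all _ fun x => ?_)
      simp only [map_mul, MvPolynomial.eval_X, hu]
      ring
    · intro x y
      have hX := hasDerivAt_eval_update i X x y
      have hGd := hasDerivAt_eval_update i G x y
      have hR := hasDerivAt_eval_update i R x y
      set x' := Function.update x i y with hx'
      have hne : MvPolynomial.eval x' G + ε ≠ 0 := by
        linarith [eval_gam_self_nonneg s X x']
      have h1 := ((((hX.const_mul t).add_const θ).sin).fun_mul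
        (((hGd.add_const ε).fun_inv (by rw [← hx']; exact hne)).fun_pow (b + 1))).fun_mul hR
      refine h1.congr_deriv ?_
      simp only [← hx', hu, regInv, ← hG, map_mul, Nat.add_sub_cancel, div_eq_mul_inv,
        ← inv_pow]
      push_cast
      ring
    · refine i4.congr (ae_of_all _ fun x => ?_)
      simp only [map_mul, MvPolynomial.eval_X]
      ring
  have hsum := Finset.sum_eq_zero fun i (_ : i ∈ s) => hstep i
  rw [← integral_finsetSum] at hsum
  · rw [← integral_const_mul, ← sub_eq_zero, ← integral_sub
      ((integrable_cos_mul s X hε t θ (b + 1) (Q * G)).const_mul t)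
      (integrable_sin_mul s X hε t θ (b + 2) _), ← hsum]
    refine integral_congr_ae (ae_of_all _ fun x => ?_)
    have hone : u x * (MvPolynomial.eval x G + ε) = 1 := regInv_mul s X hε x
    simp only [Finset.sum_add_distrib, ← Finset.mul_sum, ← map_sum]
    have s1 : ∑ i ∈ s, (MvPolynomial.pderiv i (Q * MvPolynomial.pderiv i X) -
        MvPolynomial.X i * (Q * MvPolynomial.pderiv i X)) = Q * ou s X + gam s Q X := by
      rw [ou_apply, gam, Finset.mul_sum, ← Finset.sum_add_distrib]
      refine Finset.sum_congr rfl fun i _ => ?_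
      rw [MvPolynomial.pderiv_mul]; ring
    have s2 : ∑ i ∈ s, MvPolynomial.pderiv i X * (Q * MvPolynomial.pderiv i X) = Q * G := by
      rw [hG, gam, Finset.mul_sum]
      exact Finset.sum_congr rfl fun i _ => by ring
    have s3 : ∑ i ∈ s, MvPolynomial.pderiv i G * (Q * MvPolynomial.pderiv i X) =
        Q * gam s G X := by
      rw [gam, Finset.mul_sum]
      exact Finset.sum_congr rfl fun i _ => by ring
    rw [s1, s2, s3]
    simp only [weight, ← hG, map_add, map_mul, MvPolynomial.eval_C]
    set S := Real.sin (t * MvPolynomial.eval x X + θ)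
    set W := MvPolynomial.eval x Q * MvPolynomial.eval x (ou s X) + MvPolynomial.eval x (gam s Q X)
    have : u x ^ (b + 1) = u x ^ (b + 2) * (MvPolynomial.eval x G + ε) := by
      rw [pow_succ _ (b + 1), mul_assoc, hone, mul_one]
    linear_combination (-S * W) * this
  · intro i _
    exact ((integrable_sin_mul s X hε t θ (b + 1) _).add
      ((integrable_cos_mul s X hε t θ (b + 1) _).const_mul t)).add
      ((integrable_sin_mul s X hε t θ (b + 2) _).const_mul _)

/-- The iterated weights. -/
noncomputable def weights (ε : ℝ) : ℕ → MvPolynomial ι ℝ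
  | 0 => 1
  | j + 1 => weight s X ε (2 * j) (weights ε j)

/-- Each round inserts 1 = u(Γ[X,X] + ε). The Γ part is integrated by parts and gains 1/t, the ε
part stays as an error term. The sine is a cosine with phase shifted by π/2, so the form repeats,
with the power of u raised by two. -/
theorem abs_integral_cos_mul_le (hε : 0 < ε) {t : ℝ} (ht : 1 ≤ t) (r : ℕ) (θ : ℝ) :
    |∫ x, Real.cos (t * MvPolynomial.eval x X + θ) ∂(wiener ι)| ≤
    (∑ j ∈ Finset.range r, ε * ∫ x, regInv s X ε x ^ (2 * j + 1) *
      |MvPolynomial.eval x (weights s X ε j)| ∂(wiener ι)) +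
    (t ^ r)⁻¹ * |∫ x, Real.cos (t * MvPolynomial.eval x X + (θ - r * (Real.pi / 2))) *
      regInv s X ε x ^ (2 * r) * MvPolynomial.eval x (weights s X ε r) ∂(wiener ι)| := by
  induction r with
  | zero => simp [weights]
  | succ r ih =>
    refine ih.trans ?_
    rw [Finset.sum_range_succ, add_assoc]
    gcongr
    set θ' := θ - r * (Real.pi / 2) with hθ'
    set Q := weights s X ε r
    have ht0 : 0 < t := by linarith
    have e1 : ∫ x, Real.cos (t * MvPolynomial.eval x X + θ') * regInv s X ε x ^ (2 * r) *
        MvPolynomial.eval x Q ∂(wiener ι) =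
        ∫ x, Real.cos (t * MvPolynomial.eval x X + θ') * regInv s X ε x ^ (2 * r + 1) *
          MvPolynomial.eval x (Q * gam s X X) ∂(wiener ι) +
        ε * ∫ x, Real.cos (t * MvPolynomial.eval x X + θ') * regInv s X ε x ^ (2 * r + 1) *
          MvPolynomial.eval x Q ∂(wiener ι) := by
      rw [← integral_const_mul, ← integral_add (integrable_cos_mul s X hε t θ' _ _)
        ((integrable_cos_mul s X hε t θ' _ _).const_mul _)]
      refine integral_congr_ae (ae_of_all _ fun x => ?_)
      have hone := regInv_mul s X hε x
      simp only [map_mul, pow_succ]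
      linear_combination (-Real.cos (t * MvPolynomial.eval x X + θ') * regInv s X ε x ^ (2 * r) *
        MvPolynomial.eval x Q) * hone
    have e2 : ∫ x, Real.cos (t * MvPolynomial.eval x X + θ') * regInv s X ε x ^ (2 * r + 1) *
          MvPolynomial.eval x (Q * gam s X X) ∂(wiener ι) =
        t⁻¹ * ∫ x, Real.cos (t * MvPolynomial.eval x X + (θ - (r + 1 : ℕ) * (Real.pi / 2))) *
          regInv s X ε x ^ (2 * (r + 1)) * MvPolynomial.eval x (weights s X ε (r + 1))
            ∂(wiener ι) := by
      rw [eq_inv_mul_iff_mul_eq₀ ht0.ne', integral_cos_mul_gam s X hε]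
      refine integral_congr_ae (ae_of_all _ fun x => ?_)
      simp only [weights]
      rw [← Real.cos_sub_pi_div_two]
      congr 4
      rw [hθ']
      push_cast
      ring
    have e3 : |∫ x, Real.cos (t * MvPolynomial.eval x X + θ') * regInv s X ε x ^ (2 * r + 1) *
          MvPolynomial.eval x Q ∂(wiener ι)| ≤
        ∫ x, regInv s X ε x ^ (2 * r + 1) * |MvPolynomial.eval x Q| ∂(wiener ι) := by
      refine (abs_integral_le_integral_abs).trans (integral_mono
        (integrable_cos_mul s X hε t θ' _ _).abs ?_ fun x => ?_)
      · have := (integrable_bdd_mul_eval (c := (ε⁻¹) ^ (2 * r + 1))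
          ((measurable_regInv s X (ε := ε)).pow_const (2 * r + 1)) (fun x => by
            simpa using abs_mul_regInv_pow_le s X hε (a := 1) (by simp) (2 * r + 1) x) Q).abs
        refine this.congr (ae_of_all _ fun x => ?_)
        simp only [abs_mul, abs_of_nonneg (pow_nonneg (regInv_pos s X hε x).le (2 * r + 1))]
      · simp only [abs_mul, abs_of_nonneg (pow_nonneg (regInv_pos s X hε x).le (2 * r + 1))]
        have h1 := Real.abs_cos_le_one (t * MvPolynomial.eval x X + θ')
        have h2 : 0 ≤ regInv s X ε x ^ (2 * r + 1) := pow_nonneg (regInv_pos s X hε x).le _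
        have h3 : 0 ≤ regInv s X ε x ^ (2 * r + 1) * |MvPolynomial.eval x Q| := by positivity
        nlinarith
    set I1 := ∫ x, Real.cos (t * MvPolynomial.eval x X + (θ - (r + 1 : ℕ) * (Real.pi / 2))) *
          regInv s X ε x ^ (2 * (r + 1)) * MvPolynomial.eval x (weights s X ε (r + 1))
            ∂(wiener ι)
    rw [e1, e2]
    -- The new error term already carries the factor ε, so its decay in t can be thrown away.
    have hinv : (t ^ r)⁻¹ ≤ 1 := inv_le_one_of_one_le₀ (one_le_pow₀ ht)
    have hinv0 : 0 ≤ (t ^ r)⁻¹ := by positivity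
    refine (mul_le_mul_of_nonneg_left (abs_add_le _ _) hinv0).trans ?_
    rw [mul_add, add_comm, abs_mul, abs_mul, abs_of_pos hε, abs_of_pos (inv_pos.2 ht0)]
    refine add_le_add ?_ ?_
    · calc _ ≤ 1 * (ε * _) := mul_le_mul_of_nonneg_right hinv (by positivity)
        _ ≤ _ := by rw [one_mul]; exact mul_le_mul_of_nonneg_left e3 hε.le
    · rw [pow_succ, mul_inv, mul_assoc]

/-- Pointwise u^k |Q| ≤ u^{2k} + Q², and u^{2k} ≤ 1 + u^{4r} because k ≤ 2r. This single negative
moment of order 4r serves all terms of the expansion. -/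
theorem integral_regInv_mul_le (hε : 0 < ε) {k r : ℕ} (hk : k ≤ 2 * r) {B : ℝ}
    {Q : MvPolynomial ι ℝ} (hQ : expect (Q ^ 2) ≤ B) :
    ∫ x, regInv s X ε x ^ k * |MvPolynomial.eval x Q| ∂(wiener ι) ≤
      (1 + |B|) * (1 + ∫ x, regInv s X ε x ^ (4 * r) ∂(wiener ι)) := by
  have hint : Integrable (fun x => regInv s X ε x ^ (4 * r)) (wiener ι) := by
    have := integrable_bdd_mul_eval (c := (ε⁻¹) ^ (4 * r))
      ((measurable_regInv s X (ε := ε)).pow_const (4 * r)) (fun x => by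
        simpa using abs_mul_regInv_pow_le s X hε (a := 1) (by simp) (4 * r) x) 1
    simpa using this
  have hQi : Integrable (fun x => MvPolynomial.eval x (Q ^ 2)) (wiener ι) := integrable_eval _
  have hle : ∫ x, regInv s X ε x ^ k * |MvPolynomial.eval x Q| ∂(wiener ι) ≤
      ∫ x, ((1 + regInv s X ε x ^ (4 * r)) + MvPolynomial.eval x (Q ^ 2)) ∂(wiener ι) := by
    refine integral_mono_of_nonneg (ae_of_all _ fun x => ?_)
      (((integrable_const _).add hint).add hQi) (ae_of_all _ fun x => ?_)
    · exact mul_nonneg (pow_nonneg (regInv_pos s X hε x).le _) (abs_nonneg _)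
    · have hu := (regInv_pos s X hε x).le
      set u := regInv s X ε x
      have h1 : (u ^ k) ^ 2 ≤ 1 + u ^ (4 * r) := by
        rw [← pow_mul]
        by_cases h : u ≤ 1
        · have := pow_le_one₀ (n := k * 2) hu h
          have := pow_nonneg hu (4 * r)
          linarith
        · have := pow_le_pow_right₀ (not_le.1 h).le (show k * 2 ≤ 4 * r by omega)
          linarith
      simp only [map_pow]
      rw [← sq_abs (MvPolynomial.eval x Q)]
      nlinarith [sq_nonneg (u ^ k - |MvPolynomial.eval x Q|), sq_nonneg (u ^ k),
        sq_nonneg |MvPolynomial.eval x Q|]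
  have h1i : Integrable (fun x => 1 + regInv s X ε x ^ (4 * r)) (wiener ι) :=
    (integrable_const _).add hint
  rw [integral_add h1i hQi, integral_add (integrable_const _) hint] at hle
  simp only [integral_const, probReal_univ, smul_eq_mul, one_mul] at hle
  rw [← expect_apply] at hle
  have hI : 0 ≤ ∫ x, regInv s X ε x ^ (4 * r) ∂(wiener ι) :=
    integral_nonneg fun x => pow_nonneg (regInv_pos s X hε x).le _
  nlinarith [le_abs_self B, abs_nonneg B, mul_nonneg (abs_nonneg B) hI]

end regInv

/-- Every operation in the recursion for the weights preserves uniform second moment bounds. The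
restriction ε ≤ 1 keeps the constant polynomial ε bounded, so the bounds do not depend on ε. -/
theorem exists_bdd_weights (m : ℕ) (B₀ : ℝ) (j : ℕ) : ∃ (d : ℕ) (B : ℝ), ∀ (ι : Type)
    (s : Finset ι) (X : MvPolynomial ι ℝ) (ε : ℝ), Bdd s m B₀ X → 0 < ε → ε ≤ 1 →
    Bdd s d B (weights s X ε j) := by
  induction j with
  | zero =>
    refine ⟨0, 1 ^ 2, fun ι s X ε _ _ _ => ?_⟩
    have := bdd_C s (c := 1) (b := 1) (by simp)
    simpa [weights] using this
  | succ j ih =>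
    obtain ⟨d, B, h⟩ := ih
    obtain ⟨a₁, b₁, h₁⟩ := exists_bdd_gam m m B₀ B₀
    obtain ⟨a₂, b₂, h₂⟩ := exists_bdd_mul d m B ((m : ℝ) ^ 2 * B₀)
    obtain ⟨a₃, b₃, h₃⟩ := exists_bdd_gam d m B B₀
    obtain ⟨a₄, b₄, h₄⟩ := exists_bdd_mul (max a₁ 0) (max a₂ a₃) (2 * b₁ + 2 * 1 ^ 2)
      (2 * b₂ + 2 * b₃)
    obtain ⟨a₅, b₅, h₅⟩ := exists_bdd_gam a₁ m b₁ B₀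
    obtain ⟨a₆, b₆, h₆⟩ := exists_bdd_mul d a₅ B b₅
    refine ⟨max a₄ a₆, 2 * (1 ^ 2 * b₄) + 2 * (((2 * j : ℕ) + 1 : ℝ) ^ 2 * b₆),
      fun ι s X ε hX hε hε1 => ?_⟩
    have hQ := h ι s X ε hX hε hε1
    have hG := h₁ ι s X X hX hX
    exact ((h₄ ι s _ _ (hG.add (bdd_C s (by rwa [abs_of_pos hε])))
      ((h₂ ι s _ _ hQ hX.ou).add (h₃ ι s _ _ hQ hX))).C_mul (by simp)).add
      ((h₆ ι s _ _ hQ (h₅ ι s _ _ hG hX)).C_mul (by rw [abs_of_nonneg (by positivity)]))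

/-- Decay of the characteristic function of a polynomial in terms of the negative moments of its
carré du champ. -/
theorem exists_abs_integral_cos_le (m r : ℕ) (B : ℝ) : ∃ C : ℝ, 0 ≤ C ∧ ∀ (ι : Type)
    (s : Finset ι) (X : MvPolynomial ι ℝ), Bdd s m B X → ∀ ε : ℝ, 0 < ε → ε ≤ 1 →
    ∀ t : ℝ, 1 ≤ t → |∫ x, Real.cos (t * MvPolynomial.eval x X) ∂(wiener ι)| ≤
      C * (ε + (t ^ r)⁻¹) * (1 + ∫ x, regInv s X ε x ^ (4 * r) ∂(wiener ι)) := by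
  choose d b hb using exists_bdd_weights m B
  refine ⟨∑ j ∈ Finset.range (r + 1), (1 + |b j|), by positivity,
    fun ι s X hX ε hε hε1 t ht => ?_⟩
  have h := abs_integral_cos_mul_le s X hε ht r 0
  simp only [add_zero] at h
  refine h.trans ?_
  set I := ∫ x, regInv s X ε x ^ (4 * r) ∂(wiener ι)
  have hI : 0 ≤ I := integral_nonneg fun x => pow_nonneg (regInv_pos s X hε x).le _
  have hlast : |∫ x, Real.cos (t * MvPolynomial.eval x X + (0 - r * (Real.pi / 2))) *
      regInv s X ε x ^ (2 * r) * MvPolynomial.eval x (weights s X ε r) ∂(wiener ι)| ≤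
      ∫ x, regInv s X ε x ^ (2 * r) * |MvPolynomial.eval x (weights s X ε r)| ∂(wiener ι) := by
    refine (abs_integral_le_integral_abs).trans (integral_mono
      (integrable_cos_mul s X hε t _ _ _).abs ?_ fun x => ?_)
    · have := (integrable_bdd_mul_eval (c := (ε⁻¹) ^ (2 * r))
        ((measurable_regInv s X (ε := ε)).pow_const (2 * r)) (fun x => by
          simpa using abs_mul_regInv_pow_le s X hε (a := 1) (by simp) (2 * r) x)
          (weights s X ε r)).abs
      refine this.congr (ae_of_all _ fun x => ?_)
      simp only [abs_mul, abs_of_nonneg (pow_nonneg (regInv_pos s X hε x).le (2 * r))]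
    · simp only [abs_mul, abs_of_nonneg (pow_nonneg (regInv_pos s X hε x).le (2 * r))]
      have h1 := Real.abs_cos_le_one (t * MvPolynomial.eval x X + (0 - r * (Real.pi / 2)))
      have h2 : 0 ≤ regInv s X ε x ^ (2 * r) := pow_nonneg (regInv_pos s X hε x).le _
      have h3 : 0 ≤ regInv s X ε x ^ (2 * r) * |MvPolynomial.eval x (weights s X ε r)| := by
        positivity
      nlinarith
  have hJ : ∀ j k, k ≤ 2 * r → ∫ x, regInv s X ε x ^ k *
      |MvPolynomial.eval x (weights s X ε j)| ∂(wiener ι) ≤ (1 + |b j|) * (1 + I) :=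
    fun j k hk => integral_regInv_mul_le s X hε hk (hb j ι s X ε hX hε hε1).norm
  have hr0 : 0 ≤ (t ^ r)⁻¹ := by positivity
  rw [Finset.sum_range_succ]
  have hS : ∑ j ∈ Finset.range r, ε * ∫ x, regInv s X ε x ^ (2 * j + 1) *
      |MvPolynomial.eval x (weights s X ε j)| ∂(wiener ι) ≤
      (∑ j ∈ Finset.range r, (1 + |b j|)) * (ε * (1 + I)) := by
    rw [Finset.sum_mul]
    refine Finset.sum_le_sum fun j hj => ?_
    have := hJ j (2 * j + 1) (by have := Finset.mem_range.1 hj; omega)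
    calc _ ≤ ε * ((1 + |b j|) * (1 + I)) := mul_le_mul_of_nonneg_left this hε.le
      _ = _ := by ring
  have hS0 : 0 ≤ ∑ j ∈ Finset.range r, (1 + |b j|) := by positivity
  have hL := mul_le_mul_of_nonneg_left (hlast.trans (hJ r (2 * r) le_rfl)) hr0
  have hx1 : 0 ≤ (∑ j ∈ Finset.range r, (1 + |b j|)) * ((t ^ r)⁻¹ * (1 + I)) := by positivity
  have hx2 : 0 ≤ (1 + |b r|) * (ε * (1 + I)) := by positivity
  nlinarith

/-! ### Gaussian integrals -/

theorem integral_cos_gaussianReal (c θ : ℝ) :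
    ∫ y, Real.cos (c * y + θ) ∂(gaussianReal 0 1) = Real.cos θ * Real.exp (-c ^ 2 / 2) := by
  have h := charFun_gaussianReal (μ := 0) (v := 1) c
  rw [charFun_apply_real] at h
  have hint : Integrable (fun y : ℝ => Complex.exp (c * y * Complex.I + θ * Complex.I))
      (gaussianReal 0 1) := by
    refine Integrable.of_bound (C := 1) (by fun_prop) (ae_of_all _ fun y => ?_)
    rw [← add_mul, ← Complex.ofReal_mul, ← Complex.ofReal_add, Complex.norm_exp_ofReal_mul_I]
  have h2 : ∫ y : ℝ, Complex.exp (c * y * Complex.I + θ * Complex.I) ∂(gaussianReal 0 1) =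
      ((Real.exp (-c ^ 2 / 2) : ℝ) : ℂ) * Complex.exp (θ * Complex.I) := by
    simp_rw [Complex.exp_add]
    rw [integral_mul_const, h]
    congr 1
    push_cast
    congr 1
    simp
    ring
  have h3 := congrArg Complex.re h2
  rw [← RCLike.re_eq_complex_re, ← integral_re hint] at h3
  simp only [RCLike.re_eq_complex_re, Complex.re_ofReal_mul, Complex.exp_ofReal_mul_I_re,
    ← Complex.ofReal_mul, ← add_mul, ← Complex.ofReal_add] at h3
  rw [h3, mul_comm]

theorem integral_exp_neg_sq_gaussianReal {a : ℝ} (ha : 0 ≤ a) :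
    ∫ y, Real.exp (-(a * y ^ 2)) ∂(gaussianReal 0 1) = (√(1 + 2 * a))⁻¹ := by
  rw [integral_gaussianReal_eq_integral_smul one_ne_zero]
  have : ∀ y : ℝ, gaussianPDFReal 0 1 y • Real.exp (-(a * y ^ 2)) =
      (√(2 * Real.pi))⁻¹ * Real.exp (-(a + 1 / 2) * y ^ 2) := by
    intro y
    simp only [gaussianPDFReal, NNReal.coe_one, mul_one, sub_zero, smul_eq_mul]
    rw [mul_assoc, ← Real.exp_add]
    congr 2
    ring
  simp_rw [this]
  rw [integral_const_mul, integral_gaussian, ← Real.sqrt_inv, ← Real.sqrt_mul (by positivity),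
    ← Real.sqrt_inv]
  congr 1
  have := Real.pi_ne_zero
  field_simp
  ring

theorem integral_update {κ : Type} [DecidableEq κ] (a : κ) {f : (κ → ℝ) → ℝ}
    (hf : Integrable f (wiener κ)) : ∫ z, f z ∂(wiener κ) =
      ∫ z, ∫ y, f (Function.update z a y) ∂(gaussianReal 0 1) ∂(wiener κ) := by
  have mp := measurePreserving_update a
  have hf' := hf
  rw [← mp.map_eq] at hf'
  conv_lhs => rw [← mp.map_eq]
  rw [integral_map mp.measurable.aemeasurable hf'.1]
  exact integral_prod _ (mp.integrable_comp_of_integrable hf)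

theorem sum_update_of_notMem {κ : Type} [DecidableEq κ] {J : Finset κ} {a : κ} (ha : a ∉ J)
    (z : κ → ℝ) (y : ℝ) (F : κ → ℝ → ℝ) :
    ∑ b ∈ J, F b (Function.update z a y b) = ∑ b ∈ J, F b (z b) :=
  Finset.sum_congr rfl fun b hb => by
    rw [Function.update_of_ne (by rintro rfl; exact ha hb)]

theorem integral_cos_sum {κ : Type} (J : Finset κ) (c : κ → ℝ) (θ : ℝ) :
    ∫ z, Real.cos (∑ a ∈ J, c a * z a + θ) ∂(wiener κ) =
      Real.cos θ * Real.exp (-(∑ a ∈ J, c a ^ 2) / 2) := by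
  classical
  induction J using Finset.induction_on generalizing θ with
  | empty => simp
  | insert a J ha ih =>
    rw [integral_update a]
    · simp only [Finset.sum_insert ha, Function.update_self,
        sum_update_of_notMem ha _ _ (fun b w => c b * w), add_assoc, integral_cos_gaussianReal]
      rw [integral_mul_const, ih, mul_assoc, ← Real.exp_add]
      congr 2
      ring
    · refine Integrable.of_bound (C := 1) (Measurable.aestronglyMeasurable (by fun_prop))
        (ae_of_all _ fun y => ?_)
      exact Real.abs_cos_le_one _

theorem integral_exp_neg_sum_sq {κ : Type} (J : Finset κ) {c : κ → ℝ} (hc : ∀ a, 0 ≤ c a) :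
    ∫ z, Real.exp (-∑ a ∈ J, c a * z a ^ 2) ∂(wiener κ) = (√(∏ a ∈ J, (1 + 2 * c a)))⁻¹ := by
  classical
  induction J using Finset.induction_on with
  | empty => simp
  | insert a J ha ih =>
    rw [integral_update a]
    · simp only [Finset.sum_insert ha, Function.update_self, neg_add, Real.exp_add,
        sum_update_of_notMem ha _ _ (fun b w => c b * w ^ 2), integral_mul_const,
        integral_exp_neg_sq_gaussianReal (hc a)]
      rw [integral_const_mul, ih, Finset.prod_insert ha, Real.sqrt_mul (by linarith [hc a]),
        mul_inv]
    · refine Integrable.of_bound (C := 1) (Measurable.aestronglyMeasurable (by fun_prop))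
        (ae_of_all _ fun z => ?_)
      rw [Real.norm_of_nonneg (Real.exp_nonneg _), Real.exp_le_one_iff, neg_nonpos]
      exact Finset.sum_nonneg fun a _ => mul_nonneg (hc a) (sq_nonneg _)

/-- The characteristic function of a polynomial that is linear in a part of the variables. -/
theorem integral_cos_linear {κ κ' ι' : Type} {f : κ → ι'} {g : κ' → ι'}
    (h : Function.Injective (Sum.elim f g)) (J : Finset κ') (Y : κ' → MvPolynomial κ ℝ) (t : ℝ) :
    ∫ x, Real.cos (t * MvPolynomial.eval x (∑ a ∈ J, MvPolynomial.rename f (Y a) *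
      MvPolynomial.X (g a))) ∂(wiener ι') =
    ∫ y, Real.exp (-(t ^ 2 / 2) * ∑ a ∈ J, MvPolynomial.eval y (Y a) ^ 2) ∂(wiener κ) := by
  have mp := measurePreserving_prod h
  set Φ : (κ → ℝ) × (κ' → ℝ) → ℝ := fun p =>
    Real.cos (∑ a ∈ J, (t * MvPolynomial.eval p.1 (Y a)) * p.2 a + 0) with hΦ
  have hm : Measurable Φ := by
    refine Real.measurable_cos.comp (Measurable.add_const (Finset.measurable_fun_sum _
      fun a _ => ?_) _)
    exact (((measurable_eval (Y a)).comp measurable_fst).const_mul t).mul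
      ((measurable_pi_apply a).comp measurable_snd)
  have hi : Integrable Φ ((wiener κ).prod (wiener κ')) :=
    Integrable.of_bound (C := 1) hm.aestronglyMeasurable (ae_of_all _ fun p =>
      Real.abs_cos_le_one _)
  have e1 : ∫ x, Real.cos (t * MvPolynomial.eval x (∑ a ∈ J, MvPolynomial.rename f (Y a) *
      MvPolynomial.X (g a))) ∂(wiener ι') = ∫ p, Φ p ∂((wiener κ).prod (wiener κ')) := by
    rw [← mp.map_eq, integral_map mp.measurable.aemeasurable hm.aestronglyMeasurable]
    refine integral_congr_ae (ae_of_all _ fun x => ?_)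
    simp only [hΦ, add_zero, map_sum, map_mul, MvPolynomial.eval_X, MvPolynomial.eval_rename,
      Finset.mul_sum, mul_assoc]
    rfl
  -- For fixed `y` the argument of the cosine is a centred Gaussian variable of variance t² Σ
  -- Y_a(y)², so the inner integral is its characteristic function.
  rw [e1, integral_prod _ hi]
  refine integral_congr_ae (ae_of_all _ fun y => ?_)
  simp only [hΦ]
  rw [integral_cos_sum, Real.cos_zero, one_mul]
  congr 1
  simp only [mul_pow, ← Finset.mul_sum]
  ring

/-! ### Negative moments and Laplace transforms -/

/-- A discrete form of the Gamma integral for Y^{-q}. If 0 < Y < 1, take n with 4^{-(n+1)} < Y ≤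
4^{-n}: then Y^{-q} ≤ 4^{(n+1)q} while exp(-4^n Y) ≥ 1/e, so the n-th term alone suffices. If Y ≤ 0
and q > 0, the series diverges, in accordance with 0^{-q} = ∞. -/
theorem ofReal_rpow_neg_le (Y : ℝ) (q : ℕ) :
    ENNReal.ofReal Y ^ (-(q : ℝ)) ≤ 1 + ENNReal.ofReal (4 ^ q * Real.exp 1) *
      ∑' n : ℕ, ENNReal.ofReal ((4 ^ n) ^ q * Real.exp (-(4 ^ n * max Y 0))) := by
  rcases Nat.eq_zero_or_pos q with rfl | hq
  · simp
  rcases le_or_gt Y 0 with hY | hY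
  · have : ∑' n : ℕ, ENNReal.ofReal ((4 ^ n) ^ q * Real.exp (-(4 ^ n * max Y 0))) = ∞ := by
      refine top_unique (le_trans (ENNReal.tsum_const_eq_top_of_ne_zero (α := ℕ)
        one_ne_zero).ge (ENNReal.tsum_le_tsum fun n => ?_))
      rw [max_eq_right hY, mul_zero, neg_zero, Real.exp_zero, mul_one, ENNReal.one_le_ofReal]
      exact one_le_pow₀ (one_le_pow₀ (by norm_num))
    rw [this, ENNReal.mul_top (by simp; positivity)]
    simp
  rw [max_eq_left hY.le, ENNReal.ofReal_rpow_of_pos hY, Real.rpow_neg hY.le, Real.rpow_natCast]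
  rcases le_or_gt 1 Y with h1 | h1
  · refine le_add_right (ENNReal.ofReal_le_one.2 (inv_le_one_of_one_le₀ (one_le_pow₀ h1)))
  · obtain ⟨n, hn1, hn2⟩ := exists_nat_pow_near_of_lt_one hY h1.le
      (show (0 : ℝ) < 1 / 4 by norm_num) (by norm_num)
    refine le_add_left (le_trans ?_ (mul_le_mul_right (ENNReal.le_tsum n) _))
    rw [← ENNReal.ofReal_mul (by positivity)]
    refine ENNReal.ofReal_le_ofReal ?_
    have h4 : 4 ^ n * Y ≤ 1 := by
      calc (4 : ℝ) ^ n * Y ≤ 4 ^ n * (1 / 4) ^ n := by gcongr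
        _ = 1 := by rw [← mul_pow]; norm_num
    have h5 : Y⁻¹ ≤ 4 ^ (n + 1) := by
      rw [inv_le_comm₀ hY (by positivity)]
      simpa using hn1.le
    have h6 : 1 ≤ Real.exp 1 * Real.exp (-(4 ^ n * Y)) := by
      rw [← Real.exp_add, Real.one_le_exp_iff]; linarith
    calc (Y ^ q)⁻¹ = (Y⁻¹) ^ q := by rw [inv_pow]
      _ ≤ (4 ^ (n + 1)) ^ q := by gcongr
      _ = (4 ^ q * (4 ^ n) ^ q) * 1 := by rw [← mul_pow, pow_succ]; ring
      _ ≤ (4 ^ q * (4 ^ n) ^ q) * (Real.exp 1 * Real.exp (-(4 ^ n * Y))) := by gcongr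
      _ = _ := by ring

/-- A negative moment is controlled by the decay of the Laplace transform. -/
theorem negMoment_le_of_laplace {Ω : Type} [MeasurableSpace Ω] {μ : Measure Ω}
    [IsProbabilityMeasure μ] {Y : Ω → ℝ} (hY : AEMeasurable Y μ) (q : ℕ) {D : ℝ≥0∞}
    (hD : ∀ n : ℕ, ∫⁻ x, ENNReal.ofReal (Real.exp (-(4 ^ n * max (Y x) 0))) ∂μ ≤
      D * ENNReal.ofReal (((2 ^ n) ^ (2 * q + 1))⁻¹)) :
    negMoment μ Y q ≤ 1 + ENNReal.ofReal (4 ^ q * Real.exp 1 * 2) * D := by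
  have hm : ∀ n : ℕ, AEMeasurable (fun x => ENNReal.ofReal ((4 ^ n) ^ q *
      Real.exp (-(4 ^ n * max (Y x) 0)))) μ := fun n => by
    have := hY.max (aemeasurable_const (b := (0 : ℝ)))
    exact (((this.const_mul _).neg.exp).const_mul _).ennreal_ofReal
  calc negMoment μ Y q ≤ ∫⁻ x, (1 + ENNReal.ofReal (4 ^ q * Real.exp 1) *
        ∑' n : ℕ, ENNReal.ofReal ((4 ^ n) ^ q * Real.exp (-(4 ^ n * max (Y x) 0)))) ∂μ :=
        lintegral_mono fun x => ofReal_rpow_neg_le (Y x) q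
    _ = 1 + ENNReal.ofReal (4 ^ q * Real.exp 1) * ∑' n : ℕ, ∫⁻ x, ENNReal.ofReal ((4 ^ n) ^ q *
          Real.exp (-(4 ^ n * max (Y x) 0))) ∂μ := by
        rw [lintegral_add_left measurable_const, lintegral_const_mul' _ _ ENNReal.ofReal_ne_top,
          lintegral_tsum hm]
        simp
    _ ≤ 1 + ENNReal.ofReal (4 ^ q * Real.exp 1) * ∑' n : ℕ, D * (2⁻¹ : ℝ≥0∞) ^ n := by
        gcongr with n
        simp_rw [ENNReal.ofReal_mul (show (0 : ℝ) ≤ (4 ^ n) ^ q by positivity)]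
        rw [lintegral_const_mul' _ _ ENNReal.ofReal_ne_top]
        refine (mul_le_mul_right (hD n) _).trans ?_
        rw [mul_left_comm, ← ENNReal.ofReal_mul (by positivity)]
        refine mul_le_mul_right (le_of_eq ?_) _
        -- Decay of order 2q + 1 in 2^n beats the factor 4^{nq} by exactly 2^{-n}; the geometric
        -- series is the factor 2 in the conclusion.
        have : ((4 : ℝ) ^ n) ^ q * ((2 ^ n) ^ (2 * q + 1))⁻¹ = (2⁻¹) ^ n := by
          have h4 : (4 : ℝ) = 2 ^ 2 := by norm_num
          rw [h4, pow_succ ((2 : ℝ) ^ n), pow_mul ((2 : ℝ) ^ n), ← pow_mul 2 2 n, mul_comm 2 n,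
            pow_mul 2 n 2, mul_inv, ← mul_assoc, mul_inv_cancel₀ (by positivity), one_mul, inv_pow]
        rw [this, ENNReal.ofReal_pow (by norm_num), ENNReal.ofReal_inv_of_pos (by norm_num),
          ENNReal.ofReal_ofNat]
    _ = 1 + ENNReal.ofReal (4 ^ q * Real.exp 1 * 2) * D := by
        rw [ENNReal.tsum_mul_left, ENNReal.tsum_geometric, ENNReal.one_sub_inv_two, inv_inv,
          ENNReal.ofReal_mul (q := 2) (by positivity), ENNReal.ofReal_ofNat, mul_assoc,
          mul_comm D 2]

theorem one_le_rpow_neg_add (z : ℝ≥0∞) {p : ℝ} (hp : 0 ≤ p) : 1 ≤ z ^ (-p) + z := by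
  rcases le_total 1 z with h | h
  · exact le_add_left h
  · refine le_add_right ?_
    rw [ENNReal.rpow_neg, ENNReal.one_le_inv]
    exact ENNReal.rpow_le_one h hp

/-- Lower bound of a negative moment in terms of an upper bound of the mean. -/
theorem one_le_mul_lintegral_rpow_neg {Ω : Type} [MeasurableSpace Ω] {μ : Measure Ω}
    [IsProbabilityMeasure μ] {Y : Ω → ℝ≥0∞} (hY : AEMeasurable Y μ) {B p : ℝ} (hB : 0 < B)
    (hp : 0 ≤ p) (h : ∫⁻ x, Y x ∂μ ≤ ENNReal.ofReal B) :
    1 ≤ ENNReal.ofReal (2 * (2 * B) ^ p) * ∫⁻ x, Y x ^ (-p) ∂μ := by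
  -- Scaling by twice the bound on the mean makes the mean of Y/b at most 1/2. In 1 ≤ z^{-p} + z,
  -- applied to z = Y/b, the last term then costs at most one half.
  set b := ENNReal.ofReal (2 * B) with hb
  have hb0 : b ≠ 0 := by simpa [hb] using hB
  have hbt : b ≠ ∞ := ENNReal.ofReal_ne_top
  have h1 : 1 ≤ ∫⁻ x, ((b⁻¹ * Y x) ^ (-p) + b⁻¹ * Y x) ∂μ := by
    calc (1 : ℝ≥0∞) = ∫⁻ _, 1 ∂μ := by simp
      _ ≤ _ := lintegral_mono fun x => one_le_rpow_neg_add _ hp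
  have h2 : b⁻¹ * ∫⁻ x, Y x ∂μ ≤ 2⁻¹ := by
    refine (mul_le_mul_right h _).trans (le_of_eq ?_)
    rw [hb, ← ENNReal.ofReal_inv_of_pos (by positivity), ← ENNReal.ofReal_mul (by positivity),
      mul_inv, mul_assoc, inv_mul_cancel₀ hB.ne', mul_one, ENNReal.ofReal_inv_of_pos (by norm_num),
      ENNReal.ofReal_ofNat]
  have h3 : ∫⁻ x, (b⁻¹ * Y x) ^ (-p) ∂μ = b ^ p * ∫⁻ x, Y x ^ (-p) ∂μ := by
    rw [← lintegral_const_mul' _ _ (ENNReal.rpow_ne_top_of_nonneg hp hbt)]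
    refine lintegral_congr fun x => ?_
    rw [ENNReal.rpow_neg, ENNReal.rpow_neg, ENNReal.mul_rpow_of_nonneg _ _ hp, ENNReal.inv_rpow,
      ENNReal.mul_inv, inv_inv]
    · exact Or.inl (ENNReal.inv_ne_zero.2 (ENNReal.rpow_ne_top_of_nonneg hp hbt))
    · exact Or.inl (ENNReal.inv_ne_top.2 (by
        rw [Ne, ENNReal.rpow_eq_zero_iff]; simp [hb0, hbt]))
  rw [lintegral_add_right' _ (hY.const_mul _), lintegral_const_mul' _ _ (ENNReal.inv_ne_top.2 hb0),
    h3] at h1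
  have h4 : (1 : ℝ≥0∞) ≤ b ^ p * (∫⁻ x, Y x ^ (-p) ∂μ) + 2⁻¹ := h1.trans (by gcongr)
  have h5 : (2⁻¹ : ℝ≥0∞) ≤ b ^ p * (∫⁻ x, Y x ^ (-p) ∂μ) := by
    have := tsub_le_iff_right.2 h4
    rwa [ENNReal.one_sub_inv_two] at this
  calc (1 : ℝ≥0∞) = 2 * 2⁻¹ := (ENNReal.mul_inv_cancel (by simp) (by simp)).symm
    _ ≤ 2 * (b ^ p * (∫⁻ x, Y x ^ (-p) ∂μ)) := by gcongr
    _ = _ := by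
      rw [ENNReal.ofReal_mul (by norm_num), ENNReal.ofReal_ofNat,
        ← ENNReal.ofReal_rpow_of_pos (by positivity), mul_assoc]

/-! ### Limits in `L¹` -/

/-- L¹ convergence gives almost sure convergence along a subsequence of any subsequence, and
dominated convergence applies because φ is bounded and continuous. -/
theorem tendsto_integral_comp {Ω : Type} [MeasurableSpace Ω] {μ : Measure Ω}
    [IsProbabilityMeasure μ] {f : ℕ → Ω → ℝ} {g : Ω → ℝ} {φ : ℝ → ℝ} (hφ : Continuous φ) {c : ℝ}
    (hc : ∀ y, |φ y| ≤ c) (hf : ∀ n, AEStronglyMeasurable (f n) μ) (hg : AEStronglyMeasurable g μ)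
    (h : Tendsto (fun n => eLpNorm (fun x => f n x - g x) 1 μ) atTop (𝓝 0)) :
    Tendsto (fun n => ∫ x, φ (f n x) ∂μ) atTop (𝓝 (∫ x, φ (g x) ∂μ)) := by
  refine tendsto_of_subseq_tendsto fun ns hns => ?_
  have h1 : TendstoInMeasure μ (fun n => f (ns n)) atTop g :=
    tendstoInMeasure_of_tendsto_eLpNorm one_ne_zero (fun n => hf _) hg (h.comp hns)
  obtain ⟨ms, -, hms⟩ := h1.exists_seq_tendsto_ae
  refine ⟨ms, tendsto_integral_of_dominated_convergence (fun _ => c)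
    (fun n => hφ.comp_aestronglyMeasurable (hf _)) (integrable_const c)
    (fun n => ae_of_all _ fun x => hc _) ?_⟩
  filter_upwards [hms] with x hx
  exact (hφ.tendsto _).comp hx

/-! ### The sharp operators on polynomials -/

theorem totalDegree_pderiv_add_one_le {ι : Type} {i : ι} {P : MvPolynomial ι ℝ}
    (h0 : MvPolynomial.pderiv i P ≠ 0) :
    (MvPolynomial.pderiv i P).totalDegree + 1 ≤ P.totalDegree := by
  by_cases h00 : P.totalDegree = 0
  · rw [MvPolynomial.totalDegree_eq_zero_iff_eq_C] at h00
    rw [h00, MvPolynomial.pderiv_C] at h0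
    exact absurd rfl h0
  have h1 := totalDegree_pderiv_le i P
  omega

/-- Derivatives in absent variables vanish, so a common finite set of variables can serve several
polynomials. -/
theorem gammaPoly_eq_gam {ι : Type} {s : Finset ι} {P : MvPolynomial ι ℝ}
    (hP : P ∈ MvPolynomial.supported ℝ (s : Set ι)) : gammaPoly P = gam s P P := by
  rw [MvPolynomial.mem_supported] at hP
  rw [gammaPoly, gam]
  simp only [← sq]
  refine Finset.sum_subset (by exact_mod_cast hP) fun i _ hi => ?_
  rw [MvPolynomial.pderiv_eq_zero_of_notMem_vars hi]
  simp

theorem expect_rename {ι κ : Type} {f : κ → ι} (hf : Function.Injective f)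
    (P : MvPolynomial κ ℝ) : expect (MvPolynomial.rename f P) = expect P := by
  have mp := measurePreserving_comp hf
  rw [expect_apply, expect_apply, ← mp.map_eq,
    integral_map mp.measurable.aemeasurable (measurable_eval P).aestronglyMeasurable]
  simp only [MvPolynomial.eval_rename]
  rfl

theorem pderiv_rename_of_notMem_range {ι κ : Type} {f : κ → ι} {i : ι} (hi : i ∉ Set.range f)
    (P : MvPolynomial κ ℝ) : MvPolynomial.pderiv i (MvPolynomial.rename f P) = 0 := by
  classical
  refine MvPolynomial.pderiv_eq_zero_of_notMem_vars fun h => hi ?_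
  obtain ⟨k, -, rfl⟩ := Finset.mem_image.1 (MvPolynomial.vars_rename f P h)
  exact ⟨k, rfl⟩

/-- The polynomial `∑ a ∈ J, Y a · X (g a)`, where `Y a` is a polynomial in the variables in the
range of `f`. -/
noncomputable def linExt {κ κ' ι' : Type} (f : κ → ι') (g : κ' → ι') (J : Finset κ')
    (Y : κ' → MvPolynomial κ ℝ) : MvPolynomial ι' ℝ :=
  ∑ a ∈ J, MvPolynomial.rename f (Y a) * MvPolynomial.X (g a)

theorem pderiv_linExt {κ κ' ι' : Type} [DecidableEq κ'] {f : κ → ι'} {g : κ' → ι'}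
    (h : Function.Injective (Sum.elim f g)) (J : Finset κ') (Y : κ' → MvPolynomial κ ℝ) (a : κ') :
    MvPolynomial.pderiv (g a) (linExt f g J Y) =
      if a ∈ J then MvPolynomial.rename f (Y a) else 0 := by
  have hg : ∀ b c, g b = g c → b = c := fun b c hbc =>
    Sum.inr.inj (h (a₁ := Sum.inr b) (a₂ := Sum.inr c) hbc)
  have hfg : ∀ b, g b ∉ Set.range f := by
    rintro b ⟨k, hk⟩
    have := h (a₁ := Sum.inl k) (a₂ := Sum.inr b) hk
    simp at this
  rw [linExt, map_sum, ← Finset.sum_ite_eq' J a (fun b => MvPolynomial.rename f (Y b))]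
  refine Finset.sum_congr rfl fun b _ => ?_
  rw [MvPolynomial.pderiv_mul, pderiv_rename_of_notMem_range (hfg a), zero_mul, zero_add]
  by_cases hb : b = a
  · subst hb; simp
  · rw [MvPolynomial.pderiv_X_of_ne (fun e => hb (hg _ _ e))]
    simp [hb]

/-- The fresh variables are orthonormal and independent of the coefficients. Algebraically: one
integration by parts in each fresh variable. -/
theorem expect_linExt_sq {κ κ' ι' : Type} {f : κ → ι'} {g : κ' → ι'}
    (h : Function.Injective (Sum.elim f g)) (J : Finset κ') (Y : κ' → MvPolynomial κ ℝ) :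
    expect (linExt f g J Y ^ 2) = ∑ a ∈ J, expect (Y a ^ 2) := by
  classical
  have hf : Function.Injective f := fun b c hbc =>
    Sum.inl.inj (h (a₁ := Sum.inl b) (a₂ := Sum.inl c) hbc)
  have hfg : ∀ b, g b ∉ Set.range f := by
    rintro b ⟨k, hk⟩
    have := h (a₁ := Sum.inl k) (a₂ := Sum.inr b) hk
    simp at this
  rw [sq]
  nth_rewrite 1 [linExt]
  rw [Finset.sum_mul, map_sum]
  refine Finset.sum_congr rfl fun a ha => ?_
  rw [mul_assoc, mul_left_comm, expect_X_mul, MvPolynomial.pderiv_mul,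
    pderiv_rename_of_notMem_range (hfg a), zero_mul, zero_add, pderiv_linExt h, if_pos ha, ← sq,
    ← map_pow, expect_rename hf]

/-- The inclusion of the variables of `♯^k` into those of `♯^(k+1)`. -/
def sharpEmb (ι : Type) (k : ℕ) : ι ⊕ (Fin k × ι) → ι ⊕ (Fin (k + 1) × ι) :=
  Sum.map id (Prod.map Fin.succ id)

/-- The new variables of `♯^(k+1)`. -/
def sharpNew (ι : Type) (k : ℕ) (a : ι) : ι ⊕ (Fin (k + 1) × ι) := Sum.inr (0, a)

theorem sharpEmb_sharpNew_injective (ι : Type) (k : ℕ) :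
    Function.Injective (Sum.elim (sharpEmb ι k) (sharpNew ι k)) := by
  rintro ((a | ⟨j, a⟩) | a) ((b | ⟨l, b⟩) | b) h <;>
    simp_all [sharpEmb, sharpNew, Fin.succ_ne_zero, eq_comm (a := (0 : Fin (k + 1)))]

/-- The operator `♯^k` with all indices in the finite set `s`. -/
noncomputable def sharpRec {ι : Type} (s : Finset ι) :
    (k : ℕ) → MvPolynomial ι ℝ → MvPolynomial (ι ⊕ (Fin k × ι)) ℝ
  | 0, P => MvPolynomial.rename Sum.inl P
  | k + 1, P => linExt (sharpEmb ι k) (sharpNew ι k) s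
      fun a => MvPolynomial.pderiv (Sum.inl a) (sharpRec s k P)

theorem iterPderiv_cons {ι : Type} {k : ℕ} (a : ι) (i : Fin k → ι) (P : MvPolynomial ι ℝ) :
    iterPderiv (Fin.cons a i : Fin (k + 1) → ι) P = MvPolynomial.pderiv a (iterPderiv i P) := by
  simp [iterPderiv, List.ofFn_succ]

theorem iterPderiv_mem_supported {ι : Type} {s : Set ι} {P : MvPolynomial ι ℝ}
    (hP : P ∈ MvPolynomial.supported ℝ s) {k : ℕ} (i : Fin k → ι) :
    iterPderiv i P ∈ MvPolynomial.supported ℝ s := by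
  induction k with
  | zero => simpa [iterPderiv] using hP
  | succ k ih =>
    rw [← Fin.cons_self_tail i, iterPderiv_cons]
    exact pderiv_mem_supported (ih _) _

theorem iterPderiv_eq_zero {ι : Type} {P : MvPolynomial ι ℝ} {k : ℕ} (i : Fin k → ι) {j : Fin k}
    (hj : i j ∉ P.vars) : iterPderiv i P = 0 := by
  induction k with
  | zero => exact j.elim0
  | succ k ih =>
    rw [← Fin.cons_self_tail i, iterPderiv_cons]
    rcases Fin.eq_zero_or_eq_succ j with rfl | ⟨l, rfl⟩
    · have h := MvPolynomial.mem_supported.1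
        (iterPderiv_mem_supported (MvPolynomial.mem_supported_vars P) (Fin.tail i))
      exact MvPolynomial.pderiv_eq_zero_of_notMem_vars fun h' => hj (by exact_mod_cast h h')
    · rw [ih (Fin.tail i) (j := l) hj, map_zero]

theorem sum_piFinset_succ {ι M : Type} [AddCommMonoid M] {k : ℕ} (s : Finset ι)
    (F : (Fin (k + 1) → ι) → M) :
    ∑ i ∈ Fintype.piFinset (fun _ : Fin (k + 1) => s), F i =
      ∑ a ∈ s, ∑ i ∈ Fintype.piFinset (fun _ : Fin k => s), F (Fin.cons a i) := by
  rw [← Finset.sum_product']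
  refine (Finset.sum_nbij' (fun p => Fin.cons p.1 p.2) (fun i => (i 0, Fin.tail i)) ?_ ?_ ?_ ?_
    ?_).symm
  · rintro ⟨a, i⟩ h
    simp only [Finset.mem_product, Fintype.mem_piFinset] at h ⊢
    exact Fin.cases (by simpa using h.1) (fun j => by simpa using h.2 j)
  · intro i h
    simp only [Finset.mem_product, Fintype.mem_piFinset] at h ⊢
    exact ⟨h 0, fun j => h j.succ⟩
  · rintro ⟨a, i⟩ _; simp
  · intro i _; simp
  · rintro ⟨a, i⟩ _; rfl

/-- The factors G do not depend on the N_i, so applying ♯ once more differentiates only the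
coefficient. The recursive form exhibits ♯^{k+1} as linear in one fresh Gaussian family, which the
conditional Gaussian argument needs; the new family takes index 0, matching `Fin.cons`. -/
theorem sharpRec_eq_sum {ι : Type} (s : Finset ι) (k : ℕ) (P : MvPolynomial ι ℝ) :
    sharpRec s k P = ∑ i ∈ Fintype.piFinset (fun _ : Fin k => s),
      MvPolynomial.rename Sum.inl (iterPderiv i P) *
        ∏ j, MvPolynomial.X (Sum.inr (j, i j)) := by
  induction k with
  | zero => simp [sharpRec, iterPderiv]
  | succ k ih =>
    rw [sum_piFinset_succ, sharpRec, linExt]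
    refine Finset.sum_congr rfl fun a _ => ?_
    rw [ih, map_sum, map_sum, Finset.sum_mul]
    refine Finset.sum_congr rfl fun i _ => ?_
    have hz : MvPolynomial.pderiv (Sum.inl a)
        (∏ j, MvPolynomial.X (Sum.inr (j, i j)) : MvPolynomial (ι ⊕ (Fin k × ι)) ℝ) = 0 := by
      have : (∏ j, MvPolynomial.X (Sum.inr (j, i j)) : MvPolynomial (ι ⊕ (Fin k × ι)) ℝ) =
          MvPolynomial.rename Sum.inr (∏ j, MvPolynomial.X (j, i j)) := by simp [map_prod]
      rw [this]
      exact pderiv_rename_of_notMem_range (by simp) _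
    rw [MvPolynomial.pderiv_mul, hz, mul_zero, add_zero,
      MvPolynomial.pderiv_rename Sum.inl_injective, iterPderiv_cons, map_mul,
      MvPolynomial.rename_rename, map_prod, Fin.prod_univ_succ]
    simp only [MvPolynomial.rename_X, Fin.cons_zero, Fin.cons_succ]
    have : sharpEmb ι k ∘ Sum.inl = Sum.inl := rfl
    rw [this, mul_assoc, mul_comm (MvPolynomial.X (Sum.inr (0, a)))]
    rfl

theorem sharpPoly_eq_sharpRec {ι : Type} {s : Finset ι} (k : ℕ) {P : MvPolynomial ι ℝ}
    (hP : P ∈ MvPolynomial.supported ℝ (s : Set ι)) : sharpPoly k P = sharpRec s k P := by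
  rw [MvPolynomial.mem_supported] at hP
  rw [sharpRec_eq_sum, sharpPoly]
  refine Finset.sum_subset (Fintype.piFinset_subset _ _ fun _ => by exact_mod_cast hP)
    fun i _ hi => ?_
  rw [Fintype.mem_piFinset, not_forall] at hi
  obtain ⟨j, hj⟩ := hi
  rw [iterPderiv_eq_zero i hj, map_zero, zero_mul]

theorem sharpRec_sub {ι : Type} (s : Finset ι) (k : ℕ) (P Q : MvPolynomial ι ℝ) :
    sharpRec s k (P - Q) = sharpRec s k P - sharpRec s k Q := by
  induction k with
  | zero => simp [sharpRec]
  | succ k ih =>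
    simp only [sharpRec, linExt, ih, map_sub, sub_mul, Finset.sum_sub_distrib]

/-- The variables of `♯^k` with all indices in `s`. -/
def sharpVars {ι : Type} (s : Finset ι) (k : ℕ) : Finset (ι ⊕ (Fin k × ι)) :=
  s.disjSum (Finset.univ ×ˢ s)

theorem sharpRec_mem_supported {ι : Type} {s : Finset ι} (k : ℕ) {P : MvPolynomial ι ℝ}
    (hP : P ∈ MvPolynomial.supported ℝ (s : Set ι)) :
    sharpRec s k P ∈ MvPolynomial.supported ℝ (sharpVars s k : Set (ι ⊕ (Fin k × ι))) := by
  rw [sharpRec_eq_sum]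
  refine sum_mem fun i hi => mul_mem ?_ (prod_mem fun j _ => ?_)
  · classical
    have h := MvPolynomial.mem_supported.1 (iterPderiv_mem_supported hP i)
    rw [MvPolynomial.mem_supported]
    intro v hv
    obtain ⟨k, hk, rfl⟩ := Finset.mem_image.1 (MvPolynomial.vars_rename _ _ hv)
    simpa [sharpVars] using h hk
  · rw [MvPolynomial.X_mem_supported]
    simpa [sharpVars] using Fintype.mem_piFinset.1 hi j

/-- Differentiation loses one degree and the fresh variable restores it. A vanishing derivative is
treated separately, since degree subtraction truncates at 0. -/
theorem totalDegree_linExt_le {κ κ' ι' : Type} (f : κ → ι') (g : κ' → ι') (J : Finset κ')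
    (v : κ' → κ) {P : MvPolynomial κ ℝ} {m : ℕ} (hm : P.totalDegree ≤ m) :
    (linExt f g J fun a => MvPolynomial.pderiv (v a) P).totalDegree ≤ m := by
  refine MvPolynomial.totalDegree_finsetSum_le fun a _ => ?_
  by_cases h0 : MvPolynomial.pderiv (v a) P = 0
  · simp [h0]
  have h1 := totalDegree_pderiv_add_one_le h0
  have h2 := MvPolynomial.totalDegree_rename_le f (MvPolynomial.pderiv (v a) P)
  have h3 := MvPolynomial.totalDegree_mul (MvPolynomial.rename f (MvPolynomial.pderiv (v a) P))
    (MvPolynomial.X (g a))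
  rw [MvPolynomial.totalDegree_X] at h3
  change (MvPolynomial.rename f (MvPolynomial.pderiv (v a) P) *
    MvPolynomial.X (g a)).totalDegree ≤ m
  omega

theorem totalDegree_sharpRec_le {ι : Type} {s : Finset ι} (k : ℕ) {P : MvPolynomial ι ℝ} {m : ℕ}
    (hm : P.totalDegree ≤ m) : (sharpRec s k P).totalDegree ≤ m := by
  induction k with
  | zero => exact (MvPolynomial.totalDegree_rename_le _ _).trans hm
  | succ k ih => exact totalDegree_linExt_le _ _ _ _ ih

/-- The derivatives in the G variables are nonnegative contributions that are simply dropped. -/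
theorem eval_sum_inl_le {ι : Type} (s : Finset ι) (k : ℕ) (Y : MvPolynomial (ι ⊕ (Fin k × ι)) ℝ)
    (x : ι ⊕ (Fin k × ι) → ℝ) :
    ∑ a ∈ s, MvPolynomial.eval x (MvPolynomial.pderiv (Sum.inl a) Y) ^ 2 ≤
      MvPolynomial.eval x (gam (sharpVars s k) Y Y) := by
  rw [eval_gam_self, sharpVars, Finset.sum_disjSum]
  exact le_add_of_nonneg_right (Finset.sum_nonneg fun _ _ => sq_nonneg _)

/-- The second moment of ♯^{k+1} is that of the gradient of ♯^k in the N variables, and reverse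
Poincaré bounds it at the cost of a factor m. -/
theorem expect_sharpRec_sq_le {ι : Type} {s : Finset ι} (k : ℕ) {P : MvPolynomial ι ℝ} {m : ℕ}
    (hP : P ∈ MvPolynomial.supported ℝ (s : Set ι)) (hm : P.totalDegree ≤ m) :
    expect (sharpRec s k P ^ 2) ≤ (m : ℝ) ^ k * expect (P ^ 2) := by
  induction k with
  | zero => simp [sharpRec, ← map_pow, expect_rename Sum.inl_injective]
  | succ k ih =>
    rw [sharpRec, expect_linExt_sq (sharpEmb_sharpNew_injective ι k), ← map_sum]
    calc _ ≤ expect (gam (sharpVars s k) (sharpRec s k P) (sharpRec s k P)) :=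
          expect_mono fun x => by simpa using eval_sum_inl_le s k (sharpRec s k P) x
      _ ≤ m * expect (sharpRec s k P ^ 2) :=
          expect_gam_le (sharpRec_mem_supported k hP) (totalDegree_sharpRec_le k hm)
      _ ≤ m * ((m : ℝ) ^ k * expect (P ^ 2)) := by gcongr
      _ = _ := by ring

theorem Bdd.sharpRec {ι : Type} {s : Finset ι} (k : ℕ) {P : MvPolynomial ι ℝ} {m : ℕ} {B : ℝ}
    (hP : Bdd s m B P) : Bdd (sharpVars s k) m ((m : ℝ) ^ k * B) (sharpRec s k P) where
  supp := sharpRec_mem_supported k hP.supp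
  deg := totalDegree_sharpRec_le k hP.deg
  norm := (expect_sharpRec_sq_le k hP.supp hP.deg).trans
    (mul_le_mul_of_nonneg_left hP.norm (by positivity))

/-- The Laplace transform of the carré du champ of `♯^k[P]` is bounded by the characteristic
function of `♯^(k+1)[P]`. -/
theorem integral_exp_gam_sharpRec_le {ι : Type} (s : Finset ι) (k : ℕ) (P : MvPolynomial ι ℝ)
    (t : ℝ) :
    ∫ x, Real.exp (-(t ^ 2 / 2) * MvPolynomial.eval x
      (gam (sharpVars s k) (sharpRec s k P) (sharpRec s k P))) ∂(wiener (ι ⊕ (Fin k × ι))) ≤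
    ∫ x, Real.cos (t * MvPolynomial.eval x (sharpRec s (k + 1) P))
      ∂(wiener (ι ⊕ (Fin (k + 1) × ι))) := by
  -- Integrating out the newest Gaussian family turns the right side into a Laplace transform of the
  -- gradient in the N variables alone; what remains is monotonicity.
  rw [sharpRec, linExt, integral_cos_linear (sharpEmb_sharpNew_injective ι k)]
  refine integral_mono_of_nonneg (ae_of_all _ fun x => (Real.exp_nonneg _)) ?_
    (ae_of_all _ fun x => ?_)
  · refine Integrable.of_bound (C := 1) (Measurable.aestronglyMeasurable ?_)
      (ae_of_all _ fun x => ?_)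
    · exact ((Finset.measurable_fun_sum _ fun a _ => (measurable_eval _).pow_const 2).const_mul
        _).exp
    · rw [Real.norm_of_nonneg (Real.exp_nonneg _), Real.exp_le_one_iff, neg_mul, neg_nonpos]
      positivity
  · refine Real.exp_le_exp.2 ?_
    rw [neg_mul, neg_mul, neg_le_neg_iff]
    exact mul_le_mul_of_nonneg_left (eval_sum_inl_le s k _ x) (by positivity)

/-! ### Extension of the operators by density -/

/-- A polynomial in the Gaussian variables as an element of `Lᵖ`. -/
noncomputable def toLpPoly {ι : Type} (p : ℝ≥0∞) [Fact (p ≠ ∞)] :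
    MvPolynomial ι ℝ →ₗ[ℝ] Lp ℝ p (wiener ι) where
  toFun P := (memLp_eval P (Fact.out (p := p ≠ ∞))).toLp _
  map_add' P Q := by
    rw [← MemLp.toLp_add]
    exact MemLp.toLp_congr _ _ (ae_of_all _ fun x => by simp)
  map_smul' c P := by
    rw [RingHom.id_apply, ← MemLp.toLp_const_smul]
    exact MemLp.toLp_congr _ _ (ae_of_all _ fun x => by simp)

instance fact_one_ne_top : Fact ((1 : ℝ≥0∞) ≠ ∞) := ⟨by simp⟩
instance fact_two_ne_top : Fact ((2 : ℝ≥0∞) ≠ ∞) := ⟨by simp⟩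

theorem coeFn_toLpPoly {ι : Type} (p : ℝ≥0∞) [Fact (p ≠ ∞)] (P : MvPolynomial ι ℝ) :
    toLpPoly p P =ᵐ[wiener ι] fun x => MvPolynomial.eval x P :=
  (memLp_eval P (Fact.out (p := p ≠ ∞))).coeFn_toLp

theorem tendsto_toLpPoly_iff {ι : Type} (p : ℝ≥0∞) [Fact (p ≠ ∞)] [Fact (1 ≤ p)]
    (P : ℕ → MvPolynomial ι ℝ) (F : Lp ℝ p (wiener ι)) :
    Tendsto (fun n => toLpPoly p (P n)) atTop (𝓝 F) ↔
      Tendsto (fun n => eLpNorm (fun x => MvPolynomial.eval x (P n) - F x) p (wiener ι))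
        atTop (𝓝 0) := by
  rw [Lp.tendsto_Lp_iff_tendsto_eLpNorm']
  refine tendsto_congr fun n => eLpNorm_congr_ae ?_
  filter_upwards [coeFn_toLpPoly p (P n)] with x hx
  simp [hx]

theorem approximates_iff {ι : Type} (P : ℕ → MvPolynomial ι ℝ) (F : Lp ℝ 2 (wiener ι)) :
    Approximates P F ↔ (∃ m : ℕ, ∀ n, (P n).totalDegree ≤ m) ∧
      Tendsto (fun n => toLpPoly 2 (P n)) atTop (𝓝 F) := by
  rw [Approximates, tendsto_toLpPoly_iff]

theorem norm_toLpPoly_two_sq {ι : Type} (P : MvPolynomial ι ℝ) :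
    ‖toLpPoly 2 P‖ ^ 2 = expect (P ^ 2) := by
  have h := L2.inner_def (𝕜 := ℝ) (toLpPoly 2 P) (toLpPoly 2 P)
  rw [real_inner_self_eq_norm_sq] at h
  rw [h, expect_apply]
  refine integral_congr_ae ?_
  filter_upwards [coeFn_toLpPoly 2 P] with x hx
  simp [hx, sq]

theorem norm_toLpPoly_one {ι : Type} (P : MvPolynomial ι ℝ) :
    ‖toLpPoly 1 P‖ = ∫ x, |MvPolynomial.eval x P| ∂(wiener ι) := by
  rw [L1.norm_eq_integral_norm]
  refine integral_congr_ae ?_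
  filter_upwards [coeFn_toLpPoly 1 P] with x hx
  simp [hx]

theorem exists_finset_supported {ι : Type} (P Q : MvPolynomial ι ℝ) : ∃ s : Finset ι,
    P ∈ MvPolynomial.supported ℝ (s : Set ι) ∧ Q ∈ MvPolynomial.supported ℝ (s : Set ι) := by
  classical
  refine ⟨P.vars ∪ Q.vars, ?_, ?_⟩ <;> rw [MvPolynomial.mem_supported] <;> simp

/-- Uniform continuity on sets of polynomials of bounded degree and bounded norm. -/
def BddDegreeLipschitz {ι : Type} {E : Type} [NormedAddCommGroup E]
    (T : MvPolynomial ι ℝ → E) : Prop :=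
  ∀ (m : ℕ) (b : ℝ), ∃ c : ℝ, ∀ A B : MvPolynomial ι ℝ, A.totalDegree ≤ m → B.totalDegree ≤ m →
    ‖toLpPoly 2 A‖ ≤ b → ‖toLpPoly 2 B‖ ≤ b → ∀ a : ℝ, 0 < a →
    ‖toLpPoly 2 A - toLpPoly 2 B‖ ≤ a → ‖T A - T B‖ ≤ c * a

theorem BddDegreeLipschitz.tendsto_sub {ι : Type} {E : Type} [NormedAddCommGroup E]
    {T : MvPolynomial ι ℝ → E} (hT : BddDegreeLipschitz T) {α : Type} {l : Filter α}
    {P Q : α → MvPolynomial ι ℝ} {m : ℕ} {b : ℝ} (hP : ∀ n, (P n).totalDegree ≤ m)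
    (hQ : ∀ n, (Q n).totalDegree ≤ m) (hP' : ∀ n, ‖toLpPoly 2 (P n)‖ ≤ b)
    (hQ' : ∀ n, ‖toLpPoly 2 (Q n)‖ ≤ b)
    (h : Tendsto (fun n => toLpPoly 2 (P n) - toLpPoly 2 (Q n)) l (𝓝 0)) :
    Tendsto (fun n => T (P n) - T (Q n)) l (𝓝 0) := by
  obtain ⟨c, hc⟩ := hT m b
  rw [Metric.tendsto_nhds] at h ⊢
  intro ε hε
  have hc0 : 0 < |c| + 1 := by positivity
  filter_upwards [h (ε / (2 * (|c| + 1))) (by positivity)] with n hn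
  rw [dist_zero_right] at hn ⊢
  have := hc _ _ (hP n) (hQ n) (hP' n) (hQ' n) (ε / (2 * (|c| + 1))) (by positivity) hn.le
  calc ‖T (P n) - T (Q n)‖ ≤ c * (ε / (2 * (|c| + 1))) := this
    _ ≤ (|c| + 1) * (ε / (2 * (|c| + 1))) := by
        gcongr
        linarith [le_abs_self c]
    _ = ε / 2 := by field_simp
    _ < ε := by linarith

theorem exists_norm_le_of_tendsto {E : Type} [NormedAddCommGroup E] {u : ℕ → E} {F : E}
    (h : Tendsto u atTop (𝓝 F)) : ∃ b : ℝ, ∀ n, ‖u n‖ ≤ b := by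
  obtain ⟨b, hb⟩ := (Metric.isBounded_range_of_tendsto u h).exists_norm_le
  exact ⟨b, fun n => hb _ ⟨n, rfl⟩⟩

theorem BddDegreeLipschitz.exists_limit {ι : Type} {E : Type} [NormedAddCommGroup E]
    [CompleteSpace E] {T : MvPolynomial ι ℝ → E} (hT : BddDegreeLipschitz T)
    {P : ℕ → MvPolynomial ι ℝ} {F : Lp ℝ 2 (wiener ι)} (hP : Approximates P F) :
    ∃ Y, Tendsto (fun n => T (P n)) atTop (𝓝 Y) := by
  rw [approximates_iff] at hP
  obtain ⟨⟨m, hm⟩, h⟩ := hP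
  obtain ⟨b, hb⟩ := exists_norm_le_of_tendsto h
  refine cauchySeq_tendsto_of_complete ?_
  rw [cauchySeq_iff_tendsto_dist_atTop_0]
  have key : Tendsto (fun p : ℕ × ℕ => T (P p.1) - T (P p.2)) atTop (𝓝 0) := by
    refine hT.tendsto_sub (m := m) (b := b) (fun _ => hm _) (fun _ => hm _) (fun _ => hb _)
      (fun _ => hb _) ?_
    rw [tendsto_zero_iff_norm_tendsto_zero]
    have := cauchySeq_iff_tendsto_dist_atTop_0.1 h.cauchySeq
    simpa [dist_eq_norm] using this
  rw [tendsto_zero_iff_norm_tendsto_zero] at key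
  simpa [dist_eq_norm] using key

theorem BddDegreeLipschitz.tendsto_of_tendsto {ι : Type} {E : Type} [NormedAddCommGroup E]
    {T : MvPolynomial ι ℝ → E} (hT : BddDegreeLipschitz T)
    {P Q : ℕ → MvPolynomial ι ℝ} {F : Lp ℝ 2 (wiener ι)} (hP : Approximates P F)
    (hQ : Approximates Q F) {Y : E} (hY : Tendsto (fun n => T (Q n)) atTop (𝓝 Y)) :
    Tendsto (fun n => T (P n)) atTop (𝓝 Y) := by
  rw [approximates_iff] at hP hQ
  obtain ⟨⟨m, hm⟩, h⟩ := hP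
  obtain ⟨⟨m', hm'⟩, h'⟩ := hQ
  obtain ⟨b, hb⟩ := exists_norm_le_of_tendsto h
  obtain ⟨b', hb'⟩ := exists_norm_le_of_tendsto h'
  have key := hT.tendsto_sub (m := max m m') (b := max b b') (l := atTop) (P := P) (Q := Q)
    (fun n => (hm n).trans (le_max_left _ _)) (fun n => (hm' n).trans (le_max_right _ _))
    (fun n => (hb n).trans (le_max_left _ _)) (fun n => (hb' n).trans (le_max_right _ _))
    (by simpa using h.sub h')
  simpa using key.add hY

theorem bddDegreeLipschitz_sharpPoly {ι : Type} (k : ℕ) :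
    BddDegreeLipschitz (ι := ι) (fun P => toLpPoly 2 (sharpPoly k P)) := by
  intro m b
  refine ⟨√((m : ℝ) ^ k), fun A B hA hB _ _ a ha h => ?_⟩
  obtain ⟨s, hAs, hBs⟩ := exists_finset_supported A B
  have h1 := expect_sharpRec_sq_le k (sub_mem hAs hBs)
    ((MvPolynomial.totalDegree_sub _ _).trans (max_le hA hB))
  rw [← map_sub] at h
  rw [← map_sub, sharpPoly_eq_sharpRec k hAs, sharpPoly_eq_sharpRec k hBs, ← sharpRec_sub]
  rw [← norm_toLpPoly_two_sq, ← norm_toLpPoly_two_sq] at h1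
  refine le_of_sq_le_sq ?_ (by positivity)
  rw [mul_pow, Real.sq_sqrt (by positivity)]
  exact h1.trans (by gcongr)

/-- Γ(A,A) - Γ(B,B) = Γ(A + B, A - B), followed by the weighted arithmetic-geometric inequality with
free parameter r. -/
theorem eval_gam_sub_le {ι : Type} (s : Finset ι) (A B : MvPolynomial ι ℝ) {r : ℝ} (hr : 0 < r)
    (x : ι → ℝ) :
    |MvPolynomial.eval x (gam s A A - gam s B B)| ≤ MvPolynomial.eval x
      (MvPolynomial.C (r / 2) * gam s (A + B) (A + B) +
        MvPolynomial.C (r⁻¹ / 2) * gam s (A - B) (A - B)) := by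
  simp only [gam, map_sub, map_sum, map_mul, map_add, MvPolynomial.eval_C,
    ← Finset.sum_sub_distrib, Finset.mul_sum, ← Finset.sum_add_distrib]
  refine (Finset.abs_sum_le_sum_abs _ _).trans (Finset.sum_le_sum fun i _ => ?_)
  set u := MvPolynomial.eval x (MvPolynomial.pderiv i A)
  set v := MvPolynomial.eval x (MvPolynomial.pderiv i B)
  have hr' : r * r⁻¹ = 1 := mul_inv_cancel₀ hr.ne'
  have key : ∀ a b : ℝ, a * b ≤ r / 2 * (a * a) + r⁻¹ / 2 * (b * b) := fun a b => by
    have h1 : 0 ≤ r * (a - r⁻¹ * b) ^ 2 := by positivity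
    have h2 : r * (a - r⁻¹ * b) ^ 2 = r * (a * a) - 2 * (r * r⁻¹) * (a * b) +
      (r * r⁻¹) * r⁻¹ * (b * b) := by ring
    rw [h2, hr'] at h1
    linarith
  have e : u * u - v * v = (u + v) * (u - v) := by ring
  rw [e, abs_le]
  constructor
  · have := key (u + v) (-(u - v)); linarith
  · exact key _ _

theorem bddDegreeLipschitz_gammaPoly {ι : Type} :
    BddDegreeLipschitz (ι := ι) (fun P => toLpPoly 1 (gammaPoly P)) := by
  intro m b
  refine ⟨m * (2 * |b| + 1), fun A B hA hB hAb hBb a ha h => ?_⟩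
  obtain ⟨s, hAs, hBs⟩ := exists_finset_supported A B
  have hβ : 0 < 2 * |b| + 1 := by positivity
  -- This weight balances the two terms: the sum A + B has norm at most 2|b| + 1 and the difference
  -- at most `a`. Positivity of `a` is what makes the weight admissible.
  have hr : 0 < a / (2 * |b| + 1) := by positivity
  rw [← map_sub, gammaPoly_eq_gam hAs, gammaPoly_eq_gam hBs, norm_toLpPoly_one]
  have h1 := integral_mono (integrable_eval _).abs (integrable_eval _)
    (fun x => eval_gam_sub_le s A B hr x)
  rw [← expect_apply, map_add, expect_C_mul, expect_C_mul] at h1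
  have h2 := expect_gam_le (add_mem hAs hBs)
    ((MvPolynomial.totalDegree_add _ _).trans (max_le hA hB))
  have h3 := expect_gam_le (sub_mem hAs hBs)
    ((MvPolynomial.totalDegree_sub _ _).trans (max_le hA hB))
  rw [← norm_toLpPoly_two_sq] at h2 h3
  rw [← map_sub] at h
  have h4 : ‖toLpPoly 2 (A + B)‖ ≤ 2 * |b| + 1 := by
    rw [map_add]
    linarith [norm_add_le (toLpPoly 2 A) (toLpPoly 2 B), le_abs_self b]
  refine h1.trans ?_
  calc _ ≤ a / (2 * |b| + 1) / 2 * (m * (2 * |b| + 1) ^ 2) +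
        (a / (2 * |b| + 1))⁻¹ / 2 * (m * a ^ 2) := by
        refine add_le_add (mul_le_mul_of_nonneg_left (h2.trans ?_) (by positivity))
          (mul_le_mul_of_nonneg_left (h3.trans ?_) (by positivity)) <;> gcongr
    _ = m * (2 * |b| + 1) * a := by field_simp; ring

/-- Some approximating sequence has a limit, by completeness, so the choice operator returns such a
limit. The Lipschitz bound then forces the same limit along every approximating sequence. -/
theorem tendsto_gamma {ι : Type} {P : ℕ → MvPolynomial ι ℝ} {F : Lp ℝ 2 (wiener ι)}
    (hP : Approximates P F) :
    Tendsto (fun n => toLpPoly 1 (gammaPoly (P n))) atTop (𝓝 (gamma F)) := by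
  obtain ⟨Y, hY⟩ := bddDegreeLipschitz_gammaPoly.exists_limit hP
  have h : ∃ Y : Lp ℝ 1 (wiener ι), ∃ P : ℕ → MvPolynomial ι ℝ, Approximates P F ∧
      Tendsto (fun n => eLpNorm (fun x => MvPolynomial.eval x (gammaPoly (P n)) - Y x) 1
        (wiener ι)) atTop (𝓝 0) := ⟨Y, P, hP, (tendsto_toLpPoly_iff 1 _ Y).1 hY⟩
  obtain ⟨Q, hQ, hQ'⟩ := Classical.epsilon_spec h
  exact bddDegreeLipschitz_gammaPoly.tendsto_of_tendsto hP hQ ((tendsto_toLpPoly_iff 1 _ _).2 hQ')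

theorem tendsto_sharp {ι : Type} (k : ℕ) {P : ℕ → MvPolynomial ι ℝ} {F : Lp ℝ 2 (wiener ι)}
    (hP : Approximates P F) :
    Tendsto (fun n => toLpPoly 2 (sharpPoly k (P n))) atTop (𝓝 (sharp k F)) := by
  obtain ⟨Y, hY⟩ := (bddDegreeLipschitz_sharpPoly k).exists_limit hP
  have h : ∃ Y : Lp ℝ 2 (wiener (ι ⊕ (Fin k × ι))), ∃ P : ℕ → MvPolynomial ι ℝ,
      Approximates P F ∧ Tendsto (fun n => eLpNorm (fun x =>
        MvPolynomial.eval x (sharpPoly k (P n)) - Y x) 2 (wiener (ι ⊕ (Fin k × ι))))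
        atTop (𝓝 0) := ⟨Y, P, hP, (tendsto_toLpPoly_iff 2 _ Y).1 hY⟩
  obtain ⟨Q, hQ, hQ'⟩ := Classical.epsilon_spec h
  exact (bddDegreeLipschitz_sharpPoly k).tendsto_of_tendsto hP hQ
    ((tendsto_toLpPoly_iff 2 _ _).2 hQ')

theorem approximates_sharp {ι : Type} (k : ℕ) {P : ℕ → MvPolynomial ι ℝ}
    {F : Lp ℝ 2 (wiener ι)} (hP : Approximates P F) :
    Approximates (fun n => sharpPoly k (P n)) (sharp k F) := by
  refine (approximates_iff _ _).2 ⟨?_, tendsto_sharp k hP⟩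
  obtain ⟨⟨m, hm⟩, -⟩ := hP
  refine ⟨m, fun n => ?_⟩
  rw [sharpPoly_eq_sharpRec k (MvPolynomial.mem_supported_vars (P n))]
  exact totalDegree_sharpRec_le k (hm n)

/-! ### Chaoses as closures of polynomials of bounded degree -/

/-- The polynomials of degree at most `m` as a subspace of `L²`. -/
noncomputable def polyLE (ι : Type) (m : ℕ) : Submodule ℝ (Lp ℝ 2 (wiener ι)) :=
  (MvPolynomial.restrictTotalDegree ι ℝ m).map (toLpPoly 2)

/-- The product of Hermite polynomials as a polynomial. -/
noncomputable def hermitePoly {ι : Type} (k : ι →₀ ℕ) : MvPolynomial ι ℝ :=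
  k.prod fun i n => Polynomial.aeval (MvPolynomial.X i) (Polynomial.hermite n)

theorem eval_hermitePoly {ι : Type} (k : ι →₀ ℕ) (x : ι → ℝ) :
    MvPolynomial.eval x (hermitePoly k) = hermiteProduct k x := by
  rw [hermitePoly, hermiteProduct, Finsupp.prod, Finsupp.prod, map_prod]
  refine Finset.prod_congr rfl fun i _ => ?_
  rw [Polynomial.aeval_def, Polynomial.hom_eval₂, MvPolynomial.eval_X, Polynomial.aeval_def]
  congr 1
  exact RingHom.ext_int _ _

theorem totalDegree_aeval_le {ι : Type} {P : MvPolynomial ι ℝ} {d : ℕ} (hP : P.totalDegree ≤ d)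
    (p : Polynomial ℤ) : (Polynomial.aeval P p).totalDegree ≤ p.natDegree * d := by
  rw [Polynomial.aeval_eq_sum_range]
  refine MvPolynomial.totalDegree_finsetSum_le fun i hi => ?_
  have hi' := Nat.lt_succ_iff.1 (Finset.mem_range.1 hi)
  refine (MvPolynomial.totalDegree_smul_le _ _).trans ((MvPolynomial.totalDegree_pow _ _).trans ?_)
  exact Nat.mul_le_mul hi' hP

theorem totalDegree_hermitePoly_le {ι : Type} (k : ι →₀ ℕ) :
    (hermitePoly k).totalDegree ≤ k.sum fun _ n => n := by
  rw [hermitePoly, Finsupp.prod, Finsupp.sum]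
  refine (MvPolynomial.totalDegree_finsetProd _ _).trans (Finset.sum_le_sum fun i _ => ?_)
  have := totalDegree_aeval_le (MvPolynomial.totalDegree_X (R := ℝ) i).le
    (Polynomial.hermite (k i))
  rwa [Polynomial.natDegree_hermite, mul_one] at this

/-- Products of Hermite polynomials are polynomials of the right degree. This inclusion is all that
approximation requires. -/
theorem chaosLE_le {ι : Type} (m : ℕ) : chaosLE ι m ≤ (polyLE ι m).topologicalClosure := by
  refine iSup₂_le fun k hk => Submodule.topologicalClosure_mono (Submodule.span_le.2 ?_)
  rintro f ⟨κ, hκ, hf⟩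
  refine ⟨hermitePoly κ, ?_, ?_⟩
  · rw [SetLike.mem_coe, MvPolynomial.mem_restrictTotalDegree]
    have := Nat.lt_succ_iff.1 (Finset.mem_range.1 hk)
    exact ((totalDegree_hermitePoly_le κ).trans hκ.le).trans this
  · refine Lp.ext ?_
    filter_upwards [coeFn_toLpPoly 2 (hermitePoly κ), hf] with x h1 h2
    rw [h1, h2, eval_hermitePoly]

theorem exists_approximates {ι : Type} {m : ℕ} {F : Lp ℝ 2 (wiener ι)} (hF : F ∈ chaosLE ι m) :
    ∃ P : ℕ → MvPolynomial ι ℝ, (∀ n, (P n).totalDegree ≤ m) ∧ Approximates P F := by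
  have h := chaosLE_le m hF
  rw [← SetLike.mem_coe, Submodule.topologicalClosure_coe, mem_closure_iff_seq_limit] at h
  obtain ⟨u, hu, hlim⟩ := h
  choose P hP hPu using hu
  have hd : ∀ n, (P n).totalDegree ≤ m := fun n =>
    (MvPolynomial.mem_restrictTotalDegree _ _ _).1 (hP n)
  exact ⟨P, hd, (approximates_iff _ _).2 ⟨⟨m, hd⟩, by simpa only [hPu] using hlim⟩⟩

/-! ### Negative moments and the sharp operators -/

/-- Combines the domination of the Laplace transform by the characteristic function of ♯^{k+1}[P]
with the oscillatory bound. The maxima with 0 are inert for polynomials; they make both sides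
bounded continuous functions of Γ on all of ℝ, so that the inequality survives L¹ limits. -/
theorem exists_laplace_le (m k r : ℕ) (B : ℝ) : ∃ C : ℝ, 0 < C ∧ ∀ (ι : Type)
    (P : MvPolynomial ι ℝ), P.totalDegree ≤ m → expect (P ^ 2) ≤ B → ∀ ε : ℝ, 0 < ε → ε ≤ 1 →
    ∀ t : ℝ, 1 ≤ t →
    ∫ x, Real.exp (-(t ^ 2 / 2 * max (MvPolynomial.eval x (gammaPoly (sharpPoly k P))) 0))
      ∂(wiener (ι ⊕ (Fin k × ι))) ≤
    C * (ε + (t ^ r)⁻¹) * (1 + ∫ x, ((max (MvPolynomial.eval x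
      (gammaPoly (sharpPoly (k + 1) P))) 0 + ε)⁻¹) ^ (4 * r)
        ∂(wiener (ι ⊕ (Fin (k + 1) × ι)))) := by
  obtain ⟨C, hC, h⟩ := exists_abs_integral_cos_le m r ((m : ℝ) ^ (k + 1) * B)
  refine ⟨C + 1, by positivity, fun ι P hm hB ε hε hε1 t ht => ?_⟩
  have hs := MvPolynomial.mem_supported_vars P
  have hX := Bdd.sharpRec (k + 1) (⟨hs, hm, hB⟩ : Bdd P.vars m B P)
  have h1 := (le_abs_self _).trans (h _ _ _ hX ε hε hε1 t ht)
  have h2 := (integral_exp_gam_sharpRec_le P.vars k P t).trans h1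
  rw [sharpPoly_eq_sharpRec k hs, sharpPoly_eq_sharpRec (k + 1) hs,
    gammaPoly_eq_gam (sharpRec_mem_supported k hs),
    gammaPoly_eq_gam (sharpRec_mem_supported (k + 1) hs)]
  simp only [max_eq_left (eval_gam_self_nonneg _ _ _), ← neg_mul]
  refine h2.trans ?_
  have h0 : 0 ≤ ∫ x, regInv (sharpVars P.vars (k + 1)) (sharpRec P.vars (k + 1) P) ε x ^ (4 * r)
      ∂(wiener (ι ⊕ (Fin (k + 1) × ι))) :=
    integral_nonneg fun x => pow_nonneg (regInv_pos _ _ hε x).le _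
  simp only [regInv] at h0 ⊢
  have h3 : 0 ≤ ε + (t ^ r)⁻¹ := by positivity
  gcongr
  linarith

theorem ofReal_inv_pow_le (y : ℝ) {ε : ℝ} (hε : 0 < ε) {p : ℕ} (hp : 0 < p) :
    ENNReal.ofReal (((max y 0 + ε)⁻¹) ^ p) ≤ ENNReal.ofReal y ^ (-(p : ℝ)) := by
  rcases le_or_gt y 0 with hy | hy
  · rw [ENNReal.ofReal_of_nonpos hy, ENNReal.zero_rpow_of_neg (by simpa using hp)]
    exact le_top
  · rw [max_eq_left hy.le, ENNReal.ofReal_rpow_of_pos hy, Real.rpow_neg hy.le, Real.rpow_natCast,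
      ← inv_pow]
    refine ENNReal.ofReal_le_ofReal ?_
    gcongr
    linarith

/-- If the negative moment of g is infinite there is nothing to prove. Otherwise it bounds the
regularized integrals uniformly in ε, so ε → 0 leaves a Laplace transform of order t^{-(2q+1)}, just
enough for the q-th negative moment. -/
theorem negMoment_le_of_regularized {Ω Ω' : Type} [MeasurableSpace Ω] [MeasurableSpace Ω']
    {μ : Measure Ω} {ν : Measure Ω'} [IsProbabilityMeasure μ] [IsProbabilityMeasure ν]
    {f : Ω → ℝ} {g : Ω' → ℝ} (hf : AEMeasurable f μ) (hg : AEMeasurable g ν) (q : ℕ) {C : ℝ}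
    (hC : 0 < C) (h : ∀ ε : ℝ, 0 < ε → ε ≤ 1 → ∀ t : ℝ, 1 ≤ t →
      ∫ x, Real.exp (-(t ^ 2 / 2 * max (f x) 0)) ∂μ ≤ C * (ε + (t ^ (2 * q + 1))⁻¹) *
        (1 + ∫ x, ((max (g x) 0 + ε)⁻¹) ^ (4 * (2 * q + 1)) ∂ν)) :
    negMoment μ f q ≤ 1 + ENNReal.ofReal (4 ^ q * Real.exp 1 * 2) *
      (ENNReal.ofReal C * (1 + negMoment ν g ((4 * (2 * q + 1) : ℕ) : ℝ))) := by
  set p := 4 * (2 * q + 1) with hp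
  by_cases hM : negMoment ν g (p : ℝ) = ∞
  · rw [hM]
    rw [add_top, ENNReal.mul_top (by simpa using hC), ENNReal.mul_top (by simp; positivity)]
    simp
  set M := (negMoment ν g (p : ℝ)).toReal with hMdef
  have hM0 : 0 ≤ M := ENNReal.toReal_nonneg
  have hgint : ∀ ε : ℝ, 0 < ε → ∫ x, ((max (g x) 0 + ε)⁻¹) ^ p ∂ν ≤ M := by
    intro ε hε
    have hm : AEMeasurable (fun x => ((max (g x) 0 + ε)⁻¹) ^ p) ν :=
      (((hg.max aemeasurable_const).add_const ε).inv).pow_const p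
    rw [integral_eq_lintegral_of_nonneg_ae (ae_of_all _ fun x => ?_) hm.aestronglyMeasurable]
    swap
    · change 0 ≤ ((max (g x) 0 + ε)⁻¹) ^ p
      positivity
    exact ENNReal.toReal_mono hM (lintegral_mono fun x =>
      ofReal_inv_pow_le (g x) hε (by omega))
  have hlap : ∀ t : ℝ, 1 ≤ t → ∫ x, Real.exp (-(t ^ 2 / 2 * max (f x) 0)) ∂μ ≤
      C * (t ^ (2 * q + 1))⁻¹ * (1 + M) := by
    intro t ht
    have hlim : Tendsto (fun ε : ℝ => C * (ε + (t ^ (2 * q + 1))⁻¹) * (1 + M)) (𝓝[>] 0)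
        (𝓝 (C * (0 + (t ^ (2 * q + 1))⁻¹) * (1 + M))) := by
      refine Tendsto.mono_left (Continuous.tendsto ?_ _) nhdsWithin_le_nhds
      fun_prop
    rw [zero_add] at hlim
    refine ge_of_tendsto hlim ?_
    filter_upwards [Ioc_mem_nhdsGT (show (0 : ℝ) < 1 by norm_num)] with ε hε
    have ht0 : 0 < t := by linarith
    have hε0 := hε.1
    refine (h ε hε.1 hε.2 t ht).trans ?_
    have := hgint ε hε.1
    gcongr
  refine negMoment_le_of_laplace hf q fun n => ?_
  have h2 : (1 : ℝ) ≤ √2 := Real.one_le_sqrt.2 (by norm_num)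
  have h2n : (1 : ℝ) ≤ 2 ^ n := one_le_pow₀ (by norm_num)
  -- The factor √2 makes t²/2 equal to 4^n, the scale at which negative moments are read off.
  have h1 := hlap (√2 * 2 ^ n) (one_le_mul_of_one_le_of_one_le h2 h2n)
  have e1 : (√2 * 2 ^ n) ^ 2 / 2 = (4 : ℝ) ^ n := by
    rw [mul_pow, Real.sq_sqrt (by norm_num), ← pow_mul, mul_comm n 2, pow_mul]
    norm_num
  rw [e1] at h1
  have hm : AEMeasurable (fun x => Real.exp (-(4 ^ n * max (f x) 0))) μ :=
    ((hf.max aemeasurable_const).const_mul _).neg.exp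
  rw [← ofReal_integral_eq_lintegral_ofReal]
  · have e2 : ENNReal.ofReal C * (1 + negMoment ν g (p : ℝ)) *
        ENNReal.ofReal (((2 ^ n) ^ (2 * q + 1))⁻¹) =
        ENNReal.ofReal (C * (1 + M) * ((2 ^ n) ^ (2 * q + 1))⁻¹) := by
      rw [ENNReal.ofReal_mul (by positivity), ENNReal.ofReal_mul hC.le,
        ENNReal.ofReal_add zero_le_one hM0, ENNReal.ofReal_one, hMdef, ENNReal.ofReal_toReal hM]
    rw [e2]
    refine ENNReal.ofReal_le_ofReal (h1.trans ?_)
    rw [mul_right_comm]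
    refine mul_le_mul_of_nonneg_left ?_ (by positivity)
    refine inv_anti₀ (by positivity) (pow_le_pow_left₀ (by positivity) ?_ _)
    nlinarith
  · refine Integrable.of_bound (C := 1) hm.aestronglyMeasurable (ae_of_all _ fun x => ?_)
    rw [Real.norm_of_nonneg (Real.exp_nonneg _), Real.exp_le_one_iff, neg_nonpos]
    positivity
  · exact ae_of_all _ fun x => Real.exp_nonneg _

theorem integral_sq_eq_norm_sq {ι : Type} (F : Lp ℝ 2 (wiener ι)) :
    ∫ x, (F x) ^ 2 ∂(wiener ι) = ‖F‖ ^ 2 := by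
  have h := L2.inner_def (𝕜 := ℝ) F F
  rw [real_inner_self_eq_norm_sq] at h
  rw [h]
  exact integral_congr_ae (ae_of_all _ fun x => by simp [sq])

theorem ofReal_mul_add_eq {b c C : ℝ} (hb : 0 ≤ b) (hc : 0 ≤ c) (hC : 0 ≤ C) (M : ℝ≥0∞) :
    ENNReal.ofReal b * M + ENNReal.ofReal c * (ENNReal.ofReal C * (ENNReal.ofReal b * M + M)) =
      ENNReal.ofReal (b + c * (C * (b + 1))) * M := by
  rw [ENNReal.ofReal_add hb (by positivity), ENNReal.ofReal_mul hc,
    ENNReal.ofReal_mul hC, ENNReal.ofReal_add hb zero_le_one, ENNReal.ofReal_one]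
  ring

/-- At fixed ε and t the polynomial estimate passes to the limit, since both integrands are bounded
continuous functions of Γ. Only afterwards does ε tend to 0. The additive constants are absorbed
using the bounded mean of Γ[♯^{k+1}F,♯^{k+1}F]. -/
theorem exists_negMoment_sharp_succ_le (m q k : ℕ) : ∃ q' : ℕ, ∃ C : ℝ, 0 < C ∧
    ∀ (ι : Type), ∀ F ∈ chaosLE ι m, ∫ x, (F x) ^ 2 ∂(wiener ι) = 1 →
      negMoment (wiener (ι ⊕ (Fin k × ι))) (gamma (sharp k F)) q ≤ ENNReal.ofReal C *
        negMoment (wiener (ι ⊕ (Fin (k + 1) × ι))) (gamma (sharp (k + 1) F)) q' := by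
  -- The approximating polynomials have second moment tending to 1, hence eventually at most 2.
  obtain ⟨C, hC, h⟩ := exists_laplace_le m k (2 * q + 1) 2
  set p : ℕ := 4 * (2 * q + 1) with hp
  -- Reverse Poincaré bounds the mean of Γ[♯^{k+1}P,♯^{k+1}P] by m · m^{k+1} · 2; the 1 ensures
  -- positivity when m = 0.
  set B : ℝ := m * ((m : ℝ) ^ (k + 1) * 2) + 1 with hB
  have hB0 : 0 < B := by positivity
  set b : ℝ := 2 * (2 * B) ^ (p : ℝ) with hb
  set c : ℝ := 4 ^ q * Real.exp 1 * 2 with hc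
  refine ⟨p, b + c * (C * (b + 1)), by positivity, fun ι F hF hF1 => ?_⟩
  obtain ⟨P, hPm, hPF⟩ := exists_approximates hF
  have hPlim := ((approximates_iff _ _).1 hPF).2
  have hev : ∀ᶠ n in atTop, expect (P n ^ 2) ≤ 2 := by
    have hn := (hPlim.norm.pow 2)
    rw [← integral_sq_eq_norm_sq, hF1] at hn
    filter_upwards [hn.eventually (gt_mem_nhds (show (1 : ℝ) < 2 by norm_num))] with n hn
    rw [← norm_toLpPoly_two_sq]
    exact hn.le
  have hY := tendsto_gamma (approximates_sharp k hPF)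
  have hX := tendsto_gamma (approximates_sharp (k + 1) hPF)
  set f := gamma (sharp k F)
  set g := gamma (sharp (k + 1) F)
  have hmean : ∫⁻ x, ENNReal.ofReal (g x) ∂(wiener (ι ⊕ (Fin (k + 1) × ι))) ≤
      ENNReal.ofReal B := by
    have hle : ‖g‖ ≤ B := by
      refine le_of_tendsto hX.norm ?_
      filter_upwards [hev] with n hn
      have hs := MvPolynomial.mem_supported_vars (P n)
      have hbd := Bdd.sharpRec (k + 1) (⟨hs, hPm n, hn⟩ : Bdd (P n).vars m 2 (P n))
      rw [norm_toLpPoly_one, sharpPoly_eq_sharpRec (k + 1) hs, gammaPoly_eq_gam hbd.supp]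
      simp only [abs_of_nonneg (eval_gam_self_nonneg _ _ _)]
      rw [← expect_apply]
      refine (expect_gam_le hbd.supp hbd.deg).trans ?_
      have := mul_le_mul_of_nonneg_left hbd.norm (Nat.cast_nonneg (α := ℝ) m)
      linarith
    calc ∫⁻ x, ENNReal.ofReal (g x) ∂(wiener (ι ⊕ (Fin (k + 1) × ι))) ≤
          ∫⁻ x, ‖g x‖ₑ ∂(wiener (ι ⊕ (Fin (k + 1) × ι))) :=
          lintegral_mono fun x => Real.ofReal_le_enorm _
      _ = ENNReal.ofReal ‖g‖ := by
          rw [L1.norm_def, ENNReal.ofReal_toReal]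
          exact (L1.integrable_coeFn g).2.ne
      _ ≤ _ := ENNReal.ofReal_le_ofReal hle
  have key := negMoment_le_of_regularized (μ := wiener (ι ⊕ (Fin k × ι)))
    (ν := wiener (ι ⊕ (Fin (k + 1) × ι))) (f := f) (g := g)
    (Lp.aestronglyMeasurable f).aemeasurable (Lp.aestronglyMeasurable g).aemeasurable q hC ?_
  · have hone := one_le_mul_lintegral_rpow_neg
      (Lp.aestronglyMeasurable g).aemeasurable.ennreal_ofReal hB0 (Nat.cast_nonneg (α := ℝ) p) hmean
    change 1 ≤ ENNReal.ofReal b * negMoment (wiener (ι ⊕ (Fin (k + 1) × ι))) g p at hone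
    refine key.trans ?_
    rw [← hp, ← hc]
    set M := negMoment (wiener (ι ⊕ (Fin (k + 1) × ι))) g p
    calc _ ≤ ENNReal.ofReal b * M + ENNReal.ofReal c *
          (ENNReal.ofReal C * (ENNReal.ofReal b * M + M)) := by gcongr
      _ = _ := ofReal_mul_add_eq (by positivity) (by positivity) hC.le M
  · intro ε hε hε1 t ht
    have hlim1 := tendsto_integral_comp (μ := wiener (ι ⊕ (Fin k × ι)))
      (φ := fun y => Real.exp (-(t ^ 2 / 2 * max y 0))) (by fun_prop) (c := 1)
      (fun y => by
        rw [abs_of_nonneg (Real.exp_nonneg _), Real.exp_le_one_iff, neg_nonpos]; positivity)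
      (fun n => (measurable_eval (gammaPoly (sharpPoly k (P n)))).aestronglyMeasurable)
      (Lp.aestronglyMeasurable f) ((tendsto_toLpPoly_iff 1 _ _).1 hY)
    have hlim2 := tendsto_integral_comp (μ := wiener (ι ⊕ (Fin (k + 1) × ι)))
      (φ := fun y => ((max y 0 + ε)⁻¹) ^ p)
      ((Continuous.inv₀ (by fun_prop) (fun y => by positivity)).pow p) (c := (ε⁻¹) ^ p)
      (fun y => by
        rw [abs_of_nonneg (by positivity)]
        gcongr
        linarith [le_max_right y 0])
      (fun n => (measurable_eval (gammaPoly (sharpPoly (k + 1) (P n)))).aestronglyMeasurable)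
      (Lp.aestronglyMeasurable g) ((tendsto_toLpPoly_iff 1 _ _).1 hX)
    refine le_of_tendsto_of_tendsto hlim1 ((hlim2.const_add 1).const_mul _) ?_
    filter_upwards [hev] with n hn
    exact h ι (P n) (hPm n) hn ε hε hε1 t ht

theorem negMoment_congr_of_measurePreserving {Ω Ω' : Type} [MeasurableSpace Ω]
    [MeasurableSpace Ω'] {μ : Measure Ω} {ν : Measure Ω'} {T : Ω → Ω'}
    (hT : MeasurePreserving T μ ν) {f : Ω → ℝ} {g : Ω' → ℝ} (hg : AEMeasurable g ν)
    (hfg : f =ᵐ[μ] g ∘ T) (p : ℝ) : negMoment μ f p = negMoment ν g p := by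
  rw [negMoment, negMoment, ← hT.map_eq, lintegral_map' _ hT.measurable.aemeasurable]
  · refine lintegral_congr_ae ?_
    filter_upwards [hfg] with x hx
    rw [hx, Function.comp_apply]
  · rw [hT.map_eq]
    exact hg.ennreal_ofReal.pow_const _

theorem eval_gammaPoly_sharpPoly_zero {ι : Type} (P : MvPolynomial ι ℝ)
    (x : ι ⊕ (Fin 0 × ι) → ℝ) : MvPolynomial.eval x (gammaPoly (sharpPoly 0 P)) =
      MvPolynomial.eval (fun i => x (Sum.inl i)) (gammaPoly P) := by
  have hs := MvPolynomial.mem_supported_vars P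
  rw [gammaPoly_eq_gam hs, sharpPoly_eq_sharpRec 0 hs,
    gammaPoly_eq_gam (sharpRec_mem_supported 0 hs), eval_gam_self, eval_gam_self, sharpVars,
    Finset.sum_disjSum]
  simp only [Finset.univ_eq_empty, Finset.empty_product, Finset.sum_empty, add_zero, sharpRec]
  refine Finset.sum_congr rfl fun i _ => ?_
  rw [MvPolynomial.pderiv_rename Sum.inl_injective, MvPolynomial.eval_rename]
  rfl

/-- ♯^0 adds no variables, but it lives on a differently indexed space. The two limits are compared
through one approximating sequence and the projection onto the N variables. -/
theorem negMoment_gamma_sharp_zero {ι : Type} {m : ℕ} {F : Lp ℝ 2 (wiener ι)}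
    (hF : F ∈ chaosLE ι m) (q : ℝ) :
    negMoment (wiener (ι ⊕ (Fin 0 × ι))) (gamma (sharp 0 F)) q =
      negMoment (wiener ι) (gamma F) q := by
  obtain ⟨P, -, hPF⟩ := exists_approximates hF
  have mp := measurePreserving_comp (Sum.inl_injective (α := ι) (β := Fin 0 × ι))
  refine negMoment_congr_of_measurePreserving mp (Lp.aestronglyMeasurable _).aemeasurable ?_ q
  have h1 := (tendsto_toLpPoly_iff 1 _ _).1 (tendsto_gamma (approximates_sharp 0 hPF))
  have h2 := (tendsto_toLpPoly_iff 1 _ _).1 (tendsto_gamma hPF)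
  have h3 : Tendsto (fun n => eLpNorm (fun x : ι ⊕ (Fin 0 × ι) → ℝ =>
      MvPolynomial.eval x (gammaPoly (sharpPoly 0 (P n))) - gamma F (fun i => x (Sum.inl i))) 1
        (wiener (ι ⊕ (Fin 0 × ι)))) atTop (𝓝 0) := by
    refine h2.congr fun n => ?_
    have := eLpNorm_comp_measurePreserving (p := 1)
      (g := fun x => MvPolynomial.eval x (gammaPoly (P n)) - gamma F x)
      ((measurable_eval _).aestronglyMeasurable.sub (Lp.aestronglyMeasurable _)) mp
    rw [← this]
    simp only [eval_gammaPoly_sharpPoly_zero]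
    rfl
  have h4 := h1.add h3
  rw [add_zero] at h4
  have hmeas : AEStronglyMeasurable (fun x : ι ⊕ (Fin 0 × ι) → ℝ =>
      gamma F (fun i => x (Sum.inl i))) (wiener (ι ⊕ (Fin 0 × ι))) :=
    (Lp.aestronglyMeasurable (gamma F)).comp_measurePreserving mp
  have h5 : eLpNorm (fun x => gamma (sharp 0 F) x - gamma F (fun i => x (Sum.inl i))) 1
      (wiener (ι ⊕ (Fin 0 × ι))) = 0 := by
    refine le_antisymm (ge_of_tendsto h4 (Eventually.of_forall fun n => ?_)) zero_le
    have := eLpNorm_sub_le (p := 1) (μ := wiener (ι ⊕ (Fin 0 × ι)))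
      (f := fun x => MvPolynomial.eval x (gammaPoly (sharpPoly 0 (P n))) -
        gamma F (fun i => x (Sum.inl i)))
      (g := fun x => MvPolynomial.eval x (gammaPoly (sharpPoly 0 (P n))) - gamma (sharp 0 F) x)
      ((measurable_eval _).aestronglyMeasurable.sub hmeas)
      ((measurable_eval _).aestronglyMeasurable.sub (Lp.aestronglyMeasurable _)) le_rfl
    rw [add_comm]
    refine le_trans (le_of_eq (congrArg (fun f => eLpNorm f 1 _) ?_)) this
    ext x
    simp
  have h6 := (eLpNorm_eq_zero_iff (p := 1) (μ := wiener (ι ⊕ (Fin 0 × ι)))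
    (f := fun x => gamma (sharp 0 F) x - gamma F (fun i => x (Sum.inl i)))
    ((Lp.aestronglyMeasurable _).sub hmeas) one_ne_zero).1 h5
  filter_upwards [h6] with x hx
  simpa [sub_eq_zero] using hx

/-- Negative moments of `Γ[F,F]` in terms of the iterated sharp operators. -/
theorem exists_negMoment_sharp_le (m q k : ℕ) : ∃ q' : ℕ, ∃ C : ℝ, 0 < C ∧
    ∀ (ι : Type), ∀ F ∈ chaosLE ι m, ∫ x, (F x) ^ 2 ∂(wiener ι) = 1 →
      negMoment (wiener ι) (gamma F) q ≤ ENNReal.ofReal C *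
        negMoment (wiener (ι ⊕ (Fin k × ι))) (gamma (sharp k F)) q' := by
  induction k with
  | zero =>
    refine ⟨q, 1, one_pos, fun ι F hF _ => ?_⟩
    rw [negMoment_gamma_sharp_zero hF]
    simp
  | succ k ih =>
    obtain ⟨q₁, C₁, hC₁, h₁⟩ := ih
    obtain ⟨q₂, C₂, hC₂, h₂⟩ := exists_negMoment_sharp_succ_le m q₁ k
    refine ⟨q₂, C₁ * C₂, by positivity, fun ι F hF hF1 => (h₁ ι F hF hF1).trans ?_⟩
    rw [ENNReal.ofReal_mul hC₁.le, mul_assoc]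
    gcongr
    exact h₂ ι F hF hF1

/-! ### Laplace transforms of quadratic forms and spectral remainders -/

/-- exp(-t|Wx|²) is the Gaussian average over z of cos(√(2t)⟨z,Wx⟩), an expression symmetric in x
and z. So W may be replaced by its transpose, which is diagonal after squaring when W is made of
scaled orthonormal rows; rotation invariance of the Gaussian law is not used. -/
theorem integral_exp_neg_quadratic {α ι : Type} (J : Finset α) (s : Finset ι) (w : α → ι → ℝ)
    {t : ℝ} (ht : 0 ≤ t) :
    ∫ x, Real.exp (-(t * ∑ j ∈ J, (∑ i ∈ s, w j i * x i) ^ 2)) ∂(wiener ι) =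
    ∫ z, Real.exp (-(t * ∑ i ∈ s, (∑ j ∈ J, w j i * z j) ^ 2)) ∂(wiener α) := by
  have h1 : ∀ x : ι → ℝ, Real.exp (-(t * ∑ j ∈ J, (∑ i ∈ s, w j i * x i) ^ 2)) =
      ∫ z, Real.cos (∑ j ∈ J, √(2 * t) * (∑ i ∈ s, w j i * x i) * z j + 0) ∂(wiener α) := by
    intro x
    rw [integral_cos_sum, Real.cos_zero, one_mul]
    congr 1
    simp only [mul_pow, Real.sq_sqrt (show 0 ≤ 2 * t by linarith), ← Finset.mul_sum]
    ring
  have h2 : ∀ z : α → ℝ, Real.exp (-(t * ∑ i ∈ s, (∑ j ∈ J, w j i * z j) ^ 2)) =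
      ∫ x, Real.cos (∑ i ∈ s, √(2 * t) * (∑ j ∈ J, w j i * z j) * x i + 0) ∂(wiener ι) := by
    intro z
    rw [integral_cos_sum, Real.cos_zero, one_mul]
    congr 1
    simp only [mul_pow, Real.sq_sqrt (show 0 ≤ 2 * t by linarith), ← Finset.mul_sum]
    ring
  simp_rw [h1, h2]
  rw [integral_integral_swap]
  · refine integral_congr_ae (ae_of_all _ fun z => integral_congr_ae (ae_of_all _ fun x => ?_))
    simp only [add_zero]
    congr 1
    simp only [Finset.mul_sum, Finset.sum_mul]
    rw [Finset.sum_comm]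
    exact Finset.sum_congr rfl fun i _ => Finset.sum_congr rfl fun j _ => by ring
  · refine Integrable.of_bound (C := 1) (Measurable.aestronglyMeasurable ?_)
      (ae_of_all _ fun p => Real.abs_cos_le_one _)
    unfold Function.uncurry
    fun_prop

/-- Expand the product over subsets of `J`. Each p-element subset is the range of at most p^p
embeddings of `Fin p`. -/
theorem sum_prod_embedding_le {κ : Type} (p : ℕ) (T : Finset (Fin p ↪ κ)) (J : Finset κ)
    (hT : ∀ e ∈ T, ∀ j, e j ∈ J) {x : κ → ℝ} (hx : ∀ a, 0 ≤ x a) :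
    ∑ e ∈ T, ∏ j, x (e j) ≤ (p : ℝ) ^ p * ∏ a ∈ J, (1 + x a) := by
  classical
  rw [Finset.prod_one_add, Finset.mul_sum, ← Finset.sum_fiberwise_of_maps_to
    (s := T) (t := J.powerset) (g := fun e => Finset.univ.map e) (fun e he => by
      rw [Finset.mem_powerset]
      intro a ha
      obtain ⟨j, -, rfl⟩ := Finset.mem_map.1 ha
      exact hT e he j)]
  refine Finset.sum_le_sum fun S _ => ?_
  have h1 : ∑ e ∈ T with Finset.univ.map e = S, ∏ j, x (e j) =
      ∑ e ∈ T with Finset.univ.map e = S, ∏ a ∈ S, x a := by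
    refine Finset.sum_congr rfl fun e he => ?_
    rw [← (Finset.mem_filter.1 he).2, Finset.prod_map]
  rw [h1, Finset.sum_const, nsmul_eq_mul]
  refine mul_le_mul_of_nonneg_right ?_ (Finset.prod_nonneg fun a _ => hx a)
  rcases (T.filter fun e => Finset.univ.map e = S).eq_empty_or_nonempty with h | ⟨e₀, he₀⟩
  · rw [h]; simp
  · have hS : S.card = p := by
      rw [← (Finset.mem_filter.1 he₀).2, Finset.card_map, Finset.card_univ, Fintype.card_fin]
    have hc := Finset.card_le_card_of_injOn (s := T.filter fun e => Finset.univ.map e = S)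
      (t := Fintype.piFinset fun _ : Fin p => S) (fun e => ⇑e) (fun e he => by
        simp only [Finset.coe_filter, Set.mem_ofPred_eq] at he
        simp only [Finset.mem_coe, Fintype.mem_piFinset, ← he.2]
        exact fun j => Finset.mem_map_of_mem e (Finset.mem_univ j))
      (DFunLike.coe_injective.injOn)
    rw [Fintype.card_piFinset_const, hS] at hc
    exact_mod_cast hc

theorem exists_finset_range {κ : Type} {p : ℕ} (T : Finset (Fin p ↪ κ)) :
    ∃ J : Finset κ, ∀ e ∈ T, ∀ j, e j ∈ J := by
  classical
  exact ⟨T.biUnion fun e => Finset.univ.map e, fun e he j => Finset.mem_biUnion.2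
    ⟨e, he, Finset.mem_map_of_mem e (Finset.mem_univ j)⟩⟩

theorem sum_embedding_ofReal {κ : Type} {p : ℕ} (T : Finset (Fin p ↪ κ)) (lam : κ → ℝ) :
    ∑ e ∈ T, ∏ j, ENNReal.ofReal (lam (e j) ^ 2) =
      ENNReal.ofReal (∑ e ∈ T, ∏ j, lam (e j) ^ 2) := by
  rw [ENNReal.ofReal_sum_of_nonneg fun e _ => Finset.prod_nonneg fun j _ => sq_nonneg _]
  refine Finset.sum_congr rfl fun e _ => ?_
  rw [ENNReal.ofReal_prod_of_nonneg fun j _ => sq_nonneg _]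

/-- Dropping the condition that the indices be distinct turns the sum into the p-th power of Σ λ².
-/
theorem spectralRemainder_le {κ : Type} (p : ℕ) {lam : κ → ℝ} {b : ℝ}
    (hb : ∀ J : Finset κ, ∑ a ∈ J, lam a ^ 2 ≤ b) :
    spectralRemainder p lam ≤ ENNReal.ofReal b ^ p := by
  classical
  rw [spectralRemainder, ENNReal.tsum_eq_iSup_sum]
  refine iSup_le fun T => ?_
  obtain ⟨J, hJ⟩ := exists_finset_range T
  rw [sum_embedding_ofReal, ← ENNReal.ofReal_pow (by simpa using hb ∅)]
  refine ENNReal.ofReal_le_ofReal ?_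
  calc ∑ e ∈ T, ∏ j, lam (e j) ^ 2 =
      ∑ f ∈ T.map ⟨fun e : Fin p ↪ κ => (⇑e : Fin p → κ), DFunLike.coe_injective⟩,
        ∏ j, lam (f j) ^ 2 := by rw [Finset.sum_map]; rfl
    _ ≤ ∑ f ∈ Fintype.piFinset fun _ : Fin p => J, ∏ j, lam (f j) ^ 2 := by
        refine Finset.sum_le_sum_of_subset_of_nonneg ?_
          fun f _ _ => Finset.prod_nonneg fun j _ => sq_nonneg _
        intro f hf
        obtain ⟨e, he, rfl⟩ := Finset.mem_map.1 hf
        exact Fintype.mem_piFinset.2 (hJ e he)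
    _ = (∑ a ∈ J, lam a ^ 2) ^ p := by
        rw [← Finset.prod_univ_sum (fun _ : Fin p => J) (fun _ a => lam a ^ 2)]
        simp
    _ ≤ b ^ p := by
        have := hb J
        gcongr

theorem le_mul_rpow_neg_half {a b R : ℝ≥0∞} (hb0 : b ≠ 0) (hb : b ≠ ∞)
    (h : a ^ 2 * R ≤ b ^ 2) : a ≤ b * R ^ (-(1 / 2) : ℝ) := by
  by_cases hR0 : R = 0
  · rw [hR0, ENNReal.zero_rpow_of_neg (by norm_num), ENNReal.mul_top hb0]
    exact le_top
  by_cases hR : R = ∞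
  · have ha : a = 0 := by
      by_contra ha
      rw [hR, ENNReal.mul_top (pow_ne_zero 2 ha)] at h
      exact ENNReal.pow_ne_top hb (top_unique h)
    rw [ha]; exact zero_le
  have h1 : a * R ^ (1 / 2 : ℝ) ≤ b := by
    rw [← ENNReal.rpow_le_rpow_iff (z := 2) (by norm_num),
      ENNReal.mul_rpow_of_nonneg _ _ (by norm_num), ← ENNReal.rpow_mul]
    norm_num
    simpa using h
  rw [ENNReal.rpow_neg]
  rw [← div_eq_mul_inv]
  refine (ENNReal.le_div_iff_mul_le (Or.inl ?_) (Or.inl ?_)).2 h1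
  · rw [Ne, ENNReal.rpow_eq_zero_iff]; simp [hR0, hR]
  · exact ENNReal.rpow_ne_top_of_nonneg (by norm_num) hR

/-- The product over `J` dominates p^{-p} (2t)^p times any finite partial sum of R_p with indices in
`J`. Hence E² (2t)^p R_p ≤ p^p, and 2t ≥ 4^n turns the square root of this into decay (2^n)^{-p}. -/
theorem ofReal_le_spectralRemainder {κ : Type} {p n : ℕ} {lam : κ → ℝ} {E t : ℝ}
    (hE0 : 0 ≤ E) (ht : 4 ^ n ≤ 2 * t)
    (hE : ∀ J : Finset κ, E ≤ (√(∏ a ∈ J, (1 + 2 * (t * lam a ^ 2))))⁻¹) :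
    ENNReal.ofReal E ≤ ENNReal.ofReal √((p : ℝ) ^ p) *
      spectralRemainder p lam ^ (-(1 / 2) : ℝ) * ENNReal.ofReal (((2 ^ n) ^ p)⁻¹) := by
  have ht0 : 0 ≤ t := by have : (0 : ℝ) < 4 ^ n := by positivity
                         linarith
  have hpp : 0 < (p : ℝ) ^ p := by
    rcases Nat.eq_zero_or_pos p with rfl | hp
    · simp
    · positivity
  have key : (ENNReal.ofReal E * ENNReal.ofReal ((2 ^ n) ^ p)) ^ 2 * spectralRemainder p lam ≤
      (ENNReal.ofReal √((p : ℝ) ^ p)) ^ 2 := by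
    rw [← ENNReal.ofReal_pow (Real.sqrt_nonneg _), Real.sq_sqrt hpp.le,
      ← ENNReal.ofReal_mul hE0, ← ENNReal.ofReal_pow (by positivity), spectralRemainder,
      ENNReal.tsum_eq_iSup_sum, ENNReal.mul_iSup]
    refine iSup_le fun T => ?_
    obtain ⟨J, hJ⟩ := exists_finset_range T
    rw [sum_embedding_ofReal, ← ENNReal.ofReal_mul (by positivity)]
    refine ENNReal.ofReal_le_ofReal ?_
    have hx : ∀ a, 0 ≤ 2 * (t * lam a ^ 2) := fun a => by positivity
    have h1 := sum_prod_embedding_le p T J hJ hx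
    have hprod : 0 < ∏ a ∈ J, (1 + 2 * (t * lam a ^ 2)) :=
      Finset.prod_pos fun a _ => by linarith [hx a]
    have h2 : E ^ 2 * ∏ a ∈ J, (1 + 2 * (t * lam a ^ 2)) ≤ 1 := by
      have := pow_le_pow_left₀ hE0 (hE J) 2
      rw [inv_pow, Real.sq_sqrt hprod.le] at this
      calc _ ≤ (∏ a ∈ J, (1 + 2 * (t * lam a ^ 2)))⁻¹ * ∏ a ∈ J, (1 + 2 * (t * lam a ^ 2)) := by
            gcongr
        _ = 1 := inv_mul_cancel₀ hprod.ne'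
    have h3 : ∑ e ∈ T, ∏ j, 2 * (t * lam (e j) ^ 2) =
        (2 * t) ^ p * ∑ e ∈ T, ∏ j, lam (e j) ^ 2 := by
      rw [Finset.mul_sum]
      refine Finset.sum_congr rfl fun e _ => ?_
      simp_rw [← mul_assoc]
      rw [Finset.prod_mul_distrib]
      simp
    rw [h3] at h1
    have hS : 0 ≤ ∑ e ∈ T, ∏ j, lam (e j) ^ 2 :=
      Finset.sum_nonneg fun e _ => Finset.prod_nonneg fun j _ => sq_nonneg _
    have h4 : (((2 : ℝ) ^ n) ^ p) ^ 2 ≤ (2 * t) ^ p := by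
      rw [← pow_mul, mul_comm p 2, pow_mul, ← pow_mul 2 n 2, mul_comm n 2, pow_mul]
      norm_num
      exact pow_le_pow_left₀ (by positivity) ht p
    calc (E * (2 ^ n) ^ p) ^ 2 * ∑ e ∈ T, ∏ j, lam (e j) ^ 2
        = E ^ 2 * ((((2 : ℝ) ^ n) ^ p) ^ 2 * ∑ e ∈ T, ∏ j, lam (e j) ^ 2) := by ring
      _ ≤ E ^ 2 * ((2 * t) ^ p * ∑ e ∈ T, ∏ j, lam (e j) ^ 2) := by gcongr
      _ ≤ E ^ 2 * ((p : ℝ) ^ p * ∏ a ∈ J, (1 + 2 * (t * lam a ^ 2))) := by gcongr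
      _ = (p : ℝ) ^ p * (E ^ 2 * ∏ a ∈ J, (1 + 2 * (t * lam a ^ 2))) := by ring
      _ ≤ (p : ℝ) ^ p * 1 := by gcongr
      _ = _ := mul_one _
  have h := le_mul_rpow_neg_half (by simpa using Real.sqrt_pos.2 hpp) ENNReal.ofReal_ne_top key
  have h2 : (0 : ℝ) < (2 ^ n) ^ p := by positivity
  calc ENNReal.ofReal E = ENNReal.ofReal E * ENNReal.ofReal ((2 ^ n) ^ p) *
        ENNReal.ofReal (((2 ^ n) ^ p)⁻¹) := by
        rw [mul_assoc, ← ENNReal.ofReal_mul h2.le, mul_inv_cancel₀ h2.ne', ENNReal.ofReal_one,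
          mul_one]
    _ ≤ _ := by gcongr

/-! ### Negative moments in terms of the Hessian -/

theorem exists_spectral_form {K : ℕ} {A : Matrix (Fin K) (Fin K) ℝ} (hA : A.IsHermitian) :
    ∃ v : Fin K → Fin K → ℝ, (∀ j l, ∑ i, v j i * v l i = if j = l then 1 else 0) ∧
      ∀ x : Fin K → ℝ, ∑ i, (∑ k, A i k * x k) ^ 2 =
        ∑ j, (∑ i, hA.eigenvalues j * v j i * x i) ^ 2 := by
  set b := hA.eigenvectorBasis
  refine ⟨fun j i => b j i, fun j l => ?_, fun x => ?_⟩
  · have := orthonormal_iff_ite.1 b.orthonormal l j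
    rw [EuclideanSpace.inner_eq_star_dotProduct] at this
    simp only [dotProduct, Pi.star_apply, star_trivial] at this
    rw [this]
    simp [eq_comm]
  · have h1 := b.sum_sq_norm_inner_right (WithLp.toLp 2 (A.mulVec x))
    rw [EuclideanSpace.real_norm_sq_eq] at h1
    simp only [Matrix.mulVec, dotProduct] at h1
    rw [← h1]
    refine Finset.sum_congr rfl fun j _ => ?_
    rw [EuclideanSpace.inner_eq_star_dotProduct, Real.norm_eq_abs, sq_abs]
    congr 1
    have h2 := hA.mulVec_eigenvectorBasis j
    have h3 : ∀ i, ∑ k, A k i * b j k = hA.eigenvalues j * b j i := by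
      intro i
      have := congrFun h2 i
      simp only [Matrix.mulVec, dotProduct, Pi.smul_apply, smul_eq_mul] at this
      rw [← this]
      refine Finset.sum_congr rfl fun k _ => ?_
      have := hA.apply i k
      simp only [star_trivial] at this
      rw [this]
    simp only [Matrix.mulVec, dotProduct, Pi.star_apply, star_trivial, Finset.sum_mul]
    rw [Finset.sum_comm]
    refine Finset.sum_congr rfl fun k _ => ?_
    rw [← h3, Finset.sum_mul]
    exact Finset.sum_congr rfl fun i _ => by ring

/-- The Hilbert-Schmidt norm, obtained by evaluating the spectral form at the standard basis
vectors. -/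
theorem sum_eigenvalues_sq {K : ℕ} {A : Matrix (Fin K) (Fin K) ℝ} (hA : A.IsHermitian) :
    ∑ j, hA.eigenvalues j ^ 2 = ∑ i, ∑ k, A i k ^ 2 := by
  obtain ⟨v, hv, h⟩ := exists_spectral_form hA
  have h1 : ∀ k, ∑ i, A i k ^ 2 = ∑ j, hA.eigenvalues j ^ 2 * (v j k * v j k) := by
    intro k
    have := h (Pi.single k 1)
    simp only [Pi.single_apply, mul_ite, mul_one, mul_zero, Finset.sum_ite_eq',
      Finset.mem_univ, if_true] at this
    rw [this]
    exact Finset.sum_congr rfl fun j _ => by ring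
  rw [Finset.sum_comm]
  simp_rw [h1]
  rw [Finset.sum_comm]
  simp [← Finset.mul_sum, hv]

theorem sum_sq_sum_orthonormal {α ι : Type} [DecidableEq α] (J : Finset α) (s : Finset ι)
    {v : α → ι → ℝ} (hv : ∀ j l, ∑ i ∈ s, v j i * v l i = if j = l then 1 else 0) (c z : α → ℝ) :
    ∑ i ∈ s, (∑ j ∈ J, c j * v j i * z j) ^ 2 = ∑ j ∈ J, c j ^ 2 * z j ^ 2 := by
  have : ∀ i, (∑ j ∈ J, c j * v j i * z j) ^ 2 =
      ∑ j ∈ J, ∑ l ∈ J, (c j * z j * (c l * z l)) * (v j i * v l i) := by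
    intro i
    rw [sq, Finset.sum_mul_sum]
    exact Finset.sum_congr rfl fun j _ => Finset.sum_congr rfl fun l _ => by ring
  simp_rw [this]
  rw [Finset.sum_comm]
  refine Finset.sum_congr rfl fun j hj => ?_
  rw [Finset.sum_comm]
  simp_rw [← Finset.mul_sum, hv]
  simp only [mul_ite, mul_one, mul_zero, Finset.sum_ite_eq, hj, if_true]
  ring

/-- After transposition the form is Σ λ_j² z_j² with independent z_j, so its Laplace transform is an
explicit product; restricting that product to `J` only decreases it. -/
theorem negMoment_quadratic_le {K : ℕ} {A : Matrix (Fin K) (Fin K) ℝ} (hA : A.IsHermitian)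
    (q : ℕ) : negMoment (wiener (Fin K)) (fun x => ∑ i, (∑ k, A i k * x k) ^ 2) q ≤
      1 + ENNReal.ofReal (4 ^ q * Real.exp 1 * 2) *
        (ENNReal.ofReal √(((2 * q + 1 : ℕ) : ℝ) ^ (2 * q + 1)) *
          spectralRemainder (2 * q + 1) hA.eigenvalues ^ (-(1 / 2) : ℝ)) := by
  classical
  obtain ⟨v, hv, h⟩ := exists_spectral_form hA
  refine negMoment_le_of_laplace (Measurable.aemeasurable (by fun_prop)) q fun n => ?_
  have hnn : ∀ x : Fin K → ℝ, 0 ≤ ∑ j, (∑ i, hA.eigenvalues j * v j i * x i) ^ 2 := fun x =>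
    Finset.sum_nonneg fun _ _ => sq_nonneg _
  simp only [h, max_eq_left (hnn _)]
  rw [← ofReal_integral_eq_lintegral_ofReal _ (ae_of_all _ fun x => Real.exp_nonneg _)]
  · refine ofReal_le_spectralRemainder (t := 4 ^ n) (integral_nonneg fun x => Real.exp_nonneg _)
      (by linarith [show (0 : ℝ) < 4 ^ n by positivity]) fun J => ?_
    rw [integral_exp_neg_quadratic _ _ _ (by positivity)]
    simp only [sum_sq_sum_orthonormal _ _ hv, Finset.mul_sum, ← mul_assoc]
    rw [integral_exp_neg_sum_sq _ (fun a => by positivity)]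
    refine inv_anti₀ (Real.sqrt_pos.2 (Finset.prod_pos fun a _ => by positivity))
      (Real.sqrt_le_sqrt ?_)
    simp only [← mul_assoc]
    exact Finset.prod_le_prod_of_subset_of_one_le (Finset.subset_univ J)
      (fun a _ => by positivity) (fun a _ _ => le_add_of_nonneg_right (by positivity))
  · refine Integrable.of_bound (C := 1) (Measurable.aestronglyMeasurable (by fun_prop))
      (ae_of_all _ fun x => ?_)
    rw [Real.norm_of_nonneg (Real.exp_nonneg _), Real.exp_le_one_iff, neg_nonpos]
    exact mul_nonneg (by positivity) (hnn x)

theorem mem_supported_univ {K : ℕ} (P : MvPolynomial (Fin K) ℝ) :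
    P ∈ MvPolynomial.supported ℝ ((Finset.univ : Finset (Fin K)) : Set (Fin K)) := by
  rw [MvPolynomial.mem_supported]; simp

/-- The N_i-derivative of ♯[P] is the i-th entry of the Hessian applied to G; the G-derivatives are
dropped. -/
theorem sum_hessian_le_gammaPoly {K : ℕ} (P : MvPolynomial (Fin K) ℝ)
    (x : Fin K ⊕ (Fin 1 × Fin K) → ℝ) :
    ∑ i, (∑ k, hessian P (fun a => x (Sum.inl a)) i k * x (Sum.inr (0, k))) ^ 2 ≤
      MvPolynomial.eval x (gammaPoly (sharpPoly 1 P)) := by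
  have hs := mem_supported_univ P
  rw [sharpPoly_eq_sharpRec 1 hs, gammaPoly_eq_gam (sharpRec_mem_supported 1 hs)]
  refine le_trans (le_of_eq ?_) (eval_sum_inl_le Finset.univ 1 _ x)
  refine Finset.sum_congr rfl fun i _ => ?_
  congr 1
  rw [sharpRec, linExt, map_sum, map_sum]
  refine Finset.sum_congr rfl fun k _ => ?_
  have h1 : MvPolynomial.rename (sharpEmb (Fin K) 0)
      (MvPolynomial.pderiv (Sum.inl k) (sharpRec Finset.univ 0 P)) =
      MvPolynomial.rename Sum.inl (MvPolynomial.pderiv k P) := by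
    rw [sharpRec, MvPolynomial.pderiv_rename Sum.inl_injective, MvPolynomial.rename_rename]
    rfl
  rw [h1, MvPolynomial.pderiv_mul, MvPolynomial.pderiv_rename Sum.inl_injective,
    MvPolynomial.pderiv_X_of_ne (by simp [sharpNew]), mul_zero, add_zero, map_mul,
    MvPolynomial.eval_X, MvPolynomial.eval_rename]
  rfl

theorem measurable_hessian {K : ℕ} (P : MvPolynomial (Fin K) ℝ) (i k : Fin K) :
    Measurable fun x => hessian P x i k := measurable_eval _

/-- Given N, the lower bound by |∇²P · G|² is a quadratic form with deterministic matrix, so the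
bound for such forms applies inside the integral over N. -/
theorem negMoment_gammaPoly_sharp_le {K : ℕ} (P : MvPolynomial (Fin K) ℝ) (q : ℕ) :
    negMoment (wiener (Fin K ⊕ (Fin 1 × Fin K)))
      (fun x => MvPolynomial.eval x (gammaPoly (sharpPoly 1 P))) q ≤
    1 + ENNReal.ofReal (4 ^ q * Real.exp 1 * 2) *
      (ENNReal.ofReal √(((2 * q + 1 : ℕ) : ℝ) ^ (2 * q + 1)) *
        ∫⁻ x, hessianRemainder (2 * q + 1) P x ^ (-(1 / 2) : ℝ) ∂(wiener (Fin K))) := by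
  set Φ : (Fin K → ℝ) × (Fin K → ℝ) → ℝ≥0∞ := fun p =>
    ENNReal.ofReal (∑ i, (∑ k, hessian P p.1 i k * p.2 k) ^ 2) ^ (-(q : ℝ)) with hΦ
  have hm : Measurable Φ := by
    refine (Measurable.ennreal_ofReal ?_).pow_const _
    refine Finset.measurable_fun_sum _ fun i _ => Measurable.pow_const ?_ 2
    refine Finset.measurable_fun_sum _ fun k _ => ?_
    exact ((measurable_hessian P i k).comp measurable_fst).mul
      ((measurable_pi_apply k).comp measurable_snd)
  have mp := measurePreserving_prod (f := Sum.inl) (g := fun a => Sum.inr ((0 : Fin 1), a))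
    (ι := Fin K ⊕ (Fin 1 × Fin K)) (by rintro (a | a) (b | b) h <;> simp_all)
  calc _ ≤ ∫⁻ x, Φ (fun a => x (Sum.inl a), fun a => x (Sum.inr (0, a)))
        ∂(wiener (Fin K ⊕ (Fin 1 × Fin K))) := by
        refine lintegral_mono fun x => ?_
        simp only [hΦ]
        rw [ENNReal.rpow_neg, ENNReal.rpow_neg, ENNReal.inv_le_inv]
        exact ENNReal.rpow_le_rpow (ENNReal.ofReal_le_ofReal (sum_hessian_le_gammaPoly P x))
          (Nat.cast_nonneg q)
    _ = ∫⁻ N, negMoment (wiener (Fin K)) (fun G => ∑ i, (∑ k, hessian P N i k * G k) ^ 2) q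
        ∂(wiener (Fin K)) := by
        rw [mp.lintegral_comp hm, lintegral_prod _ hm.aemeasurable]
        rfl
    _ ≤ ∫⁻ N, (1 + ENNReal.ofReal (4 ^ q * Real.exp 1 * 2) *
        (ENNReal.ofReal √(((2 * q + 1 : ℕ) : ℝ) ^ (2 * q + 1)) *
          hessianRemainder (2 * q + 1) P N ^ (-(1 / 2) : ℝ))) ∂(wiener (Fin K)) :=
        lintegral_mono fun N => negMoment_quadratic_le (hessian_isHermitian P N) q
    _ = _ := by
        rw [lintegral_add_left measurable_const, lintegral_const_mul' _ _ ENNReal.ofReal_ne_top,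
          lintegral_const_mul' _ _ ENNReal.ofReal_ne_top]
        simp

theorem expect_sum_hessian_le {K m : ℕ} {P : MvPolynomial (Fin K) ℝ} (hm : P.totalDegree ≤ m) :
    expect (∑ i, ∑ k, (MvPolynomial.pderiv i (MvPolynomial.pderiv k P)) ^ 2) ≤
      m * (m * expect (P ^ 2)) := by
  have h1 : ∑ i, ∑ k, (MvPolynomial.pderiv i (MvPolynomial.pderiv k P)) ^ 2 =
      ∑ k, gam Finset.univ (MvPolynomial.pderiv k P) (MvPolynomial.pderiv k P) := by
    rw [Finset.sum_comm]
    simp [gam, sq]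
  rw [h1, map_sum]
  calc _ ≤ ∑ k, (m : ℝ) * expect (MvPolynomial.pderiv k P ^ 2) :=
        Finset.sum_le_sum fun k _ => expect_gam_le (mem_supported_univ _)
          ((totalDegree_pderiv_le k P).trans (by omega))
    _ = m * expect (gam Finset.univ P P) := by
        rw [← Finset.mul_sum, gam, map_sum]
        simp [sq]
    _ ≤ _ := mul_le_mul_of_nonneg_left (expect_gam_le (mem_supported_univ _) hm)
        (Nat.cast_nonneg m)

/-- R_p is at most the p-th power of the squared Hilbert-Schmidt norm Q of the Hessian, so
R_p^{-1/2} ≥ Q^{-p/2}. The mean of Q is at most m², which bounds this negative moment below. -/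
theorem one_le_mul_lintegral_hessianRemainder {K m : ℕ} {P : MvPolynomial (Fin K) ℝ}
    (hm : P.totalDegree ≤ m) (hP : expect (P ^ 2) ≤ 1) (p : ℕ) :
    1 ≤ ENNReal.ofReal (2 * (2 * ((m : ℝ) ^ 2 + 1)) ^ ((p : ℝ) / 2)) *
      ∫⁻ x, hessianRemainder p P x ^ (-(1 / 2) : ℝ) ∂(wiener (Fin K)) := by
  set Q : MvPolynomial (Fin K) ℝ :=
    ∑ i, ∑ k, (MvPolynomial.pderiv i (MvPolynomial.pderiv k P)) ^ 2 with hQ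
  have hQe : ∀ x, MvPolynomial.eval x Q = ∑ i, ∑ k, hessian P x i k ^ 2 := fun x => by
    simp [hQ, hessian]
  have hQ0 : ∀ x, 0 ≤ MvPolynomial.eval x Q := fun x => by
    rw [hQe]; positivity
  have h1 : ∫⁻ x, ENNReal.ofReal (MvPolynomial.eval x Q) ∂(wiener (Fin K)) ≤
      ENNReal.ofReal ((m : ℝ) ^ 2 + 1) := by
    rw [← ofReal_integral_eq_lintegral_ofReal (integrable_eval Q) (ae_of_all _ hQ0),
      ← expect_apply]
    refine ENNReal.ofReal_le_ofReal ((expect_sum_hessian_le hm).trans ?_)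
    have : (m : ℝ) * (m * expect (P ^ 2)) ≤ m * (m * 1) := by gcongr
    nlinarith
  refine (one_le_mul_lintegral_rpow_neg (measurable_eval Q).ennreal_ofReal.aemeasurable
    (by positivity) (show 0 ≤ (p : ℝ) / 2 by positivity) h1).trans ?_
  gcongr with x
  have h2 : hessianRemainder p P x ≤ ENNReal.ofReal (MvPolynomial.eval x Q) ^ p := by
    refine spectralRemainder_le p fun J => ?_
    rw [hQe, ← sum_eigenvalues_sq (hessian_isHermitian P x)]
    exact Finset.sum_le_sum_of_subset_of_nonneg (Finset.subset_univ J) fun _ _ _ => sq_nonneg _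
  rw [ENNReal.rpow_neg, ENNReal.rpow_neg, ENNReal.inv_le_inv]
  refine (ENNReal.rpow_le_rpow h2 (by norm_num)).trans (le_of_eq ?_)
  rw [← ENNReal.rpow_natCast, ← ENNReal.rpow_mul]
  congr 1
  ring

/-- One ♯ step passes from order q to p = 4(2q + 1), and the Gaussian quadratic form at order p
needs the spectral remainder of order 2p + 1. All additive constants are absorbed into the same
integral. -/
theorem exists_negMoment_gammaPoly_le (m q : ℕ) : ∃ q' : ℕ, ∃ C : ℝ, 0 < C ∧
    ∀ (K : ℕ) (P : MvPolynomial (Fin K) ℝ), P.totalDegree ≤ m → expect (P ^ 2) ≤ 1 →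
      negMoment (wiener (Fin K)) (fun x => MvPolynomial.eval x (gammaPoly P)) q ≤
        ENNReal.ofReal C *
          ∫⁻ x, hessianRemainder q' P x ^ (-(1 / 2) : ℝ) ∂(wiener (Fin K)) := by
  obtain ⟨C, hC, h⟩ := exists_laplace_le m 0 (2 * q + 1) 1
  set p : ℕ := 4 * (2 * q + 1) with hp
  set b : ℝ := 2 * (2 * ((m : ℝ) ^ 2 + 1)) ^ (((2 * p + 1 : ℕ) : ℝ) / 2) with hb
  set c : ℝ := 4 ^ q * Real.exp 1 * 2 with hc
  set c' : ℝ := 4 ^ p * Real.exp 1 * 2 with hc'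
  set a : ℝ := √(((2 * p + 1 : ℕ) : ℝ) ^ (2 * p + 1)) with ha
  have hb0 : 0 < b := by positivity
  refine ⟨2 * p + 1, b + c * (C * (b + (b + c' * a))), by positivity, fun K P hm hP => ?_⟩
  have hone := one_le_mul_lintegral_hessianRemainder hm hP (2 * p + 1)
  have h1 := negMoment_gammaPoly_sharp_le P p
  have h2 := negMoment_le_of_regularized
    (μ := wiener (Fin K ⊕ (Fin 0 × Fin K))) (ν := wiener (Fin K ⊕ (Fin (0 + 1) × Fin K)))
    (f := fun x => MvPolynomial.eval x (gammaPoly (sharpPoly 0 P)))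
    (g := fun x => MvPolynomial.eval x (gammaPoly (sharpPoly (0 + 1) P)))
    (measurable_eval _).aemeasurable (measurable_eval _).aemeasurable q hC
    (fun ε hε hε1 t ht => h _ P hm hP ε hε hε1 t ht)
  have h3 := negMoment_congr_of_measurePreserving
    (measurePreserving_comp (Sum.inl_injective (α := Fin K) (β := Fin 0 × Fin K)))
    (f := fun x => MvPolynomial.eval x (gammaPoly (sharpPoly 0 P)))
    (g := fun x => MvPolynomial.eval x (gammaPoly P)) (measurable_eval _).aemeasurable
    (ae_of_all _ fun x => eval_gammaPoly_sharpPoly_zero P x) q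
  rw [← h3]
  refine h2.trans ?_
  rw [← hp, ← hc]
  rw [← hc', ← ha] at h1
  rw [← hb] at hone
  set M := ∫⁻ x, hessianRemainder (2 * p + 1) P x ^ (-(1 / 2) : ℝ) ∂(wiener (Fin K))
  calc _ ≤ ENNReal.ofReal b * M + ENNReal.ofReal c * (ENNReal.ofReal C *
        (ENNReal.ofReal b * M + (ENNReal.ofReal b * M + ENNReal.ofReal c' *
          (ENNReal.ofReal a * M)))) := by
        gcongr
        exact h1.trans (by gcongr)
    _ = _ := by
        have hc0 : 0 ≤ c := by positivity
        have hc0' : 0 ≤ c' := by positivity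
        have ha0 : 0 ≤ a := by positivity
        clear_value a b c c' M
        rw [ENNReal.ofReal_add hb0.le (by positivity), ENNReal.ofReal_mul hc0,
          ENNReal.ofReal_mul hC.le, ENNReal.ofReal_add hb0.le (by positivity),
          ENNReal.ofReal_add hb0.le (by positivity), ENNReal.ofReal_mul hc0']
        ring

/-- Negative moments of `Γ[F,F]` in terms of the spectral remainders of the Hessian. -/
theorem exists_negMoment_le_hessianRemainder (m q : ℕ) : ∃ q' : ℕ, ∃ C : ℝ, 0 < C ∧
    ∀ (K : ℕ) (F : MvPolynomial (Fin K) ℝ), F.totalDegree ≤ m →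
      ProbabilityTheory.variance (fun x => MvPolynomial.eval x F) (wiener (Fin K)) = 1 →
      negMoment (wiener (Fin K)) (fun x => MvPolynomial.eval x (gammaPoly F)) q ≤
        ENNReal.ofReal C *
          ∫⁻ x, hessianRemainder q' F x ^ (-(1 / 2) : ℝ) ∂(wiener (Fin K)) := by
  obtain ⟨q', C, hC, h⟩ := exists_negMoment_gammaPoly_le m q
  refine ⟨q', C, hC, fun K F hF hvar => ?_⟩
  -- The variance controls only the centred polynomial, but Γ and the Hessian do not see constants.
  have h1 := h K (F - MvPolynomial.C (expect F))
    ((MvPolynomial.totalDegree_sub _ _).trans (by simpa using hF)) ?_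
  · have hg : gammaPoly (F - MvPolynomial.C (expect F)) = gammaPoly F := by
      rw [gammaPoly_eq_gam (mem_supported_univ _), gammaPoly_eq_gam (mem_supported_univ _)]
      simp [gam]
    have hh : ∀ x, hessianRemainder q' (F - MvPolynomial.C (expect F)) x =
        hessianRemainder q' F x := by
      intro x
      have e : hessian (F - MvPolynomial.C (expect F)) x = hessian F x := by
        ext i k; simp [hessian]
      have : ∀ (A B : Matrix (Fin K) (Fin K) ℝ) (hA : A.IsHermitian) (hB : B.IsHermitian),
          A = B → spectralRemainder q' hA.eigenvalues = spectralRemainder q' hB.eigenvalues := by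
        rintro A B hA hB rfl; rfl
      exact this _ _ _ _ e
    simpa only [hg, hh] using h1
  · rw [variance_eq_integral (measurable_eval F).aemeasurable] at hvar
    rw [expect_apply, ← hvar]
    refine le_of_eq (integral_congr_ae (ae_of_all _ fun x => ?_))
    simp [expect_apply]

/-! ### The second Wiener chaos -/

/-- The polynomial `X_i X_j - δ_{ij}`, whose value is `quadVar i j`. -/
noncomputable def quadPoly (i j : ℕ) : MvPolynomial ℕ ℝ :=
  MvPolynomial.X i * MvPolynomial.X j - MvPolynomial.C (if i = j then 1 else 0)

theorem eval_quadPoly (i j : ℕ) (x : ℕ → ℝ) :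
    MvPolynomial.eval x (quadPoly i j) = quadVar i j x := by
  rw [quadPoly, quadVar]
  split_ifs with h <;> simp [h, sq]

theorem totalDegree_quadPoly_le (i j : ℕ) : (quadPoly i j).totalDegree ≤ 2 := by
  refine (MvPolynomial.totalDegree_sub _ _).trans
    (max_le ?_ (by rw [MvPolynomial.totalDegree_C]; exact zero_le))
  exact (MvPolynomial.totalDegree_mul _ _).trans (by simp)

theorem quadPoly_comm (i j : ℕ) : quadPoly i j = quadPoly j i := by
  rw [quadPoly, quadPoly, mul_comm]
  simp only [eq_comm]

theorem expect_X_mul_X {ι : Type} [DecidableEq ι] (i j : ι) :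
    expect (MvPolynomial.X i * MvPolynomial.X j) = if i = j then 1 else 0 := by
  rw [expect_X_mul, MvPolynomial.pderiv_X, Pi.single_apply]
  split_ifs <;> simp_all [expect_one]

/-- Wick's formula: subtracting δ_{ij} removes the internal pairing and leaves the two cross
pairings. -/
theorem expect_quadPoly_mul (i j k l : ℕ) : expect (quadPoly i j * quadPoly k l) =
    (if i = k ∧ j = l then 1 else 0) + (if i = l ∧ j = k then 1 else 0) := by
  have h1 : quadPoly i j * quadPoly k l = MvPolynomial.X i * (MvPolynomial.X j * quadPoly k l) -
      MvPolynomial.C (if i = j then 1 else 0) * quadPoly k l := by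
    rw [quadPoly]; ring
  have h2 : MvPolynomial.pderiv i (MvPolynomial.X j * quadPoly k l) =
      MvPolynomial.C (if i = j then 1 else 0) * quadPoly k l +
      (MvPolynomial.C (if i = k then 1 else 0) * (MvPolynomial.X j * MvPolynomial.X l) +
        MvPolynomial.C (if i = l then 1 else 0) * (MvPolynomial.X j * MvPolynomial.X k)) := by
    have h3 : ∀ a : ℕ, MvPolynomial.pderiv i (MvPolynomial.X a : MvPolynomial ℕ ℝ) =
        MvPolynomial.C (if i = a then 1 else 0) := by
      intro a
      by_cases h : i = a
      · subst h; simp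
      · rw [MvPolynomial.pderiv_X_of_ne (Ne.symm h)]; simp [h]
    rw [quadPoly, Derivation.leibniz, map_sub, Derivation.leibniz, MvPolynomial.pderiv_C, h3, h3,
      h3]
    simp only [smul_eq_mul]
    ring
  rw [h1, map_sub, expect_X_mul, h2, map_add, add_sub_cancel_left, map_add, expect_C_mul,
    expect_C_mul, expect_X_mul_X, expect_X_mul_X]
  congr 1 <;> split_ifs <;> simp_all

theorem inner_toLpPoly {ι : Type} (P Q : MvPolynomial ι ℝ) :
    inner ℝ (toLpPoly 2 P) (toLpPoly 2 Q) = expect (P * Q) := by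
  rw [L2.inner_def, expect_apply]
  refine integral_congr_ae ?_
  filter_upwards [coeFn_toLpPoly 2 P, coeFn_toLpPoly 2 Q] with x hx hx'
  simp [hx, hx', mul_comm]

/-- The partial sum `∑_{i, j < K} a i j X_{i,j}` as a polynomial. -/
noncomputable def quadSum (a : ℕ → ℕ → ℝ) (K : ℕ) : MvPolynomial ℕ ℝ :=
  ∑ i ∈ Finset.range K, ∑ j ∈ Finset.range K, a i j • quadPoly i j

theorem eval_quadSum (a : ℕ → ℕ → ℝ) (K : ℕ) (x : ℕ → ℝ) :
    MvPolynomial.eval x (quadSum a K) =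
      ∑ i ∈ Finset.range K, ∑ j ∈ Finset.range K, a i j * quadVar i j x := by
  simp [quadSum, map_sum, MvPolynomial.smul_eval, eval_quadPoly]

theorem totalDegree_quadSum_le (a : ℕ → ℕ → ℝ) (K : ℕ) : (quadSum a K).totalDegree ≤ 2 :=
  MvPolynomial.totalDegree_finsetSum_le fun _ _ => MvPolynomial.totalDegree_finsetSum_le
    fun _ _ => (MvPolynomial.totalDegree_smul_le _ _).trans (totalDegree_quadPoly_le _ _)

theorem toLpPoly_quadSum (a : ℕ → ℕ → ℝ) (K : ℕ) : toLpPoly 2 (quadSum a K) =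
    ∑ i ∈ Finset.range K, ∑ j ∈ Finset.range K, a i j • toLpPoly 2 (quadPoly i j) := by
  simp [quadSum, map_sum]

theorem isMatrixOf_iff {A : Matrix ℕ ℕ ℝ} {F : Lp ℝ 2 (wiener ℕ)} : IsMatrixOf A F ↔
    A.IsSymm ∧ Tendsto (fun K => toLpPoly 2 (quadSum A K)) atTop (𝓝 F) := by
  refine and_congr_right fun _ => ?_
  rw [tendsto_toLpPoly_iff]
  refine tendsto_congr fun K => ?_
  congr 1 with x
  exact congrArg (· - F x) (eval_quadSum A K x).symm

theorem IsMatrixOf.approximates {A : Matrix ℕ ℕ ℝ} {F : Lp ℝ 2 (wiener ℕ)}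
    (h : IsMatrixOf A F) : Approximates (quadSum A) F :=
  (approximates_iff _ _).2 ⟨⟨2, totalDegree_quadSum_le A⟩, (isMatrixOf_iff.1 h).2⟩

theorem inner_quadPoly_quadSum {a : ℕ → ℕ → ℝ} (ha : ∀ i j, a i j = a j i) {k l K : ℕ}
    (hk : k < K) (hl : l < K) :
    inner ℝ (toLpPoly 2 (quadPoly k l)) (toLpPoly 2 (quadSum a K)) = 2 * a k l := by
  simp only [toLpPoly_quadSum, inner_sum, inner_smul_right, inner_toLpPoly, expect_quadPoly_mul,
    mul_add, Finset.sum_add_distrib]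
  have h1 : ∀ u v : ℕ, u < K → v < K → ∑ i ∈ Finset.range K, ∑ j ∈ Finset.range K,
      a i j * (if u = i ∧ v = j then 1 else 0) = a u v := by
    intro u v hu hv
    rw [Finset.sum_eq_single_of_mem u (Finset.mem_range.2 hu) fun i _ hi =>
      Finset.sum_eq_zero fun j _ => by simp [hi.symm],
      Finset.sum_eq_single_of_mem v (Finset.mem_range.2 hv) fun j _ hj => by simp [hj.symm]]
    simp
  rw [h1 k l hk hl]
  simp only [and_comm (a := k = _)]
  rw [h1 l k hl hk, ha l k]; ring

theorem norm_quadSum_sq {a : ℕ → ℕ → ℝ} (ha : ∀ i j, a i j = a j i) (K : ℕ) :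
    ‖toLpPoly 2 (quadSum a K)‖ ^ 2 =
      2 * ∑ i ∈ Finset.range K, ∑ j ∈ Finset.range K, a i j ^ 2 := by
  rw [← real_inner_self_eq_norm_sq]
  conv_lhs => rw [toLpPoly_quadSum a K]
  simp only [sum_inner, inner_smul_left, Finset.mul_sum]
  refine Finset.sum_congr rfl fun i hi => Finset.sum_congr rfl fun j hj => ?_
  rw [← toLpPoly_quadSum, inner_quadPoly_quadSum ha (Finset.mem_range.1 hi)
    (Finset.mem_range.1 hj)]
  simp; ring

/-- The coefficients `E[F X_{i,j}] / 2`. -/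
noncomputable def quadCoeff (F : Lp ℝ 2 (wiener ℕ)) (i j : ℕ) : ℝ :=
  inner ℝ (toLpPoly 2 (quadPoly i j)) F / 2

theorem quadCoeff_comm (F : Lp ℝ 2 (wiener ℕ)) (i j : ℕ) : quadCoeff F i j = quadCoeff F j i := by
  rw [quadCoeff, quadPoly_comm, quadCoeff]

/-- The projection on the span of the `X_{i,j}` with `i, j < K`. -/
noncomputable def quadProj (K : ℕ) (F : Lp ℝ 2 (wiener ℕ)) : Lp ℝ 2 (wiener ℕ) :=
  toLpPoly 2 (quadSum (quadCoeff F) K)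

theorem quadProj_add (K : ℕ) (F G : Lp ℝ 2 (wiener ℕ)) :
    quadProj K (F + G) = quadProj K F + quadProj K G := by
  simp only [quadProj, toLpPoly_quadSum, quadCoeff, inner_add_right, add_div, add_smul,
    Finset.sum_add_distrib]

theorem quadProj_smul (K : ℕ) (c : ℝ) (F : Lp ℝ 2 (wiener ℕ)) :
    quadProj K (c • F) = c • quadProj K F := by
  simp only [quadProj, toLpPoly_quadSum, quadCoeff, inner_smul_right, mul_div_assoc, mul_smul,
    Finset.smul_sum]

/-- The coefficients are chosen so that ⟨ΠF, F⟩ = ‖ΠF‖²; Cauchy-Schwarz finishes. -/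
theorem norm_quadProj_le (K : ℕ) (F : Lp ℝ 2 (wiener ℕ)) : ‖quadProj K F‖ ≤ ‖F‖ := by
  have h1 : inner ℝ (quadProj K F) F = ‖quadProj K F‖ ^ 2 := by
    rw [quadProj, norm_quadSum_sq (quadCoeff_comm F), toLpPoly_quadSum]
    simp only [sum_inner, inner_smul_left, Finset.mul_sum]
    refine Finset.sum_congr rfl fun i _ => Finset.sum_congr rfl fun j _ => ?_
    rw [quadCoeff]
    simp; ring
  have h2 := real_inner_le_norm (quadProj K F) F
  rw [h1, sq] at h2
  by_contra h
  push Not at h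
  have := norm_nonneg F
  nlinarith

/-- Here ⟨ΠF, F⟩ = ‖F‖² and ‖ΠF‖ ≤ ‖F‖, which together force ‖ΠF - F‖² ≤ 0. -/
theorem quadProj_quadPoly {k l K : ℕ} (hk : k < K) (hl : l < K) :
    quadProj K (toLpPoly 2 (quadPoly k l)) = toLpPoly 2 (quadPoly k l) := by
  set F := toLpPoly 2 (quadPoly k l) with hF
  have h1 : inner ℝ (quadProj K F) F = inner ℝ F F := by
    rw [real_inner_comm, quadProj, hF, inner_quadPoly_quadSum (quadCoeff_comm _) hk hl, quadCoeff]
    ring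
  have h2 : ‖quadProj K F‖ ^ 2 ≤ ‖F‖ ^ 2 := by gcongr; exact norm_quadProj_le K F
  rw [← sub_eq_zero, ← norm_eq_zero, ← sq_eq_zero_iff]
  have h3 := norm_sub_sq_real (quadProj K F) F
  rw [h1, real_inner_self_eq_norm_sq] at h3
  nlinarith [sq_nonneg ‖quadProj K F - F‖]

theorem exists_hermitePoly_eq_quadPoly {k : ℕ →₀ ℕ} (hk : (k.sum fun _ n => n) = 2) :
    ∃ i j, hermitePoly k = quadPoly i j := by
  have h2 : Polynomial.hermite 2 = Polynomial.X ^ 2 - 1 := by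
    rw [Polynomial.hermite_succ, Polynomial.hermite_one, Polynomial.derivative_X, sq]
  have hc : (Finsupp.toMultiset k).card = 2 := by rw [Finsupp.card_toMultiset]; exact hk
  obtain ⟨i, j, hij⟩ := Multiset.card_eq_two.1 hc
  have hk' : k = Finsupp.single i 1 + Finsupp.single j 1 := by
    rw [← Finsupp.toMultiset_toFinsupp k, hij, Multiset.toFinsupp_eq_iff, map_add,
      Finsupp.toMultiset_single, Finsupp.toMultiset_single, one_nsmul, one_nsmul]
    rfl
  refine ⟨i, j, ?_⟩
  by_cases h : i = j
  · subst h
    rw [← Finsupp.single_add] at hk'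
    rw [hk', hermitePoly, Finsupp.prod_single_index (by simp), h2, quadPoly]
    simp [sq]
  · rw [hk', hermitePoly, Finsupp.prod_add_index_of_disjoint, Finsupp.prod_single_index (by simp),
      Finsupp.prod_single_index (by simp), quadPoly]
    · simp [h]
    · exact (Finsupp.support_single_disjoint one_ne_zero one_ne_zero).2 h

/-- Each element of the algebraic span is eventually fixed by the projections, and being
contractions they converge on the closure as well. -/
theorem tendsto_quadProj {F : Lp ℝ 2 (wiener ℕ)} (hF : F ∈ chaos ℕ 2) :
    Tendsto (fun K => quadProj K F) atTop (𝓝 F) := by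
  have hspan : ∀ G ∈ Submodule.span ℝ {f : Lp ℝ 2 (wiener ℕ) | ∃ k : ℕ →₀ ℕ,
      (k.sum fun _ n => n) = 2 ∧ (f : (ℕ → ℝ) → ℝ) =ᵐ[wiener ℕ] hermiteProduct k},
      ∀ᶠ K in atTop, quadProj K G = G := by
    intro G hG
    induction hG using Submodule.span_induction with
    | mem G hG =>
      obtain ⟨k, hk, hGk⟩ := hG
      obtain ⟨i, j, hij⟩ := exists_hermitePoly_eq_quadPoly hk
      have hGe : G = toLpPoly 2 (quadPoly i j) := by
        refine Lp.ext ?_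
        filter_upwards [hGk, coeFn_toLpPoly 2 (quadPoly i j)] with x h1 h2
        rw [h1, h2, ← hij, eval_hermitePoly]
      filter_upwards [eventually_gt_atTop i, eventually_gt_atTop j] with K hi hj
      rw [hGe, quadProj_quadPoly hi hj]
    | zero =>
      filter_upwards with K
      simpa using quadProj_smul K 0 0
    | add G H _ _ h1 h2 =>
      filter_upwards [h1, h2] with K h1 h2
      rw [quadProj_add, h1, h2]
    | smul c G _ h1 =>
      filter_upwards [h1] with K h1
      rw [quadProj_smul, h1]
  rw [Metric.tendsto_atTop']
  intro ε hε
  rw [chaos, ← SetLike.mem_coe, Submodule.topologicalClosure_coe, Metric.mem_closure_iff] at hF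
  obtain ⟨G, hG, hFG⟩ := hF (ε / 2) (half_pos hε)
  obtain ⟨K₀, hK₀⟩ := eventually_atTop.1 (hspan G hG)
  refine ⟨K₀, fun K hK => ?_⟩
  have h1 : quadProj K F - F = quadProj K (F - G) - (F - G) := by
    have : quadProj K F = quadProj K (F - G) + quadProj K G := by
      rw [← quadProj_add, sub_add_cancel]
    rw [this, hK₀ K hK.le]; abel
  rw [dist_eq_norm] at hFG ⊢
  rw [h1]
  have := norm_sub_le (quadProj K (F - G)) (F - G)
  have := norm_quadProj_le K (F - G)
  linarith

theorem exists_isMatrixOf {F : Lp ℝ 2 (wiener ℕ)} (hF : F ∈ chaos ℕ 2) :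
    ∃ A : Matrix ℕ ℕ ℝ, IsMatrixOf A F :=
  ⟨Matrix.of (quadCoeff F), isMatrixOf_iff.2
    ⟨Matrix.IsSymm.ext fun i j => quadCoeff_comm F j i, tendsto_quadProj hF⟩⟩

/-- The matrix of an element of the second chaos is square summable. -/
theorem IsMatrixOf.sum_sq_le {A : Matrix ℕ ℕ ℝ} {F : Lp ℝ 2 (wiener ℕ)} (h : IsMatrixOf A F)
    (K : ℕ) : 2 * ∑ i ∈ Finset.range K, ∑ j ∈ Finset.range K, A i j ^ 2 ≤ ‖F‖ ^ 2 := by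
  obtain ⟨hA, h⟩ := isMatrixOf_iff.1 h
  have h1 : Tendsto (fun K => 2 * ∑ i ∈ Finset.range K, ∑ j ∈ Finset.range K, A i j ^ 2) atTop
      (𝓝 (‖F‖ ^ 2)) := by
    refine (h.norm.pow 2).congr fun K => norm_quadSum_sq (fun i j => hA.apply j i) K
  refine Monotone.ge_of_tendsto (fun K L hKL => ?_) h1 K
  gcongr 2 * ?_
  have hs := Finset.range_subset_range.2 hKL
  refine (Finset.sum_le_sum fun i _ => Finset.sum_le_sum_of_subset_of_nonneg hs
    fun j _ _ => sq_nonneg _).trans (Finset.sum_le_sum_of_subset_of_nonneg hs fun i _ _ =>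
      Finset.sum_nonneg fun j _ => sq_nonneg _)

/-! ### Eigenvectors of square summable matrices -/

theorem hasSum_lp_mul (v w : lp (fun _ : ℕ => ℝ) 2) :
    HasSum (fun i => v i * w i) (inner ℝ v w) := by
  refine (lp.hasSum_inner (𝕜 := ℝ) v w).congr_fun ?_
  intro i
  simp [mul_comm]

theorem hasSum_lp_sq (v : lp (fun _ : ℕ => ℝ) 2) : HasSum (fun i => v i ^ 2) (‖v‖ ^ 2) := by
  rw [← real_inner_self_eq_norm_sq]
  simpa only [sq] using hasSum_lp_mul v v

theorem summable_sq_of_sum_le {A : Matrix ℕ ℕ ℝ} {b : ℝ}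
    (hA : ∀ K, ∑ i ∈ Finset.range K, ∑ j ∈ Finset.range K, A i j ^ 2 ≤ b) :
    Summable fun p : ℕ × ℕ => A p.1 p.2 ^ 2 := by
  refine summable_of_sum_le (c := b) (fun _ => sq_nonneg _) fun u => ?_
  obtain ⟨K, hK⟩ : ∃ K, u ⊆ Finset.range K ×ˢ Finset.range K := by
    refine ⟨u.sup (fun p => max p.1 p.2) + 1, fun p hp => ?_⟩
    have := Finset.le_sup (f := fun p : ℕ × ℕ => max p.1 p.2) hp
    simp only [Finset.mem_product, Finset.mem_range]
    omega
  refine (Finset.sum_le_sum_of_subset_of_nonneg hK fun _ _ _ => sq_nonneg _).trans ?_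
  rw [Finset.sum_product]
  exact hA K

/-- A row of a square summable matrix as an element of `ℓ²`. -/
noncomputable def rowVec {A : Matrix ℕ ℕ ℝ} (hA : Summable fun p : ℕ × ℕ => A p.1 p.2 ^ 2)
    (i : ℕ) : lp (fun _ : ℕ => ℝ) 2 :=
  ⟨fun j => A i j, memℓp_gen (by simpa using hA.prod_factor i)⟩

theorem summable_norm_rowVec {A : Matrix ℕ ℕ ℝ} (hA : Summable fun p : ℕ × ℕ => A p.1 p.2 ^ 2) :
    Summable fun i => ‖rowVec hA i‖ ^ 2 :=
  hA.prod.congr fun i => (hasSum_lp_sq (rowVec hA i)).tsum_eq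

theorem tsum_norm_rowVec_le {A : Matrix ℕ ℕ ℝ} {b : ℝ}
    (hAb : ∀ K, ∑ i ∈ Finset.range K, ∑ j ∈ Finset.range K, A i j ^ 2 ≤ b)
    (hA : Summable fun p : ℕ × ℕ => A p.1 p.2 ^ 2) : ∑' i, ‖rowVec hA i‖ ^ 2 ≤ b := by
  have h1 : ∀ L, ∑ i ∈ Finset.range L, ‖rowVec hA i‖ ^ 2 ≤ b := by
    intro L
    have h2 : Tendsto (fun K => ∑ i ∈ Finset.range L, ∑ j ∈ Finset.range K, A i j ^ 2) atTop
        (𝓝 (∑ i ∈ Finset.range L, ‖rowVec hA i‖ ^ 2)) :=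
      tendsto_finsetSum _ fun i _ => (hasSum_lp_sq (rowVec hA i)).tendsto_sum_nat
    refine le_of_tendsto h2 ?_
    filter_upwards [eventually_ge_atTop L] with K hK
    exact (Finset.sum_le_sum_of_subset_of_nonneg (Finset.range_subset_range.2 hK) fun i _ _ =>
      Finset.sum_nonneg fun j _ => sq_nonneg _).trans (hAb K)
  exact (summable_norm_rowVec hA).tsum_le_of_sum_range_le h1

theorem inner_rowVec {A : Matrix ℕ ℕ ℝ} (hA : Summable fun p : ℕ × ℕ => A p.1 p.2 ^ 2) {c : ℝ}
    {v : lp (fun _ : ℕ => ℝ) 2} (hv : v ∈ eigenspace A c) (i : ℕ) :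
    inner ℝ (rowVec hA i) v = c * v i :=
  (hasSum_lp_mul _ _).unique (hv i)

/-- Compute Σ A_{ij} v_j w_i in both orders. The exchange is legitimate because A and w ⊗ v are both
square summable, hence the double sum converges absolutely. -/
theorem inner_eq_zero_of_mem_eigenspace {A : Matrix ℕ ℕ ℝ} (hs : A.IsSymm)
    (hA : Summable fun p : ℕ × ℕ => A p.1 p.2 ^ 2) {c d : ℝ} (hcd : c ≠ d)
    {v w : lp (fun _ : ℕ => ℝ) 2} (hv : v ∈ eigenspace A c) (hw : w ∈ eigenspace A d) :
    inner ℝ v w = 0 := by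
  have hsum : Summable fun p : ℕ × ℕ => A p.1 p.2 * v p.2 * w p.1 := by
    have h1 : Summable fun p : ℕ × ℕ => w p.1 ^ 2 * v p.2 ^ 2 :=
      (hasSum_lp_sq w).summable.mul_of_nonneg (hasSum_lp_sq v).summable (fun _ => sq_nonneg _)
        fun _ => sq_nonneg _
    refine Summable.of_norm_bounded (hA.add h1) fun p => ?_
    rw [Real.norm_eq_abs, abs_le]
    constructor <;> nlinarith [sq_nonneg (A p.1 p.2 + w p.1 * v p.2),
      sq_nonneg (A p.1 p.2 - w p.1 * v p.2), sq_nonneg (A p.1 p.2), sq_nonneg (w p.1 * v p.2)]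
  have h1 : ∑' p : ℕ × ℕ, A p.1 p.2 * v p.2 * w p.1 = c * inner ℝ v w := by
    rw [hsum.tsum_prod]
    have : ∀ i, ∑' j, A i j * v j * w i = c * (v i * w i) := fun i => by
      rw [tsum_mul_right, (hv i).tsum_eq, mul_assoc]
    simp only [this]
    exact ((hasSum_lp_mul v w).mul_left c).tsum_eq
  have h2 : ∑' p : ℕ × ℕ, A p.1 p.2 * v p.2 * w p.1 = d * inner ℝ v w := by
    rw [hsum.tsum_prod]
    refine (Summable.tsum_comm (f := fun i j => A i j * v j * w i) hsum).symm.trans ?_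
    have : ∀ j, ∑' i, A i j * v j * w i = d * (v j * w j) := fun j => by
      have h4 : ∀ i, A i j * v j * w i = v j * (A j i * w i) := fun i => by rw [hs.apply]; ring
      simp only [h4]
      rw [tsum_mul_left, (hw j).tsum_eq]; ring
    simp only [this]
    exact ((hasSum_lp_mul v w).mul_left d).tsum_eq
  have h3 : (c - d) * inner ℝ v w = 0 := by rw [sub_mul, ← h1, ← h2, sub_self]
  exact (mul_eq_zero.1 h3).resolve_left (sub_ne_zero.2 hcd)

theorem exists_orthonormal_eigenvectors {A : Matrix ℕ ℕ ℝ} (hs : A.IsSymm)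
    (hA : Summable fun p : ℕ × ℕ => A p.1 p.2 ^ 2) :
    ∃ v : (Σ c : {c : ℝ // c ≠ 0}, Fin (Module.finrank ℝ (eigenspace A c.1))) →
      lp (fun _ : ℕ => ℝ) 2, Orthonormal ℝ v ∧ ∀ a, v a ∈ eigenspace A a.1.1 := by
  have h : ∀ c : {c : ℝ // c ≠ 0}, ∃ u : Fin (Module.finrank ℝ (eigenspace A c.1)) →
      eigenspace A c.1, Orthonormal ℝ u := by
    intro c
    -- `finrank` is 0 both for a trivial and for an infinite-dimensional space; in either case the
    -- index type is empty. Thus finiteness of multiplicities need not be established here.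
    by_cases h0 : Module.finrank ℝ (eigenspace A c.1) = 0
    · have : IsEmpty (Fin (Module.finrank ℝ (eigenspace A c.1))) := by rw [h0]; infer_instance
      exact ⟨fun _ => 0, ⟨fun i => isEmptyElim i, fun i => isEmptyElim i⟩⟩
    · have := Module.finite_of_finrank_pos (Nat.pos_of_ne_zero h0)
      exact ⟨stdOrthonormalBasis ℝ _, (stdOrthonormalBasis ℝ _).orthonormal⟩
  choose u hu using h
  refine ⟨fun a => u a.1 a.2, ⟨fun a => (hu a.1).1 a.2, ?_⟩, fun a => (u a.1 a.2).2⟩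
  rintro ⟨c, i⟩ ⟨d, j⟩ hab
  by_cases hcd : c = d
  · subst hcd
    exact (hu c).2 fun hij => hab (congrArg (Sigma.mk c) hij)
  · exact inner_eq_zero_of_mem_eigenspace hs hA (fun h => hcd (Subtype.ext h)) (u c i).2 (u d j).2

/-- The inner product of the i-th row with v_a is λ_a v_a(i). Bessel's inequality for each row,
summed over i, gives the bound. -/
theorem sum_eigenvalue_sq_le {A : Matrix ℕ ℕ ℝ} (hA : Summable fun p : ℕ × ℕ => A p.1 p.2 ^ 2)
    {κ : Type} {v : κ → lp (fun _ : ℕ => ℝ) 2} (hv : Orthonormal ℝ v) {lam : κ → ℝ}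
    (hlam : ∀ a, v a ∈ eigenspace A (lam a)) (J : Finset κ) :
    ∑ a ∈ J, lam a ^ 2 ≤ ∑' i, ‖rowVec hA i‖ ^ 2 := by
  have h1 : HasSum (fun i => ∑ a ∈ J, lam a ^ 2 * v a i ^ 2) (∑ a ∈ J, lam a ^ 2) := by
    refine hasSum_sum fun a _ => ?_
    simpa [hv.1 a] using (hasSum_lp_sq (v a)).mul_left (lam a ^ 2)
  refine hasSum_le (fun i => ?_) h1 (summable_norm_rowVec hA).hasSum
  refine (Finset.sum_le_sum fun a _ => ?_).trans (hv.sum_inner_products_le (s := J) (rowVec hA i))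
  rw [real_inner_comm, inner_rowVec hA (hlam a), Real.norm_eq_abs, sq_abs, mul_pow]

/-- Bessel's inequality for the finitely supported vector with entries y_l. -/
theorem sum_truncated_sq_le {κ : Type} {v : κ → lp (fun _ : ℕ => ℝ) 2} (hv : Orthonormal ℝ v)
    (J : Finset κ) (s : Finset ℕ) (y : ℕ → ℝ) :
    ∑ a ∈ J, (∑ l ∈ s, v a l * y l) ^ 2 ≤ ∑ l ∈ s, y l ^ 2 := by
  have h1 := hv.sum_inner_products_le (s := J) (∑ l ∈ s, lp.single 2 l (y l))
  have h2 := lp.norm_sum_single (p := 2) (E := fun _ : ℕ => ℝ) (by norm_num) y s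
  norm_num at h2
  rw [h2] at h1
  refine le_trans (Finset.sum_le_sum fun a _ => ?_) h1
  rw [inner_sum, Real.norm_eq_abs, sq_abs]
  simp only [lp.inner_single_right]
  simp [mul_comm]

/-- With u = Σ z_a v_a the left side is the squared norm of the truncated matrix applied to the
truncation of u, and it converges to |Au|² = Σ λ_a² z_a². By Cauchy-Schwarz the i-th term is
dominated by |row_i|² |u|², which is summable. -/
theorem tendsto_sum_rowVec {A : Matrix ℕ ℕ ℝ} (hs : A.IsSymm)
    (hA : Summable fun p : ℕ × ℕ => A p.1 p.2 ^ 2) {κ : Type}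
    {v : κ → lp (fun _ : ℕ => ℝ) 2} (hv : Orthonormal ℝ v) {lam : κ → ℝ}
    (hlam : ∀ a, v a ∈ eigenspace A (lam a)) (J : Finset κ) (z : κ → ℝ) :
    Tendsto (fun K => ∑ i ∈ Finset.range K,
      (∑ a ∈ J, (∑ l ∈ Finset.range K, v a l * A l i) * z a) ^ 2) atTop
      (𝓝 (∑ a ∈ J, lam a ^ 2 * z a ^ 2)) := by
  classical
  set u := ∑ a ∈ J, z a • v a with hu
  set w := ∑ a ∈ J, (lam a * z a) • v a with hw
  have hui : ∀ i, u i = ∑ a ∈ J, z a * v a i := fun i => by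
    rw [hu, lp.coeFn_sum, Finset.sum_apply]; rfl
  have hwi : ∀ i, w i = ∑ a ∈ J, lam a * z a * v a i := fun i => by
    rw [hw, lp.coeFn_sum, Finset.sum_apply]; rfl
  have hrow : ∀ i, inner ℝ (rowVec hA i) u = w i := fun i => by
    rw [hu, inner_sum, hwi]
    refine Finset.sum_congr rfl fun a _ => ?_
    rw [inner_smul_right, inner_rowVec hA (hlam a)]; ring
  have hswap : ∀ K i, ∑ a ∈ J, (∑ l ∈ Finset.range K, v a l * A l i) * z a =
      ∑ l ∈ Finset.range K, A i l * u l := fun K i => by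
    simp only [hui, Finset.sum_mul, Finset.mul_sum]
    rw [Finset.sum_comm]
    refine Finset.sum_congr rfl fun l _ => Finset.sum_congr rfl fun a _ => ?_
    rw [hs.apply]; ring
  have hw2 : ‖w‖ ^ 2 = ∑ a ∈ J, lam a ^ 2 * z a ^ 2 := by
    rw [← real_inner_self_eq_norm_sq, hw, hv.inner_sum]
    refine Finset.sum_congr rfl fun a _ => ?_
    simp; ring
  rw [← hw2, ← (hasSum_lp_sq w).tsum_eq]
  simp only [hswap]
  have key := tendsto_tsum_of_dominated_convergence (𝓕 := atTop)
    (f := fun K i => if i ∈ Finset.range K then (∑ l ∈ Finset.range K, A i l * u l) ^ 2 else 0)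
    (g := fun i => w i ^ 2) (bound := fun i => ‖rowVec hA i‖ ^ 2 * ‖u‖ ^ 2)
    ((summable_norm_rowVec hA).mul_right _) ?_ ?_
  · refine key.congr fun K => ?_
    rw [tsum_eq_sum (s := Finset.range K) fun i hi => if_neg hi]
    exact Finset.sum_congr rfl fun i hi => if_pos hi
  · intro i
    have h1 : Tendsto (fun K => ∑ l ∈ Finset.range K, A i l * u l) atTop (𝓝 (w i)) := by
      rw [← hrow i]
      exact (hasSum_lp_mul (rowVec hA i) u).tendsto_sum_nat
    refine (h1.pow 2).congr' ?_
    filter_upwards [eventually_gt_atTop i] with K hK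
    rw [if_pos (Finset.mem_range.2 hK)]
  · filter_upwards with K i
    split_ifs
    · rw [Real.norm_of_nonneg (sq_nonneg _)]
      refine (Finset.sum_mul_sq_le_sq_mul_sq _ _ _).trans ?_
      gcongr
      · exact sum_le_hasSum _ (fun _ _ => sq_nonneg _) (hasSum_lp_sq (rowVec hA i))
      · exact sum_le_hasSum _ (fun _ _ => sq_nonneg _) (hasSum_lp_sq u)
    · simp; positivity

/-! ### Negative moments in the second chaos -/

theorem eval_gammaPoly_quadSum {A : Matrix ℕ ℕ ℝ} (hs : A.IsSymm) (K : ℕ) (x : ℕ → ℝ) :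
    MvPolynomial.eval x (gammaPoly (quadSum A K)) =
      4 * ∑ l ∈ Finset.range K, (∑ j ∈ Finset.range K, A l j * x j) ^ 2 := by
  have hsup : quadSum A K ∈ MvPolynomial.supported ℝ (Finset.range K : Set ℕ) := by
    refine sum_mem fun i hi => sum_mem fun j hj => Subalgebra.smul_mem _ ?_ _
    exact sub_mem (mul_mem (MvPolynomial.X_mem_supported.2 hi) (MvPolynomial.X_mem_supported.2 hj))
      (Subalgebra.algebraMap_mem _ _)
  rw [gammaPoly_eq_gam hsup, eval_gam_self, Finset.mul_sum]
  refine Finset.sum_congr rfl fun l hl => ?_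
  have h1 : ∀ i j, MvPolynomial.eval x (MvPolynomial.pderiv l (quadPoly i j)) =
      (if l = i then x j else 0) + (if l = j then x i else 0) := fun i j => by
    have h3 : ∀ a : ℕ, MvPolynomial.eval x (MvPolynomial.pderiv l (MvPolynomial.X a)) =
        if l = a then 1 else 0 := fun a => by
      by_cases h : l = a
      · subst h; simp
      · rw [MvPolynomial.pderiv_X_of_ne (Ne.symm h)]; simp [h]
    rw [quadPoly, map_sub, Derivation.leibniz, MvPolynomial.pderiv_C, sub_zero, map_add,
      smul_eq_mul, smul_eq_mul, map_mul, map_mul, h3, h3, MvPolynomial.eval_X, MvPolynomial.eval_X]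
    simp [add_comm]
  have h2 : MvPolynomial.eval x (MvPolynomial.pderiv l (quadSum A K)) =
      2 * ∑ j ∈ Finset.range K, A l j * x j := by
    simp only [quadSum, map_sum, Derivation.map_smul, MvPolynomial.smul_eval, h1, mul_add,
      Finset.sum_add_distrib, mul_ite, mul_zero]
    rw [Finset.sum_comm]
    simp only [Finset.sum_ite_eq, hl, if_true, two_mul]
    congr 1
    exact Finset.sum_congr rfl fun i _ => by rw [hs.apply]
  rw [h2]; ring

theorem integrable_exp_neg {Ω : Type} [MeasurableSpace Ω] {μ : Measure Ω} [IsFiniteMeasure μ]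
    {f : Ω → ℝ} (hf : AEStronglyMeasurable f μ) (h0 : ∀ x, 0 ≤ f x) :
    Integrable (fun x => Real.exp (-f x)) μ := by
  refine Integrable.of_bound (C := 1) (Real.continuous_exp.comp_aestronglyMeasurable hf.neg)
    (ae_of_all _ fun x => ?_)
  rw [Real.norm_of_nonneg (Real.exp_nonneg _), Real.exp_le_one_iff, neg_nonpos]
  exact h0 x

/-- The Laplace transform of `Γ[F, F]` in the second chaos is bounded by the eigenvalues. -/
theorem IsMatrixOf.integral_exp_neg_gamma_le {A : Matrix ℕ ℕ ℝ} {F : Lp ℝ 2 (wiener ℕ)}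
    (hAF : IsMatrixOf A F) (hA : Summable fun p : ℕ × ℕ => A p.1 p.2 ^ 2) {κ : Type}
    {v : κ → lp (fun _ : ℕ => ℝ) 2} (hv : Orthonormal ℝ v) {lam : κ → ℝ}
    (hlam : ∀ a, v a ∈ eigenspace A (lam a)) (J : Finset κ) {t : ℝ} (ht : 0 ≤ t) :
    ∫ x, Real.exp (-(t * max (gamma F x) 0)) ∂(wiener ℕ) ≤
      (√(∏ a ∈ J, (1 + 2 * ((4 * t) * lam a ^ 2))))⁻¹ := by
  have hs : A.IsSymm := hAF.1
  have hL : Tendsto (fun K => ∫ x, Real.exp (-(t * max (MvPolynomial.eval x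
      (gammaPoly (quadSum A K))) 0)) ∂(wiener ℕ)) atTop
      (𝓝 (∫ x, Real.exp (-(t * max (gamma F x) 0)) ∂(wiener ℕ))) := by
    refine tendsto_integral_comp (φ := fun y => Real.exp (-(t * max y 0))) (c := 1)
      (by fun_prop) (fun y => ?_) (fun K => (measurable_eval _).aestronglyMeasurable)
      (Lp.aestronglyMeasurable _) ((tendsto_toLpPoly_iff 1 _ _).1 (tendsto_gamma hAF.approximates))
    rw [Real.abs_exp, Real.exp_le_one_iff, neg_nonpos]
    positivity
  have hR : Tendsto (fun K => ∫ z : κ → ℝ, Real.exp (-((4 * t) * ∑ i ∈ Finset.range K,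
      (∑ a ∈ J, (∑ l ∈ Finset.range K, v a l * A l i) * z a) ^ 2)) ∂(wiener κ)) atTop
      (𝓝 ((√(∏ a ∈ J, (1 + 2 * ((4 * t) * lam a ^ 2))))⁻¹)) := by
    rw [← integral_exp_neg_sum_sq J fun a => by positivity]
    refine tendsto_integral_of_dominated_convergence (fun _ => 1)
      (fun K => Measurable.aestronglyMeasurable (by fun_prop)) (integrable_const 1)
      (fun K => ae_of_all _ fun z => ?_) (ae_of_all _ fun z => ?_)
    · rw [Real.norm_of_nonneg (Real.exp_nonneg _), Real.exp_le_one_iff, neg_nonpos]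
      positivity
    · have h1 := ((tendsto_sum_rowVec hs hA hv hlam J z).const_mul (4 * t)).neg.rexp
      simpa only [Finset.mul_sum, mul_assoc] using h1
  -- At level K, Γ is 4|A_K x|², and Bessel bounds it below by the part seen by the finitely many
  -- eigenvectors in `J`. Transposing leaves finitely many Gaussians z_a, which makes the passage K
  -- → ∞ on the right possible.
  refine le_of_tendsto_of_tendsto' hL hR fun K => ?_
  rw [← integral_exp_neg_quadratic J (Finset.range K) _ (by positivity)]
  refine integral_mono_of_nonneg (ae_of_all _ fun x => Real.exp_nonneg _)
    (integrable_exp_neg (Measurable.aestronglyMeasurable (by fun_prop)) fun x => by positivity)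
    (ae_of_all _ fun x => Real.exp_le_exp.2 (neg_le_neg ?_))
  rw [eval_gammaPoly_quadSum hs, max_eq_left (by positivity), mul_comm 4 t, mul_assoc]
  gcongr t * (4 * ?_)
  refine le_trans (le_of_eq ?_) (sum_truncated_sq_le hv J (Finset.range K)
    fun l => ∑ j ∈ Finset.range K, A l j * x j)
  refine Finset.sum_congr rfl fun a _ => ?_
  congr 1
  simp only [Finset.sum_mul, Finset.mul_sum, ← mul_assoc]
  exact Finset.sum_comm

/-- Since the squared eigenvalues sum to at most 1, the spectral remainder is at most 1 and its
power -1/2 is at least 1; this absorbs the additive constant. -/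
theorem negMoment_gamma_le_matrixRemainder (q : ℕ) {A : Matrix ℕ ℕ ℝ} {F : Lp ℝ 2 (wiener ℕ)}
    (hAF : IsMatrixOf A F) (hF : ‖F‖ ≤ 1) :
    negMoment (wiener ℕ) (gamma F) q ≤ ENNReal.ofReal (1 + 4 ^ q * Real.exp 1 * 2 *
      √(((2 * q + 1 : ℕ) : ℝ) ^ (2 * q + 1))) * matrixRemainder (2 * q + 1) A ^ (-(1 / 2) : ℝ) := by
  have hb : ∀ K, ∑ i ∈ Finset.range K, ∑ j ∈ Finset.range K, A i j ^ 2 ≤ 1 := fun K => by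
    have h1 := hAF.sum_sq_le K
    have h2 : ‖F‖ ^ 2 ≤ 1 := pow_le_one₀ (norm_nonneg _) hF
    linarith [Finset.sum_nonneg fun i (_ : i ∈ Finset.range K) =>
      Finset.sum_nonneg fun j (_ : j ∈ Finset.range K) => sq_nonneg (A i j)]
  have hA := summable_sq_of_sum_le hb
  obtain ⟨v, hv, hlam⟩ := exists_orthonormal_eigenvectors hAF.1 hA
  have hR : matrixRemainder (2 * q + 1) A ≤ 1 := by
    refine (spectralRemainder_le _ fun J => (sum_eigenvalue_sq_le hA hv hlam J).trans
      (tsum_norm_rowVec_le hb hA)).trans ?_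
    simp
  have h1 : 1 ≤ matrixRemainder (2 * q + 1) A ^ (-(1 / 2) : ℝ) := by
    rw [ENNReal.rpow_neg, ENNReal.one_le_inv]
    exact ENNReal.rpow_le_one hR (by norm_num)
  refine (negMoment_le_of_laplace (D := ENNReal.ofReal √(((2 * q + 1 : ℕ) : ℝ) ^ (2 * q + 1)) *
    matrixRemainder (2 * q + 1) A ^ (-(1 / 2) : ℝ)) (Lp.aestronglyMeasurable _).aemeasurable q
    fun n => ?_).trans ?_
  · rw [← ofReal_integral_eq_lintegral_ofReal _ (ae_of_all _ fun x => Real.exp_nonneg _)]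
    -- The extra factor 4 is that of Γ = 4|A_K x|².
    · refine ofReal_le_spectralRemainder (t := 4 * 4 ^ n)
        (integral_nonneg fun x => Real.exp_nonneg _)
        (by linarith [show (0 : ℝ) < 4 ^ n by positivity]) fun J => ?_
      exact hAF.integral_exp_neg_gamma_le hA hv hlam J (by positivity)
    · refine integrable_exp_neg (AEMeasurable.aestronglyMeasurable ?_) fun x => by positivity
      have := (Lp.aestronglyMeasurable (gamma F)).aemeasurable
      fun_prop
  · rw [ENNReal.ofReal_add zero_le_one (by positivity), add_mul, ENNReal.ofReal_one, one_mul,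
      ENNReal.ofReal_mul (p := 4 ^ q * Real.exp 1 * 2) (by positivity),
      mul_assoc (ENNReal.ofReal _)]
    gcongr

/-- Negative moments of `Γ[F,F]` in terms of the spectral remainders of the matrix of `F`. -/
theorem exists_negMoment_le_matrixRemainder (q : ℕ) : ∃ C : ℝ, 0 < C ∧
    ∀ F ∈ chaos ℕ 2, ∫ x, (F x) ^ 2 ∂(wiener ℕ) ≤ 1 →
      (∃ A : Matrix ℕ ℕ ℝ, IsMatrixOf A F) ∧ ∀ A : Matrix ℕ ℕ ℝ, IsMatrixOf A F →
        negMoment (wiener ℕ) (gamma F) q ≤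
          ENNReal.ofReal C * matrixRemainder (2 * q + 1) A ^ (-(1 / 2) : ℝ) := by
  refine ⟨_, by positivity, fun F hF hF1 => ⟨exists_isMatrixOf hF, fun A hAF =>
    negMoment_gamma_le_matrixRemainder q hAF ?_⟩⟩
  rw [integral_sq_eq_norm_sq] at hF1
  exact (sq_le_one_iff₀ (norm_nonneg _)).1 hF1

end GaussianChaos

theorem mainTheorem12 :
    -- Negative moments of `Γ[F,F]` in terms of the Hessian.
    (∀ m q : ℕ, ∃ q' : ℕ, ∃ C : ℝ, 0 < C ∧
      ∀ (K : ℕ) (F : MvPolynomial (Fin K) ℝ), F.totalDegree ≤ m →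
        ProbabilityTheory.variance (fun x => MvPolynomial.eval x F)
          (GaussianChaos.wiener (Fin K)) = 1 →
        GaussianChaos.negMoment (GaussianChaos.wiener (Fin K))
            (fun x => MvPolynomial.eval x (GaussianChaos.gammaPoly F)) q
          ≤ ENNReal.ofReal C *
            ∫⁻ x, (GaussianChaos.hessianRemainder q' F x) ^ (-(1 / 2) : ℝ)
              ∂(GaussianChaos.wiener (Fin K))) ∧
    -- The second Wiener chaos.
    (∀ q : ℕ, ∃ C : ℝ, 0 < C ∧
      ∀ F ∈ GaussianChaos.chaos ℕ 2, ∫ x, (F x) ^ 2 ∂(GaussianChaos.wiener ℕ) ≤ 1 →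
        (∃ A : Matrix ℕ ℕ ℝ, GaussianChaos.IsMatrixOf A F) ∧
        ∀ A : Matrix ℕ ℕ ℝ, GaussianChaos.IsMatrixOf A F →
          GaussianChaos.negMoment (GaussianChaos.wiener ℕ) (GaussianChaos.gamma F) q
            ≤ ENNReal.ofReal C *
              (GaussianChaos.matrixRemainder (2 * q + 1) A) ^ (-(1 / 2) : ℝ)) ∧
    -- The iterated sharp operators.
    (∀ m q k : ℕ, k ≤ m → ∃ q' : ℕ, ∃ C : ℝ, 0 < C ∧
      ∀ F ∈ GaussianChaos.chaosLE ℕ m, ∫ x, (F x) ^ 2 ∂(GaussianChaos.wiener ℕ) = 1 →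
        GaussianChaos.negMoment (GaussianChaos.wiener ℕ) (GaussianChaos.gamma F) q
          ≤ ENNReal.ofReal C *
            GaussianChaos.negMoment (GaussianChaos.wiener (ℕ ⊕ (Fin k × ℕ)))
              (GaussianChaos.gamma (GaussianChaos.sharp k F)) q') := by
  refine ⟨GaussianChaos.exists_negMoment_le_hessianRemainder,
    GaussianChaos.exists_negMoment_le_matrixRemainder, fun m q k _ => ?_⟩
  obtain ⟨q', C, hC, h⟩ := GaussianChaos.exists_negMoment_sharp_le m q k
  exact ⟨q', C, hC, fun F hF hF1 => h ℕ F hF hF1⟩
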